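/- Let $g$ be a Lorentzian metric of class $C^2$, with signature $(-,+,+,+)$, on an open set $U\subseteq\mathbb R^4$ (a coordinate patch of a spacetime; no field equation is imposed, so vacuum metrics are included), and let $p\in U$ be a point at which the Weyl tensor $W$ of $g$ is not zero. All the following objects are taken at $p$. Let $*W_{abcd}=\frac12\eta_{abef}W^{ef}{}_{cd}$, where $\eta$ is the metric volume element, and let $$T_{ambn}=\tfrac14\left(W_a{}^r{}_b{}^s\,W_{mrns}+{*W}_a{}^r{}_b{}^s\,{*W}_{mrns}\right)$$ be the Bel-Robinson tensor. An observer is a vector $u$ with $g(u,u)=-1$; $\perp$ denotes projection of every index by $\gamma=g+u\otimes u$. Relative to $u$, put $E=W(u;u)$ and $H={*W}(u;u)$ (that is, $E_{ac}=W_{abcd}u^bu^d$, and similarly for $H$), $q_\perp=-T(u,u,u)_\perp$ (super-Poynting vector), $Q_\perp=-T(u)_\perp$ (stress flux tensor) and $|Q_\perp|=\sqrt{(Q_\perp,Q_\perp)}$. The field is García-Parrado radiative at $p$ if $Q_\perp\neq0$ for every observer, and non-radiative otherwise. An observer $e_0$ is at rest with respect to the field if $q_\perp=0$ for $u=e_0$;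 the tensors $E,H,Q_\perp$ relative to $e_0$ are denoted $E_0,H_0,Q_{0\perp}$ and are called proper. Let $\rho_1,\rho_2,\rho_3\in\mathbb C$ be the eigenvalues, with multiplicity, of $F_{ab}\mapsto\frac12W_{ab}{}^{cd}F_{cd}$ on the complex three-dimensional space of self-dual bivectors. The field is of type I if they are distinct, and of type D if this endomorphism is diagonalizable with eigenvalues $-2\rho,\rho,\rho$, $\rho\ne0$. Put $\alpha=\frac12\sqrt{(T,T)}$ with $(T,T)=T_{abcd}T^{abcd}$, $\xi=\frac14\sum_k|\rho_k|^2$ and $\xi_Q=\sqrt{2\xi^2-\frac12\alpha^2}$. Theorem. If the field is García-Parrado non-radiative at $p$, then it is of type I or D at $p$. Conversely, suppose that the field is of type I or D at $p$. Then there are observers at rest, and for every observer $e_0$ at rest the following conditions are equivalent to each other and to the field being García-Parrado non-radiative at $p$: (i) the proper stress flux tensor vanishes, $Q_{0\perp}=0$; (ii) the proper electric and magnetic Weyl tensors $E_0$ and $H_0$ are linearly dependent, or equivalently $E_0\otimes H_0=H_0\otimes E_0$; (iii) the proper scalar of the stress flux vanishes: $\xi_Q=0$, or equivalently $\inf_u|Q_\perp|=0$,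 the infimum being over all observers $u$; (iv) the Bel-Robinson tensor, as the endomorphism $X_{ab}\mapsto T_{ab}{}^{cd}X_{cd}$ of the nine-dimensional space of traceless symmetric tensors, has only real eigenvalues. -/

import Mathlib

noncomputable section

namespace SuperEnergy

/-! Index notation on a coordinate patch of a four-dimensional spacetime; the signature is
`(-,+,+,+)`. A covariant tensor at a point is the array of its components in the coordinate
basis, `G` is the matrix of the metric at the point and `G⁻¹` the matrix of the inverse metric. -/

abbrev Vec := Fin 4 → ℝ
abbrev Mat := Matrix (Fin 4) (Fin 4) ℝ
abbrev CMat := Matrix (Fin 4) (Fin 4) ℂ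
abbrev Tensor3 := Fin 4 → Fin 4 → Fin 4 → ℝ
abbrev Tensor4 := Fin 4 → Fin 4 → Fin 4 → Fin 4 → ℝ

/-! ### Lorentzian metrics and their curvature -/

/-- A symmetric bilinear form on `ℝ⁴` of signature `(-,+,+,+)`. -/
def IsLorentzian (G : Mat) : Prop :=
  G.IsSymm ∧ ∃ P : Mat, IsUnit P.det ∧ P.transpose * G * P = Matrix.diagonal ![-1, 1, 1, 1]

/-- `g` is a Lorentzian metric of class `C²` on the coordinate domain `U`. -/
structure IsLorentzianMetricOn (g : Vec → Mat) (U : Set Vec) : Prop where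
  isOpen : IsOpen U
  contDiffOn : ∀ a b, ContDiffOn ℝ 2 (fun x => g x a b) U
  lorentzian : ∀ x ∈ U, IsLorentzian (g x)

/-- The partial derivative `∂ₐ f` at `x`. -/
def partialDeriv (a : Fin 4) (f : Vec → ℝ) (x : Vec) : ℝ :=
  fderiv ℝ f x (Pi.single a 1)

/-- The Christoffel symbols `Γ^a_{bc}` of the Levi-Civita connection. -/
def christoffel (g : Vec → Mat) (a b c : Fin 4) (x : Vec) : ℝ :=
  (1 / 2) * ∑ d, (g x)⁻¹ a d *
    (partialDeriv b (fun y => g y d c) x + partialDeriv c (fun y => g y d b) x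
      - partialDeriv d (fun y => g y b c) x)

/-- The curvature `R^a_{bcd} = ∂_c Γ^a_{db} - ∂_d Γ^a_{cb} + Γ^a_{ce} Γ^e_{db} - Γ^a_{de} Γ^e_{cb}`. -/
def riemannUp (g : Vec → Mat) (x : Vec) (a b c d : Fin 4) : ℝ :=
  partialDeriv c (christoffel g a d b) x - partialDeriv d (christoffel g a c b) x
    + ∑ e, (christoffel g a c e x * christoffel g e d b x
      - christoffel g a d e x * christoffel g e c b x)

/-- The curvature `R_{abcd}`. -/
def riemann (g : Vec → Mat) (x : Vec) : Tensor4 :=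
  fun a b c d => ∑ e, g x a e * riemannUp g x e b c d

/-- The Ricci tensor `R_{bd} = R^a_{bad}`. -/
def ricci (g : Vec → Mat) (x : Vec) (b d : Fin 4) : ℝ :=
  ∑ a, riemannUp g x a b a d

/-- The scalar curvature. -/
def scalarCurv (g : Vec → Mat) (x : Vec) : ℝ :=
  ∑ b, ∑ d, (g x)⁻¹ b d * ricci g x b d

/-- The Weyl tensor `W_{abcd}` of a four-dimensional metric at `x`. -/
def weyl (g : Vec → Mat) (x : Vec) : Tensor4 :=
  fun a b c d => riemann g x a b c d
    - (1 / 2) * (g x a c * ricci g x b d - g x a d * ricci g x b c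
        - g x b c * ricci g x a d + g x b d * ricci g x a c)
    + (scalarCurv g x / 6) * (g x a c * g x b d - g x a d * g x b c)

/-! ### Duality -/

/-- The Levi-Civita permutation symbol. -/
def leviCivita (a b c d : Fin 4) : ℝ :=
  Matrix.det (Matrix.of fun i j : Fin 4 => if ![a, b, c, d] i = j then (1 : ℝ) else 0)

/-- The metric volume element `η_{abcd}`. -/
def volumeElement (G : Mat) : Tensor4 :=
  fun a b c d => Real.sqrt (-G.det) * leviCivita a b c d

/-- The dual `*W_{abcd} = ½ η_{abef} W^{ef}_{cd}`. -/
def dual (G : Mat) (W : Tensor4) : Tensor4 :=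
  fun a b c d => (1 / 2) * ∑ e, ∑ f, ∑ m, ∑ n,
    volumeElement G a b e f * G⁻¹ e m * G⁻¹ f n * W m n c d

/-! ### The Bel-Robinson tensor and its invariants -/

/-- `T_{ambn} = ¼ (W_a^r_b^s W_{mrns} + *W_a^r_b^s *W_{mrns})`. -/
def belRobinson (G : Mat) (W : Tensor4) : Tensor4 :=
  fun a m b n => (1 / 4) * ∑ r, ∑ s, ∑ r', ∑ s', G⁻¹ r r' * G⁻¹ s s' *
    (W a r b s * W m r' n s' + dual G W a r b s * dual G W m r' n s')

/-- The invariant `α = ½ √(T,T)`. -/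
def alpha (G : Mat) (W : Tensor4) : ℝ :=
  (1 / 2) * Real.sqrt (∑ a, ∑ b, ∑ c, ∑ d, ∑ a', ∑ b', ∑ c', ∑ d',
    G⁻¹ a a' * G⁻¹ b b' * G⁻¹ c c' * G⁻¹ d d' *
      belRobinson G W a b c d * belRobinson G W a' b' c' d')

/-- The Bel-Robinson tensor as an endomorphism `X_{ab} ↦ T_{ab}^{cd} X_{cd}` of the
(complexified) covariant 2-tensors. -/
def belRobinsonApply (G : Mat) (W : Tensor4) (X : CMat) : CMat :=
  Matrix.of fun a b => ∑ c, ∑ d, ∑ c', ∑ d',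
    ((belRobinson G W a b c d * G⁻¹ c c' * G⁻¹ d d' : ℝ) : ℂ) * X c' d'

/-- `z` is an eigenvalue of the Bel-Robinson tensor, seen as an endomorphism of the
nine-dimensional space of the traceless symmetric tensors (complexified, so that non-real
eigenvalues are seen). -/
def IsBelRobinsonEigenvalue (G : Mat) (W : Tensor4) (z : ℂ) : Prop :=
  ∃ X : CMat, X ≠ 0 ∧ X.IsSymm ∧ (∑ a, ∑ b, ((G⁻¹ a b : ℝ) : ℂ) * X a b = 0) ∧
    belRobinsonApply G W X = z • X

/-! ### The Weyl endomorphism on self-dual bivectors and the Petrov-Bel types -/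

/-- The endomorphism `F_{ab} ↦ ½ W_{ab}^{cd} F_{cd}`. -/
def bivectorMap (G : Mat) (W : Tensor4) : CMat →ₗ[ℂ] CMat where
  toFun F := Matrix.of fun a b => (1 / 2) * ∑ c, ∑ d, ∑ c', ∑ d',
    ((W a b c d * G⁻¹ c c' * G⁻¹ d d' : ℝ) : ℂ) * F c' d'
  map_add' F F' := by
    ext a b
    simp only [Matrix.of_apply, Matrix.add_apply, mul_add, Finset.sum_add_distrib]
  map_smul' z F := by
    ext a b
    simp only [Matrix.of_apply, Matrix.smul_apply, smul_eq_mul, RingHom.id_apply,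
      Finset.mul_sum]
    refine Finset.sum_congr rfl fun _ _ => Finset.sum_congr rfl fun _ _ =>
      Finset.sum_congr rfl fun _ _ => Finset.sum_congr rfl fun _ _ => ?_
    ring

/-- The projection `F ↦ ½ (A - i *A)`, with `A = ½ (F - Fᵀ)` and `*A_{ab} = ½ η_{ab}^{cd} A_{cd}`,
of the complex 2-tensors onto the self-dual bivectors (those with `*A = i A`). -/
def selfDualProj (G : Mat) : CMat →ₗ[ℂ] CMat :=
  (1 / 2 : ℂ) • (LinearMap.id - Complex.I • bivectorMap G (volumeElement G)) ∘ₗ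
    ((1 / 2 : ℂ) • (LinearMap.id - (Matrix.transposeLinearEquiv (Fin 4) (Fin 4) ℂ ℂ).toLinearMap))

/-- The complex three-dimensional space of the self-dual bivectors. -/
abbrev SelfDual (G : Mat) : Submodule ℂ CMat := LinearMap.range (selfDualProj G)

/-- The Weyl tensor as an endomorphism of the space of the self-dual bivectors. (A Weyl tensor
preserves this space; the projection is then the identity and is there for typing only.) -/
def weylEnd (G : Mat) (W : Tensor4) : Module.End ℂ (SelfDual G) :=
  (selfDualProj G).rangeRestrict ∘ₗ bivectorMap G W ∘ₗ (SelfDual G).subtype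

/-- Petrov-Bel type I: three different Weyl eigenvalues. -/
def IsTypeI (G : Mat) (W : Tensor4) : Prop :=
  ∃ ρ : Fin 3 → ℂ, Function.Injective ρ ∧ ∀ k, (weylEnd G W).HasEigenvalue (ρ k)

/-- Petrov-Bel type D: a diagonalizable Weyl endomorphism, with eigenvalues
`-2ρ, ρ, ρ` and `ρ ≠ 0`. -/
def IsTypeD (G : Mat) (W : Tensor4) : Prop :=
  ∃ ρ : ℂ, ρ ≠ 0 ∧ (weylEnd G W).HasEigenvalue (-2 * ρ) ∧
    Module.finrank ℂ ((weylEnd G W).eigenspace ρ) = 2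

/-- The invariant `ξ = ¼ ∑ tₖ`, with `tₖ = |ρₖ|²` for the three Weyl eigenvalues `ρₖ`, repeated
according to their multiplicity as roots of the characteristic polynomial. -/
def xi (G : Mat) (W : Tensor4) : ℝ :=
  (1 / 4) * ((weylEnd G W).charpoly.roots.map fun ρ => ‖ρ‖ ^ 2).sum

/-- The scalar `ξ_Q = √(2 ξ² - ½ α²)`. -/
def xiQ (G : Mat) (W : Tensor4) : ℝ :=
  Real.sqrt (2 * xi G W ^ 2 - (1 / 2) * alpha G W ^ 2)

/-! ### Observers and relative quantities -/

/-- An observer at the point: a unit timelike vector `u`. -/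
def IsObserver (G : Mat) (u : Vec) : Prop :=
  ∑ a, ∑ b, G a b * u a * u b = -1

/-- The electric field `E = W(u;u)`, i.e. `E_{ac} = W_{abcd} u^b u^d`. -/
def electric (W : Tensor4) (u : Vec) : Mat :=
  Matrix.of fun a c => ∑ b, ∑ d, W a b c d * u b * u d

/-- The magnetic field `H = *W(u;u)`. -/
def magnetic (G : Mat) (W : Tensor4) (u : Vec) : Mat := electric (dual G W) u

/-- The projector `γ^a_b = δ^a_b + u^a u_b` orthogonal to `u`. -/
def projector (G : Mat) (u : Vec) (a b : Fin 4) : ℝ :=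
  (if a = b then 1 else 0) + u a * ∑ c, G b c * u c

/-- The super-Poynting vector `q_⊥ = -T(u,u,u)_⊥`. -/
def superPoynting (G : Mat) (W : Tensor4) (u : Vec) : Vec :=
  fun a => -∑ a', ∑ b, ∑ c, ∑ d, projector G u a' a *
    belRobinson G W a' b c d * u b * u c * u d

/-- The stress flux tensor `Q_⊥ = -T(u)_⊥`. -/
def stressFlux (G : Mat) (W : Tensor4) (u : Vec) : Tensor3 :=
  fun a b c => -∑ a', ∑ b', ∑ c', ∑ d, projector G u a' a * projector G u b' b *
    projector G u c' c * belRobinson G W a' b' c' d * u d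

/-- The super-energy scalar `|Q_⊥| = √(Q_⊥, Q_⊥)`. -/
def stressFluxScalar (G : Mat) (W : Tensor4) (u : Vec) : ℝ :=
  Real.sqrt (∑ a, ∑ b, ∑ c, ∑ a', ∑ b', ∑ c', G⁻¹ a a' * G⁻¹ b b' * G⁻¹ c c' *
    stressFlux G W u a b c * stressFlux G W u a' b' c')

/-- The proper scalar of the stress flux: the infimum of `|Q_⊥|` for all the observers. -/
def properStressFluxScalar (G : Mat) (W : Tensor4) : ℝ :=
  sInf (stressFluxScalar G W '' {u | IsObserver G u})

/-- Observers at rest with respect to the field: those with vanishing super-Poynting vector. The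
relative quantities of such an observer are the proper ones. -/
def IsAtRest (G : Mat) (W : Tensor4) (e₀ : Vec) : Prop :=
  IsObserver G e₀ ∧ superPoynting G W e₀ = 0

/-- García-Parrado radiation at the point: the stress flux tensor does not vanish for any
observer. -/
def IsRadiative (G : Mat) (W : Tensor4) : Prop :=
  ∀ u, IsObserver G u → stressFlux G W u ≠ 0

end SuperEnergy

end

/-! In an oriented orthonormal frame a Weyl tensor is a pair of symmetric traceless 3×3 matrices E
and H, and its endomorphism of the self-dual bivectors has the matrix M = -E + iH
(`exists_weylEnd_conj`). Rotations and boosts act on M as congruences by complex orthogonal matrices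
(`HasParts.rot`, `HasParts.boost`). The super-Poynting vector is a multiple of the axial vector of
[E, H], so an observer is at rest exactly when E and H commute in its frames; a rotation then makes
both diagonal.

If the stress flux vanishes for some observer, so do its traces, which are the components of the
super-Poynting vector. Hence M becomes diagonal in a frame of that observer, and a nonzero traceless
diagonal M is of type I or D (`isTypeI_or_isTypeD_of_not_isRadiative`). Conversely, in types I and D
the symmetric matrix M is diagonalizable, so it has an eigenvector that is not null. A rotation and
a boost carry it to a coordinate axis, which leaves a 2×2 block, and a boost along that axis makes
the real and imaginary parts of the block commute (`exists_mul_comm`).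

For an observer at rest write E = diag(x, y, -x-y), H = diag(x', y', -x'-y') and δ = xy' - yx'.
Every condition reduces to δ = 0: the stress flux has only the components T_{1230} = -δ/2 and their
permutations, E and H are dependent iff δ = 0, 2ξ² - α²/2 = 3δ²/2, and the Bel-Robinson eigenvalues
include -2A ± iδ with A real, all of them being real if δ = 0.

The conditions that involve all observers need a bound independent of the frame
(`le_stressFluxScalar`). The Gram determinant |E|²|H|² - (E·H)² is at most 24|Q|², the trace of M²
is invariant, and Schur's inequality gives 4ξ ≤ |E|² + |H|². Together these yield 16ξ² - |tr M²|² ≤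
96|Q|² for every observer, and the left side is 12δ². -/

noncomputable section

namespace SuperEnergy

open Matrix
open scoped Kronecker

/-! ### Change of basis -/

/-- The components of a covariant 4-tensor in the basis formed by the columns of `P`. -/
def pull (P : Mat) (T : Tensor4) : Tensor4 := fun a b c d =>
  ∑ k, ∑ l, ∑ i, ∑ j, P i a * P j b * P k c * P l d * T i j k l

/-- A 4-tensor as a matrix whose rows and columns are indexed by pairs. -/
def flat (T : Tensor4) : Matrix (Fin 4 × Fin 4) (Fin 4 × Fin 4) ℝ :=
  of fun x y => T x.1 x.2 y.1 y.2

/-- Exchange of the two middle indices. -/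
def swapMid (T : Tensor4) : Tensor4 := fun a b c d => T a c b d

theorem flat_injective : Function.Injective flat := by
  intro S T h
  funext a b c d
  exact congrFun (congrFun h (a, b)) (c, d)

/-- Written on pairs of indices, a change of basis is a congruence by P ⊗ P and a contraction is a
matrix product, so covariance statements reduce to associativity. -/
theorem flat_pull (P : Mat) (T : Tensor4) :
    flat (pull P T) = (P ⊗ₖ P)ᵀ * flat T * (P ⊗ₖ P) := by
  ext ⟨a, b⟩ ⟨c, d⟩
  simp only [flat, pull, of_apply, mul_apply, Fintype.sum_prod_type, transpose_apply,
    kronecker_apply, Finset.sum_mul]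
  refine Finset.sum_congr rfl fun _ _ => Finset.sum_congr rfl fun _ _ =>
      Finset.sum_congr rfl fun _ _ => Finset.sum_congr rfl fun _ _ => ?_
  ring

theorem sum_quad (f : Fin 4 → Fin 4 → Fin 4 → Fin 4 → ℝ) : ∑ i, ∑ j, ∑ k, ∑ l, f i j k l =
    ∑ x : Fin 4 × Fin 4 × Fin 4 × Fin 4, f x.1 x.2.1 x.2.2.1 x.2.2.2 := by
  simp only [Fintype.sum_prod_type]

theorem sum_quad_swap (f : Fin 4 → Fin 4 → Fin 4 → Fin 4 → ℝ) :
    ∑ k, ∑ l, ∑ i, ∑ j, f i j k l = ∑ i, ∑ j, ∑ k, ∑ l, f i j k l := by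
  rw [sum_quad fun k l i j => f i j k l, sum_quad]
  exact Fintype.sum_equiv
    ⟨fun x => (x.2.2.1, x.2.2.2, x.1, x.2.1), fun x => (x.2.2.1, x.2.2.2, x.1, x.2.1),
      fun _ => rfl, fun _ => rfl⟩ _ _ fun _ => rfl

theorem swapMid_pull (P : Mat) (T : Tensor4) : swapMid (pull P T) = pull P (swapMid T) := by
  funext a b c d
  have h (f : Fin 4 → Fin 4 → Fin 4 → Fin 4 → ℝ) :
      ∑ k, ∑ l, ∑ i, ∑ j, f i j k l = ∑ k, ∑ l, ∑ i, ∑ j, f i k j l := by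
    rw [sum_quad fun k l i j => f i j k l, sum_quad fun k l i j => f i k j l]
    exact Fintype.sum_equiv
      ⟨fun x => (x.2.2.2, x.2.1, x.2.2.1, x.1), fun x => (x.2.2.2, x.2.1, x.2.2.1, x.1),
        fun _ => rfl, fun _ => rfl⟩ _ _ fun _ => rfl
  simp only [swapMid, pull]
  rw [h]
  refine Finset.sum_congr rfl fun _ _ => Finset.sum_congr rfl fun _ _ =>
      Finset.sum_congr rfl fun _ _ => Finset.sum_congr rfl fun _ _ => ?_
  ring

theorem swapMid_injective : Function.Injective swapMid := by
  intro S T h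
  funext a b c d
  exact congrFun (congrFun (congrFun (congrFun h a) c) b) d

theorem flat_dual (G : Mat) (W : Tensor4) :
    flat (dual G W) = (1 / 2 : ℝ) • (flat (volumeElement G) * ((G⁻¹ ⊗ₖ G⁻¹) * flat W)) := by
  ext ⟨a, b⟩ ⟨c, d⟩
  simp only [flat, dual, of_apply, mul_apply, Fintype.sum_prod_type, Matrix.smul_apply, smul_eq_mul,
    kronecker_apply, Finset.mul_sum, mul_assoc]

/-- Exchanging the middle indices puts the contracted indices r, s side by side, which makes the
Bel-Robinson tensor a sum of two matrix products A K Aᵀ. -/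
theorem flat_swapMid_belRobinson (G : Mat) (W : Tensor4) :
    flat (swapMid (belRobinson G W)) = (1 / 4 : ℝ) •
      (flat (swapMid W) * ((G⁻¹ ⊗ₖ G⁻¹) * (flat (swapMid W))ᵀ) +
        flat (swapMid (dual G W)) * ((G⁻¹ ⊗ₖ G⁻¹) * (flat (swapMid (dual G W)))ᵀ)) := by
  ext ⟨a, b⟩ ⟨c, d⟩
  simp only [flat, swapMid, belRobinson, of_apply, mul_apply, Fintype.sum_prod_type, Matrix.smul_apply,
    smul_eq_mul, kronecker_apply, Finset.mul_sum, transpose_apply, Matrix.add_apply,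
    ← Finset.sum_add_distrib]
  refine Finset.sum_congr rfl fun _ _ => Finset.sum_congr rfl fun _ _ =>
      Finset.sum_congr rfl fun _ _ => Finset.sum_congr rfl fun _ _ => ?_
  ring

/-- The transformation law of the inverse metric; it absorbs the factors P and Pᵀ on either side of
each contraction. -/
theorem mul_inv_congruence_mul (P G : Mat) (hP : IsUnit P.det) :
    P * (Pᵀ * G * P)⁻¹ * Pᵀ = G⁻¹ := by
  have hPt : IsUnit Pᵀ.det := by rwa [det_transpose]
  rw [Matrix.mul_inv_rev, Matrix.mul_inv_rev]
  calc P * (P⁻¹ * (G⁻¹ * Pᵀ⁻¹)) * Pᵀ = (P * P⁻¹) * G⁻¹ * (Pᵀ⁻¹ * Pᵀ) := by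
        simp only [Matrix.mul_assoc]
    _ = G⁻¹ := by rw [mul_nonsing_inv _ hP, nonsing_inv_mul _ hPt, one_mul, mul_one]

theorem kronecker_inv_congruence (P G : Mat) (hP : IsUnit P.det) :
    (P ⊗ₖ P) * ((Pᵀ * G * P)⁻¹ ⊗ₖ (Pᵀ * G * P)⁻¹) * (P ⊗ₖ P)ᵀ = G⁻¹ ⊗ₖ G⁻¹ := by
  have h : (P ⊗ₖ P)ᵀ = Pᵀ ⊗ₖ Pᵀ := kroneckerMap_transpose _ _ _
  rw [h, ← mul_kronecker_mul, ← mul_kronecker_mul, mul_inv_congruence_mul P G hP]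

/-- Contractions of tensors commute with a change of basis. -/
theorem flat_pull_mul_kronecker_mul (P G : Mat) (hP : IsUnit P.det)
    (A B : Matrix (Fin 4 × Fin 4) (Fin 4 × Fin 4) ℝ) :
    ((P ⊗ₖ P)ᵀ * A * (P ⊗ₖ P)) * (((Pᵀ * G * P)⁻¹ ⊗ₖ (Pᵀ * G * P)⁻¹) *
        ((P ⊗ₖ P)ᵀ * B * (P ⊗ₖ P))) =
      (P ⊗ₖ P)ᵀ * (A * ((G⁻¹ ⊗ₖ G⁻¹) * B)) * (P ⊗ₖ P) := by
  rw [← kronecker_inv_congruence P G hP]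
  simp only [Matrix.mul_assoc]

/-- The quadruples of indices as functions. -/
def quadEquiv : (Fin 4 × Fin 4 × Fin 4 × Fin 4) ≃ (Fin 4 → Fin 4) where
  toFun x := ![x.1, x.2.1, x.2.2.1, x.2.2.2]
  invFun f := (f 0, f 1, f 2, f 3)
  left_inv _ := rfl
  right_inv f := by
    funext i
    fin_cases i <;> rfl

theorem det_eq_sum_leviCivita (N : Mat) : N.det = ∑ i, ∑ j, ∑ k, ∑ l,
    N 0 i * N 1 j * N 2 k * N 3 l * leviCivita i j k l := by
  have e (i : Fin 4) : N i = ∑ j, N i j • (Pi.single j 1 : Fin 4 → ℝ) := by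
    ext k; simp [Finset.sum_apply, Pi.single_apply]
  have h := (detRowAlternating (R := ℝ) (n := Fin 4)).toMultilinearMap.map_sum
    (fun i j => N i j • (Pi.single j 1 : Fin 4 → ℝ))
  rw [show (fun i => ∑ j, N i j • (Pi.single j 1 : Fin 4 → ℝ)) = N from
    funext fun i => (e i).symm] at h
  change N.det = _ at h
  rw [h, ← Equiv.sum_comp quadEquiv]
  simp only [Fintype.sum_prod_type]
  refine Finset.sum_congr rfl fun i _ => Finset.sum_congr rfl fun j _ =>
      Finset.sum_congr rfl fun k _ => Finset.sum_congr rfl fun l _ => ?_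
  rw [MultilinearMap.map_smul_univ, smul_eq_mul, Fin.prod_univ_four]
  refine congrArg₂ (· * ·) rfl ?_
  change det _ = det _
  congr 1
  ext r s
  change (Pi.single (![i, j, k, l] r) 1 : Fin 4 → ℝ) s = if ![i, j, k, l] r = s then 1 else 0
  simp [Pi.single_apply, eq_comm]

/-- The 0-1 matrix that defines the symbol selects columns of P, so both sides expand the
determinant of its product with Pᵀ. -/
theorem sum_prod_mul_leviCivita (P : Mat) (a b c d : Fin 4) :
    ∑ i, ∑ j, ∑ k, ∑ l, P i a * P j b * P k c * P l d * leviCivita i j k l =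
      P.det * leviCivita a b c d := by
  have h := det_eq_sum_leviCivita
    ((of fun i j : Fin 4 => if ![a, b, c, d] i = j then (1 : ℝ) else 0) * Pᵀ)
  rw [det_mul, det_transpose, mul_comm] at h
  have row (r x : Fin 4) : ((of fun i j : Fin 4 => if ![a, b, c, d] i = j then (1 : ℝ) else 0) *
      Pᵀ) r x = P x (![a, b, c, d] r) := by
    simp [mul_apply]
  rw [leviCivita, h]
  simp only [row]
  rfl

theorem pull_eq_sum (P : Mat) (T : Tensor4) (a b c d : Fin 4) : pull P T a b c d =
    ∑ i, ∑ j, ∑ k, ∑ l, P i a * P j b * P k c * P l d * T i j k l := by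
  simp only [pull]
  exact sum_quad_swap fun i j k l => P i a * P j b * P k c * P l d * T i j k l

/-- The square root produces |det P| while the permutation symbol produces det P; hence the
restriction to oriented changes of basis. -/
theorem pull_volumeElement (P G : Mat) (hP : 0 < P.det) :
    pull P (volumeElement G) = volumeElement (Pᵀ * G * P) := by
  funext a b c d
  have hd : (Pᵀ * G * P).det = P.det ^ 2 * G.det := by
    rw [det_mul, det_mul, det_transpose]; ring
  have hs : √(-(Pᵀ * G * P).det) = P.det * √(-G.det) := by
    rw [hd, ← mul_neg, Real.sqrt_mul (sq_nonneg _), Real.sqrt_sq hP.le]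
  rw [volumeElement, hs, mul_right_comm, ← sum_prod_mul_leviCivita, pull_eq_sum]
  simp only [volumeElement, Finset.sum_mul]
  refine Finset.sum_congr rfl fun _ _ => Finset.sum_congr rfl fun _ _ =>
      Finset.sum_congr rfl fun _ _ => Finset.sum_congr rfl fun _ _ => ?_
  ring

theorem pull_dual (P G : Mat) (hP : 0 < P.det) (W : Tensor4) :
    dual (Pᵀ * G * P) (pull P W) = pull P (dual G W) := by
  apply flat_injective
  rw [flat_dual, ← pull_volumeElement P G hP, flat_pull, flat_pull, flat_pull, flat_dual,
    flat_pull_mul_kronecker_mul P G hP.ne'.isUnit, Matrix.mul_smul, Matrix.smul_mul]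

theorem pull_belRobinson (P G : Mat) (hP : 0 < P.det) (W : Tensor4) :
    belRobinson (Pᵀ * G * P) (pull P W) = pull P (belRobinson G W) := by
  have ht (A : Matrix (Fin 4 × Fin 4) (Fin 4 × Fin 4) ℝ) :
      ((P ⊗ₖ P)ᵀ * A * (P ⊗ₖ P))ᵀ = (P ⊗ₖ P)ᵀ * Aᵀ * (P ⊗ₖ P) := by
    simp only [transpose_mul, transpose_transpose, Matrix.mul_assoc]
  apply swapMid_injective
  apply flat_injective
  rw [flat_swapMid_belRobinson, pull_dual P G hP, swapMid_pull, swapMid_pull, swapMid_pull,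
    flat_pull, flat_pull, flat_pull, ht, ht, flat_pull_mul_kronecker_mul P G hP.ne'.isUnit,
    flat_pull_mul_kronecker_mul P G hP.ne'.isUnit, flat_swapMid_belRobinson, Matrix.mul_smul,
    Matrix.smul_mul, Matrix.mul_add, Matrix.add_mul]

end SuperEnergy
end

noncomputable section

namespace SuperEnergy

open Matrix
open scoped Kronecker

/-! ### Covariance of the relative quantities and of the invariants -/

/-- A matrix as a vector indexed by pairs. -/
def vec2 {R : Type*} (M : Matrix (Fin 4) (Fin 4) R) : Fin 4 × Fin 4 → R := fun x => M x.1 x.2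

theorem vec2_injective {R : Type*} : Function.Injective (vec2 (R := R)) := by
  intro M N h
  ext a b
  exact congrFun h (a, b)

theorem vec2_congruence {R : Type*} [CommRing R] (P M : Matrix (Fin 4) (Fin 4) R) :
    vec2 (Pᵀ * M * P) = (P ⊗ₖ P)ᵀ *ᵥ vec2 M := by
  ext ⟨a, b⟩
  simp only [vec2, mul_apply, mulVec, dotProduct, transpose_apply, kronecker_apply,
    Fintype.sum_prod_type, Finset.sum_mul]
  rw [Finset.sum_comm]
  refine Finset.sum_congr rfl fun _ _ => Finset.sum_congr rfl fun _ _ => ?_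
  ring

/-- The contraction of the last two indices with a vector. -/
def quad (T : Tensor4) (u : Vec) : Mat := of fun a b => ∑ c, ∑ d, T a b c d * u c * u d

theorem vec2_quad (T : Tensor4) (u : Vec) :
    vec2 (quad T u) = flat T *ᵥ fun x => u x.1 * u x.2 := by
  ext ⟨a, b⟩
  simp only [vec2, quad, of_apply, flat, mulVec, dotProduct, Fintype.sum_prod_type, mul_assoc]

theorem quad_pull (P : Mat) (T : Tensor4) (v : Vec) :
    quad (pull P T) v = Pᵀ * quad T (P *ᵥ v) * P := by
  apply vec2_injective
  have h : (P ⊗ₖ P) *ᵥ (fun x => v x.1 * v x.2) = fun x => (P *ᵥ v) x.1 * (P *ᵥ v) x.2 := by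
    ext ⟨a, b⟩
    simp only [mulVec, dotProduct, kronecker_apply, Fintype.sum_prod_type, Finset.sum_mul_sum]
    refine Finset.sum_congr rfl fun _ _ => Finset.sum_congr rfl fun _ _ => ?_
    ring
  rw [vec2_congruence, vec2_quad, vec2_quad, flat_pull, ← h, mulVec_mulVec, mulVec_mulVec,
    Matrix.mul_assoc]

theorem electric_eq_quad (W : Tensor4) (u : Vec) : electric W u = quad (swapMid W) u := rfl

theorem electric_pull (P : Mat) (W : Tensor4) (v : Vec) :
    electric (pull P W) v = Pᵀ * electric W (P *ᵥ v) * P := by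
  rw [electric_eq_quad, electric_eq_quad, swapMid_pull, quad_pull]

theorem magnetic_pull (P G : Mat) (hP : 0 < P.det) (W : Tensor4) (v : Vec) :
    magnetic (Pᵀ * G * P) (pull P W) v = Pᵀ * magnetic G W (P *ᵥ v) * P := by
  rw [magnetic, magnetic, pull_dual P G hP, electric_pull]

theorem of_projector (G : Mat) (u : Vec) :
    of (projector G u) = 1 + vecMulVec u (G *ᵥ u) := by
  ext a b
  simp [projector, vecMulVec_apply, mulVec, dotProduct, one_apply]

theorem mul_projector (P G : Mat) (v : Vec) :
    P * of (projector (Pᵀ * G * P) v) = of (projector G (P *ᵥ v)) * P := by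
  rw [of_projector, of_projector, Matrix.mul_add, Matrix.add_mul, mul_vecMulVec, vecMulVec_mul,
    ← mulVec_transpose, mulVec_mulVec, mulVec_mulVec, Matrix.mul_one, Matrix.one_mul,
    Matrix.mul_assoc]

theorem superPoynting_eq (G : Mat) (W : Tensor4) (u : Vec) :
    superPoynting G W u = -((of (projector G u))ᵀ *ᵥ (quad (belRobinson G W) u *ᵥ u)) := by
  ext a
  simp only [superPoynting, quad, mulVec, dotProduct, of_apply, transpose_apply, Pi.neg_apply,
    Finset.mul_sum, Finset.sum_mul]
  congr 1
  refine Finset.sum_congr rfl fun _ _ => Finset.sum_congr rfl fun _ _ =>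
      Finset.sum_congr rfl fun _ _ => Finset.sum_congr rfl fun _ _ => ?_
  ring

theorem superPoynting_pull (P G : Mat) (hP : 0 < P.det) (W : Tensor4) (v : Vec) :
    superPoynting (Pᵀ * G * P) (pull P W) v = Pᵀ *ᵥ superPoynting G W (P *ᵥ v) := by
  rw [superPoynting_eq, superPoynting_eq, pull_belRobinson P G hP, quad_pull, mulVec_neg]
  simp only [mulVec_mulVec]
  rw [← Matrix.mul_assoc, ← Matrix.mul_assoc, ← Matrix.mul_assoc, ← transpose_mul, mul_projector,
    transpose_mul]
  simp only [Matrix.mul_assoc]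

/-- The contraction of the last index with a vector. -/
def contr (T : Tensor4) (u : Vec) : Tensor3 := fun a b c => ∑ d, T a b c d * u d

/-- The components of a covariant 3-tensor in the basis formed by the columns of `P`. -/
def pull3 (P : Mat) (S : Tensor3) : Tensor3 := fun a b c =>
  ∑ i, ∑ j, ∑ k, P i a * P j b * P k c * S i j k

/-- A 3-tensor as a vector. -/
def vec3 (S : Tensor3) : (Fin 4 × Fin 4) × Fin 4 → ℝ := fun x => S x.1.1 x.1.2 x.2

theorem vec3_injective : Function.Injective vec3 := by
  intro S T h
  funext a b c
  exact congrFun h ((a, b), c)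

theorem vec3_pull3 (P : Mat) (S : Tensor3) :
    vec3 (pull3 P S) = ((P ⊗ₖ P) ⊗ₖ P)ᵀ *ᵥ vec3 S := by
  ext ⟨⟨a, b⟩, c⟩
  simp only [vec3, pull3, mulVec, dotProduct, transpose_apply, kronecker_apply,
    Fintype.sum_prod_type]

theorem pull3_mul (P R : Mat) (S : Tensor3) : pull3 (P * R) S = pull3 R (pull3 P S) := by
  apply vec3_injective
  rw [vec3_pull3, vec3_pull3, vec3_pull3, mulVec_mulVec, ← transpose_mul, mul_kronecker_mul,
    mul_kronecker_mul]

theorem contr_pull (P : Mat) (T : Tensor4) (v : Vec) :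
    contr (pull P T) v = pull3 P (contr T (P *ᵥ v)) := by
  funext a b c
  simp only [contr, pull3, pull_eq_sum, mulVec, dotProduct, Finset.mul_sum, Finset.sum_mul]
  rw [Finset.sum_comm]
  refine Finset.sum_congr rfl fun _ _ => ?_
  rw [Finset.sum_comm]
  refine Finset.sum_congr rfl fun _ _ => ?_
  rw [Finset.sum_comm]
  refine Finset.sum_congr rfl fun _ _ => ?_
  rw [Finset.sum_comm]
  refine Finset.sum_congr rfl fun _ _ => Finset.sum_congr rfl fun _ _ => ?_
  ring

theorem stressFlux_eq (G : Mat) (W : Tensor4) (u : Vec) :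
    stressFlux G W u = -pull3 (of (projector G u)) (contr (belRobinson G W) u) := by
  funext a b c
  simp only [stressFlux, pull3, contr, of_apply, Pi.neg_apply, Finset.mul_sum, mul_assoc]

theorem pull3_neg (P : Mat) (S : Tensor3) : pull3 P (-S) = -pull3 P S := by
  funext a b c
  simp [pull3]

theorem stressFlux_pull (P G : Mat) (hP : 0 < P.det) (W : Tensor4) (v : Vec) :
    stressFlux (Pᵀ * G * P) (pull P W) v = pull3 P (stressFlux G W (P *ᵥ v)) := by
  rw [stressFlux_eq, stressFlux_eq, pull_belRobinson P G hP, contr_pull, pull3_neg, ← pull3_mul,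
    ← pull3_mul, mul_projector]

theorem stressFluxScalar_eq (G : Mat) (W : Tensor4) (u : Vec) :
    stressFluxScalar G W u = √(vec3 (stressFlux G W u) ⬝ᵥ
      (((G⁻¹ ⊗ₖ G⁻¹) ⊗ₖ G⁻¹) *ᵥ vec3 (stressFlux G W u))) := by
  simp only [stressFluxScalar, vec3, mulVec, dotProduct, kronecker_apply, Fintype.sum_prod_type,
    Finset.mul_sum]
  refine congrArg Real.sqrt ?_
  refine Finset.sum_congr rfl fun _ _ => Finset.sum_congr rfl fun _ _ =>
      Finset.sum_congr rfl fun _ _ => Finset.sum_congr rfl fun _ _ =>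
      Finset.sum_congr rfl fun _ _ => Finset.sum_congr rfl fun _ _ => ?_
  ring

theorem stressFluxScalar_pull (P G : Mat) (hP : 0 < P.det) (W : Tensor4) (v : Vec) :
    stressFluxScalar (Pᵀ * G * P) (pull P W) v = stressFluxScalar G W (P *ᵥ v) := by
  have ht (A : Matrix ((Fin 4 × Fin 4) × Fin 4) ((Fin 4 × Fin 4) × Fin 4) ℝ)
      (x y : (Fin 4 × Fin 4) × Fin 4 → ℝ) : (Aᵀ *ᵥ x) ⬝ᵥ y = x ⬝ᵥ (A *ᵥ y) := by
    rw [mulVec_transpose, dotProduct_mulVec]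
  have h3 : ((P ⊗ₖ P) ⊗ₖ P)ᵀ = (Pᵀ ⊗ₖ Pᵀ) ⊗ₖ Pᵀ := by
    rw [← kroneckerMap_transpose, ← kroneckerMap_transpose]
  rw [stressFluxScalar_eq, stressFluxScalar_eq, stressFlux_pull P G hP, vec3_pull3, ht,
    mulVec_mulVec, mulVec_mulVec, h3, ← mul_kronecker_mul, ← mul_kronecker_mul,
    ← mul_kronecker_mul, ← mul_kronecker_mul,
    mul_inv_congruence_mul P G hP.ne'.isUnit]

theorem alpha_eq (G : Mat) (W : Tensor4) : alpha G W = (1 / 2) * √(trace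
    ((flat (belRobinson G W))ᵀ * ((G⁻¹ ⊗ₖ G⁻¹) * (flat (belRobinson G W) * (G⁻¹ ⊗ₖ G⁻¹)ᵀ)))) := by
  simp only [alpha, trace, diag_apply, mul_apply, flat, of_apply, transpose_apply,
    kronecker_apply, Fintype.sum_prod_type, Finset.mul_sum]
  refine congrArg (fun x => 1 / 2 * √x) ?_
  rw [← sum_quad_swap]
  refine Finset.sum_congr rfl fun _ _ => Finset.sum_congr rfl fun _ _ =>
      Finset.sum_congr rfl fun _ _ => Finset.sum_congr rfl fun _ _ =>
      Finset.sum_congr rfl fun _ _ => Finset.sum_congr rfl fun _ _ =>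
      Finset.sum_congr rfl fun _ _ => Finset.sum_congr rfl fun _ _ => ?_
  ring

theorem alpha_pull (P G : Mat) (hP : 0 < P.det) (W : Tensor4) :
    alpha (Pᵀ * G * P) (pull P W) = alpha G W := by
  rw [alpha_eq, alpha_eq, pull_belRobinson P G hP, flat_pull,
    ← kronecker_inv_congruence P G hP.ne'.isUnit]
  simp only [transpose_mul, transpose_transpose, Matrix.mul_assoc]
  rw [trace_mul_comm (P ⊗ₖ P)ᵀ]
  simp only [Matrix.mul_assoc]

/-- The complex 2-tensor `F` in the basis formed by the columns of `P`. -/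
def congrC (P : Mat) (F : CMat) : CMat := (P.map Complex.ofReal)ᵀ * F * P.map Complex.ofReal

theorem kronecker_map_ofReal (A B : Mat) :
    (A ⊗ₖ B).map Complex.ofReal = A.map Complex.ofReal ⊗ₖ B.map Complex.ofReal := by
  ext ⟨a, b⟩ ⟨c, d⟩
  simp

/-- The action of a real 4-tensor on the complex 2-tensors. -/
def tensorApply (G : Mat) (T : Tensor4) (F : CMat) : CMat :=
  of fun a b => ∑ c, ∑ d, ∑ c', ∑ d',
    ((T a b c d * G⁻¹ c c' * G⁻¹ d d' : ℝ) : ℂ) * F c' d'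

theorem belRobinsonApply_eq (G : Mat) (W : Tensor4) (X : CMat) :
    belRobinsonApply G W X = tensorApply G (belRobinson G W) X := rfl

theorem bivectorMap_eq (G : Mat) (W : Tensor4) (F : CMat) :
    bivectorMap G W F = (1 / 2 : ℂ) • tensorApply G W F := rfl

theorem vec2_tensorApply (G : Mat) (T : Tensor4) (F : CMat) :
    vec2 (tensorApply G T F) =
      (flat T * (G⁻¹ ⊗ₖ G⁻¹)).map Complex.ofReal *ᵥ vec2 F := by
  ext ⟨a, b⟩
  have h : (flat T * (G⁻¹ ⊗ₖ G⁻¹)).map Complex.ofReal =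
      (flat T).map Complex.ofReal * (G⁻¹ ⊗ₖ G⁻¹).map Complex.ofReal :=
    Matrix.map_mul (f := Complex.ofRealHom)
  rw [h, ← mulVec_mulVec]
  simp only [vec2, tensorApply, of_apply, mulVec, dotProduct, Fintype.sum_prod_type, flat,
    map_apply, kronecker_apply, Finset.mul_sum, Complex.ofReal_mul, mul_assoc]

theorem tensorApply_pull (P G : Mat) (hP : IsUnit P.det) (T : Tensor4) (F : CMat) :
    tensorApply (Pᵀ * G * P) (pull P T) (congrC P F) = congrC P (tensorApply G T F) := by
  apply vec2_injective
  have hm (A B : Matrix (Fin 4 × Fin 4) (Fin 4 × Fin 4) ℝ) : (A * B).map Complex.ofReal =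
      A.map Complex.ofReal * B.map Complex.ofReal := Matrix.map_mul (f := Complex.ofRealHom)
  rw [vec2_tensorApply, congrC, congrC, vec2_congruence, vec2_congruence, vec2_tensorApply,
    mulVec_mulVec, mulVec_mulVec, ← kronecker_map_ofReal, ← transpose_map (f := Complex.ofReal), ← hm, ← hm, flat_pull,
    ← kronecker_inv_congruence P G hP]
  simp only [Matrix.mul_assoc]

end SuperEnergy
end

noncomputable section

namespace SuperEnergy

open Matrix
open scoped Kronecker

/-! ### Weyl tensors at a point -/

/-- The algebraic symmetries of a Weyl tensor. -/
structure IsWeylTensor (G : Mat) (W : Tensor4) : Prop where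
  antisymm : ∀ a b c d, W a b c d = -W b a c d
  pair : ∀ a b c d, W a b c d = W c d a b
  cyclic : ∀ a b c d, W a b c d + W a c d b + W a d b c = 0
  trace : ∀ b d, ∑ a, ∑ c, G⁻¹ a c * W a b c d = 0

theorem trace_iff_vecMul (K : Mat) (W : Tensor4) :
    (∀ b d, ∑ a, ∑ c, K a c * W a b c d = 0) ↔ vec2 K ᵥ* flat (swapMid W) = 0 := by
  simp only [funext_iff, Prod.forall, vecMul, dotProduct, vec2, flat, swapMid, of_apply,
    Fintype.sum_prod_type, Pi.zero_apply]

theorem IsWeylTensor.pull {G : Mat} {W : Tensor4} (h : IsWeylTensor G W) {P : Mat}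
    (hP : IsUnit P.det) : IsWeylTensor (Pᵀ * G * P) (pull P W) where
  antisymm a b c d := by
    simp only [pull_eq_sum, ← Finset.sum_neg_distrib]
    rw [Finset.sum_comm]
    refine Finset.sum_congr rfl fun i _ => Finset.sum_congr rfl fun j _ =>
      Finset.sum_congr rfl fun k _ => Finset.sum_congr rfl fun l _ => ?_
    rw [h.antisymm j i]
    ring
  pair a b c d := by
    rw [pull_eq_sum, SuperEnergy.pull]
    refine Finset.sum_congr rfl fun i _ => Finset.sum_congr rfl fun j _ =>
      Finset.sum_congr rfl fun k _ => Finset.sum_congr rfl fun l _ => ?_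
    rw [h.pair i j]
    ring
  cyclic a b c d := by
    have h1 (f : Fin 4 → Fin 4 → Fin 4 → ℝ) :
        ∑ j, ∑ k, ∑ l, f j k l = ∑ j, ∑ k, ∑ l, f k l j := by
      rw [Finset.sum_comm]
      conv_rhs => rw [Finset.sum_comm]
      conv_lhs => rw [Finset.sum_comm]
      conv_rhs => enter [2, k]; rw [Finset.sum_comm]
    have e1 : SuperEnergy.pull P W a c d b =
        ∑ i, ∑ j, ∑ k, ∑ l, P i a * P j b * P k c * P l d * W i k l j := by
      rw [pull_eq_sum]
      refine Finset.sum_congr rfl fun i _ => ?_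
      rw [h1]
      refine Finset.sum_congr rfl fun j _ => Finset.sum_congr rfl fun k _ =>
        Finset.sum_congr rfl fun l _ => ?_
      ring
    have e2 : SuperEnergy.pull P W a d b c =
        ∑ i, ∑ j, ∑ k, ∑ l, P i a * P j b * P k c * P l d * W i l j k := by
      rw [pull_eq_sum]
      refine Finset.sum_congr rfl fun i _ => ?_
      rw [h1, h1]
      refine Finset.sum_congr rfl fun j _ => Finset.sum_congr rfl fun k _ =>
        Finset.sum_congr rfl fun l _ => ?_
      ring
    rw [e1, e2, pull_eq_sum]
    simp only [← Finset.sum_add_distrib, ← mul_add]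
    refine Finset.sum_eq_zero fun i _ => Finset.sum_eq_zero fun j _ =>
      Finset.sum_eq_zero fun k _ => Finset.sum_eq_zero fun l _ => ?_
    rw [h.cyclic, mul_zero]
  trace := by
    rw [trace_iff_vecMul]
    have hk : vec2 (Pᵀ * G * P)⁻¹ ᵥ* (P ⊗ₖ P)ᵀ = vec2 G⁻¹ := by
      rw [vecMul_transpose, ← mul_inv_congruence_mul P G hP]
      have := vec2_congruence Pᵀ (Pᵀ * G * P)⁻¹
      rw [transpose_transpose] at this
      rw [this, ← kroneckerMap_transpose, transpose_transpose]
    rw [swapMid_pull, flat_pull, ← vecMul_vecMul, ← vecMul_vecMul, hk,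
      (trace_iff_vecMul _ _).1 h.trace, zero_vecMul]

end SuperEnergy
end

noncomputable section

namespace SuperEnergy

open Matrix Filter
open scoped Topology

/-! ### The Weyl tensor of a metric -/

theorem IsLorentzian.det_ne_zero {G : Mat} (h : IsLorentzian G) : G.det ≠ 0 := by
  obtain ⟨-, P, -, hP⟩ := h
  intro h0
  have := congrArg det hP
  simp [det_mul, h0, det_diagonal, Fin.prod_univ_four] at this

theorem contDiffAt_det {n : ℕ} {A : Vec → Matrix (Fin n) (Fin n) ℝ} {p : Vec}
    (h : ∀ i j, ContDiffAt ℝ 1 (fun x => A x i j) p) : ContDiffAt ℝ 1 (fun x => (A x).det) p := by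
  simp only [det_apply']
  exact ContDiffAt.sum fun σ _ => contDiffAt_const.mul (contDiffAt_prod fun i _ => h _ _)

theorem contDiffAt_inv {n : ℕ} {A : Vec → Matrix (Fin n) (Fin n) ℝ} {p : Vec}
    (h : ∀ i j, ContDiffAt ℝ 1 (fun x => A x i j) p) (h0 : (A p).det ≠ 0) (i j : Fin n) :
    ContDiffAt ℝ 1 (fun x => (A x)⁻¹ i j) p := by
  have e : (fun x => (A x)⁻¹ i j) = fun x => (A x).det⁻¹ * (A x).adjugate i j := by
    funext x
    rw [inv_def, Matrix.smul_apply, smul_eq_mul, Ring.inverse_eq_inv']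
  rw [e]
  refine ((contDiffAt_det h).inv h0).mul ?_
  simp only [adjugate_apply]
  refine contDiffAt_det fun k l => ?_
  by_cases hk : k = j
  · subst hk
    simp only [updateRow_self]
    exact contDiffAt_const
  · simp only [updateRow_ne hk]
    exact h k l

theorem contDiffAt_partialDeriv {f : Vec → ℝ} {p : Vec} (h : ContDiffAt ℝ 2 f p) (a : Fin 4) :
    ContDiffAt ℝ 1 (partialDeriv a f) p :=
  (h.fderiv_right (m := 1) (by norm_num)).clm_apply contDiffAt_const

theorem partialDeriv_comm {f : Vec → ℝ} {p : Vec} (h : ContDiffAt ℝ 2 f p) (a b : Fin 4) :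
    partialDeriv a (partialDeriv b f) p = partialDeriv b (partialDeriv a f) p := by
  have hd : DifferentiableAt ℝ (fderiv ℝ f) p :=
    (h.fderiv_right (m := 1) (by norm_num)).differentiableAt (by norm_num)
  have e (a b : Fin 4) : partialDeriv a (partialDeriv b f) p =
      fderiv ℝ (fderiv ℝ f) p (Pi.single a 1) (Pi.single b 1) := by
    unfold partialDeriv
    rw [fderiv_clm_apply hd (differentiableAt_const _)]
    simp
  rw [e, e, (h.isSymmSndFDerivAt (by simp)).eq]

theorem partialDeriv_congr {f f' : Vec → ℝ} {p : Vec} (h : f =ᶠ[𝓝 p] f') (a : Fin 4) :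
    partialDeriv a f p = partialDeriv a f' p := by
  rw [partialDeriv, partialDeriv, h.fderiv_eq]

theorem partialDeriv_congr_eventually {f f' : Vec → ℝ} {p : Vec} (h : f =ᶠ[𝓝 p] f') (a : Fin 4) :
    partialDeriv a f =ᶠ[𝓝 p] partialDeriv a f' := by
  filter_upwards [h.fderiv (𝕜 := ℝ)] with x hx
  rw [partialDeriv, partialDeriv, hx]

theorem partialDeriv_mul {f f' : Vec → ℝ} {p : Vec} (h : DifferentiableAt ℝ f p)
    (h' : DifferentiableAt ℝ f' p) (a : Fin 4) :
    partialDeriv a (fun x => f x * f' x) p =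
      f p * partialDeriv a f' p + f' p * partialDeriv a f p := by
  simp [partialDeriv, fderiv_fun_mul h h']

theorem partialDeriv_sum {ι : Type*} [Fintype ι] {f : ι → Vec → ℝ} {p : Vec}
    (h : ∀ i, DifferentiableAt ℝ (f i) p) (a : Fin 4) :
    partialDeriv a (fun x => ∑ i, f i x) p = ∑ i, partialDeriv a (f i) p := by
  simp [partialDeriv, fderiv_fun_sum fun i _ => h i]

/-- The Christoffel symbols `Γ_{abc}` of the first kind. -/
def christoffelLow (g : Vec → Mat) (a b c : Fin 4) (x : Vec) : ℝ :=
  (1 / 2) * (partialDeriv b (fun y => g y a c) x + partialDeriv c (fun y => g y a b) x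
    - partialDeriv a (fun y => g y b c) x)

variable {g : Vec → Mat} {U : Set Vec} {p : Vec}

theorem christoffel_eq (g : Vec → Mat) (a b c : Fin 4) (x : Vec) :
    christoffel g a b c x = ∑ d, (g x)⁻¹ a d * christoffelLow g d b c x := by
  rw [christoffel, Finset.mul_sum]
  refine Finset.sum_congr rfl fun d _ => ?_
  rw [christoffelLow]
  ring

theorem sum_mul_sum_inv {G : Mat} (h : G.det ≠ 0) (a : Fin 4) (f : Fin 4 → ℝ) :
    ∑ e, G a e * ∑ d, G⁻¹ e d * f d = f a := by
  have : G *ᵥ (G⁻¹ *ᵥ f) = f := by rw [mulVec_mulVec, mul_nonsing_inv _ h.isUnit, one_mulVec]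
  exact congrFun this a

theorem sum_inv_mul_sum {G : Mat} (h : G.det ≠ 0) (a : Fin 4) (f : Fin 4 → ℝ) :
    ∑ e, G⁻¹ a e * ∑ d, G e d * f d = f a := by
  have : G⁻¹ *ᵥ (G *ᵥ f) = f := by rw [mulVec_mulVec, nonsing_inv_mul _ h.isUnit, one_mulVec]
  exact congrFun this a

namespace IsLorentzianMetricOn

theorem symm (hg : IsLorentzianMetricOn g U) {x : Vec} (hx : x ∈ U) (a b : Fin 4) :
    g x a b = g x b a := ((hg.lorentzian x hx).1.apply a b).symm

theorem contDiffAt (hg : IsLorentzianMetricOn g U) (hp : p ∈ U) (a b : Fin 4) :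
    ContDiffAt ℝ 2 (fun x => g x a b) p :=
  (hg.contDiffOn a b).contDiffAt (hg.isOpen.mem_nhds hp)

theorem symm_eventually (hg : IsLorentzianMetricOn g U) (hp : p ∈ U) (a b : Fin 4) :
    (fun x => g x a b) =ᶠ[𝓝 p] fun x => g x b a := by
  filter_upwards [hg.isOpen.mem_nhds hp] with x hx using hg.symm hx a b

theorem differentiableAt_christoffelLow (hg : IsLorentzianMetricOn g U) (hp : p ∈ U)
    (a b c : Fin 4) : ContDiffAt ℝ 1 (christoffelLow g a b c) p := by
  unfold christoffelLow
  have h (a b c : Fin 4) := contDiffAt_partialDeriv (hg.contDiffAt hp a b) c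
  exact contDiffAt_const.mul (((h _ _ _).add (h _ _ _)).sub (h _ _ _))

theorem contDiffAt_christoffel (hg : IsLorentzianMetricOn g U) (hp : p ∈ U) (a b c : Fin 4) :
    ContDiffAt ℝ 1 (christoffel g a b c) p := by
  have e : christoffel g a b c = fun x => ∑ d, (g x)⁻¹ a d * christoffelLow g d b c x :=
    funext fun x => christoffel_eq g a b c x
  rw [e]
  refine ContDiffAt.sum fun d _ => ContDiffAt.mul ?_ (hg.differentiableAt_christoffelLow hp _ _ _)
  exact contDiffAt_inv (fun i j => (hg.contDiffAt hp i j).of_le (by norm_num))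
    (hg.lorentzian p hp).det_ne_zero a d

/-- The product rule applied to the identity that lowers the index of Γ, valid near p; no derivative
of the inverse metric has to be computed. -/
theorem sum_mul_partialDeriv_christoffel (hg : IsLorentzianMetricOn g U) (hp : p ∈ U)
    (a b c k : Fin 4) : ∑ e, g p a e * partialDeriv k (christoffel g e b c) p =
      partialDeriv k (christoffelLow g a b c) p
        - ∑ e, partialDeriv k (fun x => g x a e) p * christoffel g e b c p := by
  have h : (fun x => ∑ e, g x a e * christoffel g e b c x) =ᶠ[𝓝 p] christoffelLow g a b c := by
    filter_upwards [hg.isOpen.mem_nhds hp] with x hx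
    simp only [christoffel_eq]
    exact sum_mul_sum_inv (hg.lorentzian x hx).det_ne_zero a fun d => christoffelLow g d b c x
  have d1 (e : Fin 4) : DifferentiableAt ℝ (fun x => g x a e) p :=
    (hg.contDiffAt hp a e).differentiableAt (by norm_num)
  have d2 (e : Fin 4) : DifferentiableAt ℝ (christoffel g e b c) p :=
    (hg.contDiffAt_christoffel hp e b c).differentiableAt (by norm_num)
  rw [← partialDeriv_congr h, partialDeriv_sum fun e => (d1 e).fun_mul (d2 e), eq_sub_iff_add_eq,
    ← Finset.sum_add_distrib]
  refine Finset.sum_congr rfl fun e _ => ?_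
  rw [partialDeriv_mul (d1 e) (d2 e)]
  ring

theorem partialDeriv_metric (hg : IsLorentzianMetricOn g U) (hp : p ∈ U) (a e c : Fin 4) :
    partialDeriv c (fun x => g x a e) p = christoffelLow g a c e p + christoffelLow g e c a p := by
  have h (a b c : Fin 4) : partialDeriv c (fun x => g x a b) p = partialDeriv c (fun x => g x b a) p :=
    partialDeriv_congr (hg.symm_eventually hp a b) c
  rw [christoffelLow, christoffelLow, h e a c, h a c e, h e c a]
  ring

theorem partialDeriv_christoffelLow (hg : IsLorentzianMetricOn g U) (hp : p ∈ U)
    (a b c k : Fin 4) : partialDeriv k (christoffelLow g a b c) p = (1 / 2) *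
      (partialDeriv k (partialDeriv b fun y => g y a c) p
        + partialDeriv k (partialDeriv c fun y => g y a b) p
        - partialDeriv k (partialDeriv a fun y => g y b c) p) := by
  have d (a b c : Fin 4) : DifferentiableAt ℝ (partialDeriv c fun x => g x a b) p :=
    (contDiffAt_partialDeriv (hg.contDiffAt hp a b) c).differentiableAt (by norm_num)
  unfold christoffelLow
  rw [partialDeriv, fderiv_const_mul (((d _ _ _).fun_add (d _ _ _)).fun_sub (d _ _ _)),
    fderiv_fun_sub ((d _ _ _).fun_add (d _ _ _)) (d _ _ _), fderiv_fun_add (d _ _ _) (d _ _ _)]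
  simp [partialDeriv]

/-- The curvature in terms of the second derivatives of the metric and of the Christoffel
symbols of the first kind. -/
theorem riemann_eq (hg : IsLorentzianMetricOn g U) (hp : p ∈ U) (a b c d : Fin 4) :
    riemann g p a b c d = (1 / 2) *
      (partialDeriv c (partialDeriv b fun y => g y a d) p
        - partialDeriv c (partialDeriv a fun y => g y d b) p
        - partialDeriv d (partialDeriv b fun y => g y a c) p
        + partialDeriv d (partialDeriv a fun y => g y c b) p)
      - ∑ f, christoffelLow g f c a p * christoffel g f d b p
      + ∑ f, christoffelLow g f d a p * christoffel g f c b p := by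
  have h1 (c d : Fin 4) : ∑ e, g p a e * ∑ f, christoffel g e c f p * christoffel g f d b p =
      ∑ f, christoffelLow g a c f p * christoffel g f d b p := by
    simp only [Finset.mul_sum]
    rw [Finset.sum_comm]
    refine Finset.sum_congr rfl fun f _ => ?_
    rw [← sum_mul_sum_inv (hg.lorentzian p hp).det_ne_zero a fun e => christoffelLow g e c f p,
      Finset.sum_mul]
    refine Finset.sum_congr rfl fun e _ => ?_
    rw [christoffel_eq g e c f]
    ring
  have h2 : riemann g p a b c d =
      ∑ e, g p a e * partialDeriv c (christoffel g e d b) p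
        - ∑ e, g p a e * partialDeriv d (christoffel g e c b) p
        + (∑ e, g p a e * ∑ f, christoffel g e c f p * christoffel g f d b p
          - ∑ e, g p a e * ∑ f, christoffel g e d f p * christoffel g f c b p) := by
    simp only [riemann, riemannUp, ← Finset.sum_sub_distrib, ← Finset.sum_add_distrib]
    refine Finset.sum_congr rfl fun e _ => ?_
    rw [Finset.sum_sub_distrib]
    ring
  have h3 (c d : Fin 4) :
      ∑ e, partialDeriv c (fun x => g x a e) p * christoffel g e d b p =
        ∑ e, christoffelLow g a c e p * christoffel g e d b p
          + ∑ e, christoffelLow g e c a p * christoffel g e d b p := by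
    rw [← Finset.sum_add_distrib]
    refine Finset.sum_congr rfl fun e _ => ?_
    rw [hg.partialDeriv_metric hp, add_mul]
  rw [h2, h1, h1, hg.sum_mul_partialDeriv_christoffel hp, hg.sum_mul_partialDeriv_christoffel hp,
    h3, h3, hg.partialDeriv_christoffelLow hp, hg.partialDeriv_christoffelLow hp,
    partialDeriv_comm (hg.contDiffAt hp a b) c d]
  ring

theorem inv_symm (hg : IsLorentzianMetricOn g U) (hp : p ∈ U) (a b : Fin 4) :
    (g p)⁻¹ a b = (g p)⁻¹ b a := by
  have : ((g p)⁻¹)ᵀ = (g p)⁻¹ := by rw [transpose_nonsing_inv, (hg.lorentzian p hp).1]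
  exact (congrFun (congrFun this a) b).symm

/-- By `riemann_eq` the curvature is a combination of the second derivatives D and the products Q of
Christoffel symbols. The class C² gives D1, the symmetry of g gives D2, the symmetry of Γ in its
lower indices gives Q1 and Q2, and the symmetry of the inverse metric gives Q3; the rest is linear.
-/
theorem riemann_symmetries (hg : IsLorentzianMetricOn g U) (hp : p ∈ U) (a b c d : Fin 4) :
    riemann g p a b c d = -riemann g p b a c d ∧ riemann g p a b c d = riemann g p c d a b ∧
      riemann g p a b c d + riemann g p a c d b + riemann g p a d b c = 0 := by
  set D : Fin 4 → Fin 4 → Fin 4 → Fin 4 → ℝ := fun c b a d =>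
    partialDeriv c (partialDeriv b fun y => g y a d) p with hD
  set Q : Fin 4 → Fin 4 → Fin 4 → Fin 4 → ℝ := fun c a d b =>
    ∑ f, christoffelLow g f c a p * christoffel g f d b p with hQ
  have hR (a b c d : Fin 4) : riemann g p a b c d =
      (1 / 2) * (D c b a d - D c a d b - D d b a c + D d a c b) - Q c a d b + Q d a c b :=
    hg.riemann_eq hp a b c d
  have D1 (a b c d : Fin 4) : D a b c d = D b a c d := partialDeriv_comm (hg.contDiffAt hp c d) a b
  have D2 (a b c d : Fin 4) : D a b c d = D a b d c :=
    partialDeriv_congr (partialDeriv_congr_eventually (hg.symm_eventually hp c d) b) a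
  have L (a b c : Fin 4) : christoffelLow g a b c p = christoffelLow g a c b p := by
    rw [christoffelLow, christoffelLow, partialDeriv_congr (hg.symm_eventually hp b c)]
    ring
  have C (a b c : Fin 4) : christoffel g a b c p = christoffel g a c b p := by
    simp only [christoffel_eq, L _ b c]
  have Q1 (a b c d : Fin 4) : Q a b c d = Q b a c d := by simp only [hQ, L _ a b]
  have Q2 (a b c d : Fin 4) : Q a b c d = Q a b d c := by simp only [hQ, C _ c d]
  have Q3 (a b c d : Fin 4) : Q a b c d = Q c d a b := by
    simp only [hQ, christoffel_eq, Finset.mul_sum]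
    rw [Finset.sum_comm]
    refine Finset.sum_congr rfl fun e _ => Finset.sum_congr rfl fun f _ => ?_
    rw [hg.inv_symm hp f e]
    ring
  refine ⟨?_, ?_, ?_⟩
  · rw [hR, hR]
    linarith [D2 c b a d, D2 d b a c, D2 c a d b, D2 d a c b, Q3 c a d b, Q3 d a c b]
  · rw [hR, hR]
    linarith [D1 d a c b, D1 c a d b, D2 a c d b, D1 d b a c, D2 b d a c, D1 c b a d,
      Q1 c a d b, Q2 a c d b, Q3 d a c b, Q1 c b d a, Q2 b c d a]
  · rw [hR, hR, hR]
    linarith [D1 c b a d, D1 d b a c, D1 c d a b, D2 c a d b, D2 d a c b, D2 b a c d,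
      Q2 c a d b, Q2 d a c b, Q2 b a c d]

theorem ricci_eq (hg : IsLorentzianMetricOn g U) (hp : p ∈ U) (b d : Fin 4) :
    ricci g p b d = ∑ a, ∑ e, (g p)⁻¹ a e * riemann g p e b a d := by
  refine Finset.sum_congr rfl fun a _ => ?_
  exact (sum_inv_mul_sum (hg.lorentzian p hp).det_ne_zero a
    fun e => riemannUp g p e b a d).symm

theorem ricci_symm (hg : IsLorentzianMetricOn g U) (hp : p ∈ U) (b d : Fin 4) :
    ricci g p b d = ricci g p d b := by
  rw [hg.ricci_eq hp, hg.ricci_eq hp, Finset.sum_comm]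
  refine Finset.sum_congr rfl fun a _ => Finset.sum_congr rfl fun e _ => ?_
  rw [hg.inv_symm hp e a, (hg.riemann_symmetries hp a b e d).2.1]

theorem isWeylTensor (hg : IsLorentzianMetricOn g U) (hp : p ∈ U) :
    IsWeylTensor (g p) (weyl g p) where
  antisymm a b c d := by
    simp only [weyl]
    linarith [(hg.riemann_symmetries hp a b c d).1]
  pair a b c d := by
    simp only [weyl, (hg.riemann_symmetries hp a b c d).2.1, hg.symm hp c a, hg.symm hp d b,
      hg.symm hp c b, hg.symm hp d a, hg.ricci_symm hp c a, hg.ricci_symm hp d b,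
      hg.ricci_symm hp c b, hg.ricci_symm hp d a]
    ring
  cyclic a b c d := by
    simp only [weyl]
    rw [hg.symm hp d b, hg.symm hp c b, hg.symm hp d c, hg.ricci_symm hp d b,
      hg.ricci_symm hp c b, hg.ricci_symm hp d c]
    linarith [(hg.riemann_symmetries hp a b c d).2.2]
  trace b d := by
    have h0 := (hg.lorentzian p hp).det_ne_zero
    have t1 : ∑ a, ∑ c, (g p)⁻¹ a c * riemann g p a b c d = ricci g p b d := by
      rw [hg.ricci_eq hp, Finset.sum_comm]
      refine Finset.sum_congr rfl fun a _ => Finset.sum_congr rfl fun c _ => ?_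
      rw [hg.inv_symm hp]
    have t2 : ∑ a, ∑ c, (g p)⁻¹ a c * g p a c = 4 := by
      have h (a : Fin 4) : ∑ c, (g p)⁻¹ a c * g p a c = 1 := by
        have := congrFun (congrFun (nonsing_inv_mul (g p) h0.isUnit) a) a
        rw [mul_apply, one_apply_eq] at this
        rw [← this]
        exact Finset.sum_congr rfl fun c _ => by rw [hg.symm hp c a]
      simp [h]
    have t3 (f : Fin 4 → ℝ) (d : Fin 4) :
        ∑ a, ∑ c, (g p)⁻¹ a c * (g p a d * f c) = f d := by
      rw [Finset.sum_comm]
      have h (c : Fin 4) : ∑ a, (g p)⁻¹ a c * (g p a d * f c) = if c = d then f c else 0 := by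
        have := congrFun (congrFun (nonsing_inv_mul (g p) h0.isUnit) c) d
        rw [mul_apply, one_apply] at this
        rw [← boole_mul, ← this, Finset.sum_mul]
        exact Finset.sum_congr rfl fun a _ => by rw [hg.inv_symm hp a c]; ring
      simp [h]
    have t4 (f : Fin 4 → ℝ) (d : Fin 4) :
        ∑ a, ∑ c, (g p)⁻¹ a c * (g p d c * f a) = f d := by
      rw [← t3 f d, Finset.sum_comm]
      refine Finset.sum_congr rfl fun a _ => Finset.sum_congr rfl fun c _ => ?_
      rw [hg.inv_symm hp c a, hg.symm hp d a]
    have t5 : ∑ a, ∑ c, (g p)⁻¹ a c * ricci g p a c = scalarCurv g p := rfl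
    have e : ∑ a, ∑ c, (g p)⁻¹ a c * weyl g p a b c d =
        ∑ a, ∑ c, (g p)⁻¹ a c * riemann g p a b c d
        - (1 / 2) * ((∑ a, ∑ c, (g p)⁻¹ a c * g p a c) * ricci g p b d
          - ∑ a, ∑ c, (g p)⁻¹ a c * (g p a d * ricci g p b c)
          - ∑ a, ∑ c, (g p)⁻¹ a c * (g p b c * ricci g p a d)
          + (∑ a, ∑ c, (g p)⁻¹ a c * ricci g p a c) * g p b d)
        + (scalarCurv g p / 6) * ((∑ a, ∑ c, (g p)⁻¹ a c * g p a c) * g p b d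
          - ∑ a, ∑ c, (g p)⁻¹ a c * (g p a d * g p b c)) := by
      simp only [Finset.sum_mul, Finset.mul_sum, ← Finset.sum_sub_distrib,
        ← Finset.sum_add_distrib]
      refine Finset.sum_congr rfl fun a _ => Finset.sum_congr rfl fun c _ => ?_
      rw [weyl]
      ring
    rw [e, t1, t2, t3, t4 fun a => ricci g p a d, t5, t3]
    ring

end IsLorentzianMetricOn

end SuperEnergy
end

noncomputable section

namespace SuperEnergy

open Matrix

/-! ### Weyl tensors in an orthonormal frame -/

/-- The Minkowski metric. -/
def minkowski : Mat := diagonal ![-1, 1, 1, 1]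

theorem minkowski_inv : minkowski⁻¹ = minkowski := by
  apply inv_eq_right_inv
  rw [minkowski, diagonal_mul_diagonal, ← diagonal_one]
  congr 1
  ext i
  fin_cases i <;> simp

theorem sum_minkowski_mul (a : Fin 4) (f : Fin 4 → ℝ) :
    ∑ b, minkowski a b * f b = (![-1, 1, 1, 1] : Vec) a * f a := by
  simp [minkowski, diagonal_apply]

theorem det_minkowski : minkowski.det = -1 := by
  simp [minkowski, det_diagonal, Fin.prod_univ_four]

/-- The antisymmetric array with electric part `e` and magnetic part `h`. -/
def biv {R : Type*} [Zero R] [Neg R] (e h : Fin 3 → R) : Matrix (Fin 4) (Fin 4) R :=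
  !![0, e 0, e 1, e 2; -e 0, 0, h 2, -h 1; -e 1, -h 2, 0, h 0; -e 2, h 1, -h 0, 0]

/-- The Weyl tensor with electric part `E` and magnetic part `H`, in an orthonormal frame. -/
def weylOf (E H : Matrix (Fin 3) (Fin 3) ℝ) : Tensor4 := fun a b c d =>
  biv (fun i => biv (E i) (H i) c d) (fun i => biv (H i) (-E i) c d) a b

theorem eq_biv_of_antisymm {R : Type*} [Field R] [CharZero R] {X : Matrix (Fin 4) (Fin 4) R}
    (h : ∀ a b, X a b = -X b a) :
    X = biv ![X 0 1, X 0 2, X 0 3] ![X 2 3, X 3 1, X 1 2] := by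
  have h0 (a : Fin 4) : X a a = 0 := self_eq_neg.1 (h a a)
  ext a b
  fin_cases a <;> fin_cases b <;> simp [biv, h0] <;> exact h _ _

/-- The 0-1 matrix of the symbol selects the rows of the Vandermonde matrix of the nodes 0, 1, 2, 3,
whose determinant is 12. The resulting polynomial form lets `ring` prove the antisymmetries. -/
theorem leviCivita_eq (a b c d : Fin 4) : leviCivita a b c d =
    ((![0, 1, 2, 3] : Vec) b - (![0, 1, 2, 3] : Vec) a) *
      ((![0, 1, 2, 3] : Vec) c - (![0, 1, 2, 3] : Vec) a) *
      ((![0, 1, 2, 3] : Vec) d - (![0, 1, 2, 3] : Vec) a) *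
      ((![0, 1, 2, 3] : Vec) c - (![0, 1, 2, 3] : Vec) b) *
      ((![0, 1, 2, 3] : Vec) d - (![0, 1, 2, 3] : Vec) b) *
      ((![0, 1, 2, 3] : Vec) d - (![0, 1, 2, 3] : Vec) c) / 12 := by
  set v : Vec := ![0, 1, 2, 3] with hv
  have h1 : (of fun i j : Fin 4 => if ![a, b, c, d] i = j then (1 : ℝ) else 0) * vandermonde v =
      vandermonde ![v a, v b, v c, v d] := by
    ext i j
    rw [mul_apply]
    simp only [of_apply, ite_mul, one_mul, zero_mul, Finset.sum_ite_eq, Finset.mem_univ, if_true,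
      vandermonde_apply]
    fin_cases i <;> rfl
  have h2 := congrArg det h1
  have e (w : Vec) : (vandermonde w).det = (w 1 - w 0) * (w 2 - w 0) * (w 3 - w 0) *
      (w 2 - w 1) * (w 3 - w 1) * (w 3 - w 2) := by
    rw [det_vandermonde]
    rw [Fin.prod_univ_four, show Finset.Ioi (0 : Fin 4) = {1, 2, 3} from rfl,
      show Finset.Ioi (1 : Fin 4) = {2, 3} from rfl, show Finset.Ioi (2 : Fin 4) = {3} from rfl,
      show Finset.Ioi (3 : Fin 4) = ∅ from rfl, Finset.prod_insert (by decide),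
      Finset.prod_insert (by decide), Finset.prod_insert (by decide), Finset.prod_singleton,
      Finset.prod_singleton, Finset.prod_singleton, Finset.prod_empty]
    ring
  rw [det_mul, e, e] at h2
  have h3 : (v 1 - v 0) * (v 2 - v 0) * (v 3 - v 0) * (v 2 - v 1) * (v 3 - v 1) * (v 3 - v 2) =
      12 := by
    simp [hv]; norm_num
  rw [h3] at h2
  rw [leviCivita, eq_div_iff (by norm_num), h2]
  rfl

theorem dual_minkowski (W : Tensor4) (a b c d : Fin 4) : dual minkowski W a b c d = (1 / 2) *
    ∑ e, ∑ f, leviCivita a b e f * ((![-1, 1, 1, 1] : Vec) e * ((![-1, 1, 1, 1] : Vec) f *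
      W e f c d)) := by
  simp only [dual, minkowski_inv, volumeElement, det_minkowski, neg_neg, Real.sqrt_one, one_mul,
    mul_assoc, ← Finset.mul_sum]
  simp only [mul_left_comm (minkowski _ _), ← Finset.mul_sum, sum_minkowski_mul]
  simp only [mul_left_comm ((![-1, 1, 1, 1] : Vec) _) ((![-1, 1, 1, 1] : Vec) _)]

theorem dual_minkowski_biv (W : Tensor4) (c d : Fin 4) (e h : Fin 3 → ℝ)
    (hW : ∀ a b, W a b c d = biv e h a b) (a b : Fin 4) :
    dual minkowski W a b c d = biv h (-e) a b := by
  have ha : ∀ a b, of (fun a b => dual minkowski W a b c d) a b =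
      -of (fun a b => dual minkowski W a b c d) b a := by
    intro a b
    simp only [of_apply, dual_minkowski, ← mul_neg, ← Finset.sum_neg_distrib]
    refine congrArg _ (Finset.sum_congr rfl fun _ _ => Finset.sum_congr rfl fun _ _ => ?_)
    rw [leviCivita_eq, leviCivita_eq]
    ring
  have key := eq_biv_of_antisymm ha
  have k2 := congrFun (congrFun key a) b
  rw [of_apply] at k2
  rw [k2]
  congr 1
  · ext i
    fin_cases i <;>
    · simp [dual_minkowski, hW, Fin.sum_univ_four, leviCivita_eq, biv]
      norm_num
      try ring
  · ext i
    fin_cases i <;>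
    · simp [dual_minkowski, hW, Fin.sum_univ_four, leviCivita_eq, biv]
      norm_num
      try ring

theorem neg_biv (e h : Fin 3 → ℝ) (a b : Fin 4) : -biv e h a b = biv (-e) (-h) a b := by
  fin_cases a <;> fin_cases b <;> simp [biv]

theorem dual_weylOf (E H : Matrix (Fin 3) (Fin 3) ℝ) :
    dual minkowski (weylOf E H) = weylOf H (-E) := by
  funext a b c d
  rw [dual_minkowski_biv (weylOf E H) c d _ _ (fun a b => rfl), weylOf]
  congr 1
  ext i
  exact neg_biv _ _ _ _

/-- The trace condition with indices 00 gives tr E = 0, those with one index 0 give the symmetry of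
H, the spatial ones turn the purely spatial components into -E, and the cyclic identity gives tr H =
0. -/
theorem exists_eq_weylOf {W : Tensor4} (h : IsWeylTensor minkowski W) :
    ∃ E H : Matrix (Fin 3) (Fin 3) ℝ, E.IsSymm ∧ H.IsSymm ∧ E.trace = 0 ∧ H.trace = 0 ∧
      W = weylOf E H := by
  have a2 (a b c d) : W a b c d = -W a b d c := by
    rw [h.pair, h.antisymm, h.pair]
  have z1 (a c d) : W a a c d = 0 := by linarith [h.antisymm a a c d]
  have z2 (a b c) : W a b c c = 0 := by linarith [a2 a b c c]
  have t (b d) : -W 0 b 0 d + W 1 b 1 d + W 2 b 2 d + W 3 b 3 d = 0 := by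
    have := h.trace b d
    simp only [minkowski_inv, sum_minkowski_mul] at this
    simpa [Fin.sum_univ_four] using this
  have r1 := h.antisymm 1 0
  have r2 := h.antisymm 2 0
  have r3 := h.antisymm 3 0
  have r4 := h.antisymm 2 1
  have r5 := h.antisymm 3 2
  have r6 := h.antisymm 3 1
  have s1 (a b) := a2 a b 1 0
  have s2 (a b) := a2 a b 2 0
  have s3 (a b) := a2 a b 3 0
  have s4 (a b) := a2 a b 2 1
  have s5 (a b) := a2 a b 3 2
  have s6 (a b) := a2 a b 3 1
  have p1 (a b) := h.pair a b 0 1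
  have c0 := h.cyclic 0 1 2 3
  have t00 := t 0 0
  have t01 := t 0 1
  have t02 := t 0 2
  have t03 := t 0 3
  have t11 := t 1 1
  have t12 := t 1 2
  have t13 := t 1 3
  have t22 := t 2 2
  have t23 := t 2 3
  have t33 := t 3 3
  have q1 := h.pair 1 3 1 2
  have q2 := h.pair 2 3 1 2
  have q3 := h.pair 2 3 1 3
  have q4 := h.pair 0 2 0 1
  have q5 := h.pair 0 3 0 1
  have q6 := h.pair 0 3 0 2
  simp only [r1, r2, r3, r4, r5, r6, s1, s2, s3, s4, s5, s6, z1, z2] at t00 t01 t02 t03 t11 t12 t13 t22 t23 t33 c0 q1 q2 q3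
  refine ⟨of fun i j => W 0 i.succ 0 j.succ,
    of fun i => ![W 0 i.succ 2 3, W 0 i.succ 3 1, W 0 i.succ 1 2], ?_, ?_, ?_, ?_, ?_⟩
  · ext i j
    exact h.pair _ _ _ _
  · ext i j
    fin_cases i <;> fin_cases j <;> simp [s6] <;> linarith
  · simp [trace, Fin.sum_univ_three]
    linarith
  · simp [trace, Fin.sum_univ_three, s6]
    linarith
  · funext a b c d
    have e1 (a b c d) : W a b c d = biv ![W a b 0 1, W a b 0 2, W a b 0 3]
        ![W a b 2 3, W a b 3 1, W a b 1 2] c d :=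
      congrFun (congrFun (eq_biv_of_antisymm (X := of fun c d => W a b c d) fun c d => a2 a b c d) c) d
    have e2 : W a b c d = biv ![W 0 1 c d, W 0 2 c d, W 0 3 c d]
        ![W 2 3 c d, W 3 1 c d, W 1 2 c d] a b :=
      congrFun (congrFun (eq_biv_of_antisymm (X := of fun a b => W a b c d) fun a b =>
        h.antisymm a b c d) a) b
    rw [e2, weylOf]
    congr 1
    · ext i
      fin_cases i
      · exact e1 0 1 c d
      · exact e1 0 2 c d
      · exact e1 0 3 c d
    · have p (a b c) := h.pair a b 0 c
      ext i
      fin_cases i <;> simp only [Fin.zero_eta, Fin.mk_one, Fin.reduceFinMk, cons_val] <;>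
        rw [e1] <;> refine congrFun (congrFun (congrArg₂ biv ?_ ?_) c) d <;> ext j <;>
        fin_cases j <;> simp [r6, s6, p 2 3, p 1 3, p 1 2] <;> linarith

end SuperEnergy
end

/-! ### Components of the Bel-Robinson tensor in an orthonormal frame -/

noncomputable section

namespace SuperEnergy

open Matrix

theorem belRobinson_minkowski (W : Tensor4) (a m b n : Fin 4) :
    belRobinson minkowski W a m b n = (1 / 4) * ∑ r, ∑ s, (![-1, 1, 1, 1] : Vec) r *
      ((![-1, 1, 1, 1] : Vec) s * (W a r b s * W m r n s +
        dual minkowski W a r b s * dual minkowski W m r n s)) := by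
  rw [belRobinson]
  congr 1
  refine Finset.sum_congr rfl fun r _ => Finset.sum_congr rfl fun s _ => ?_
  simp only [minkowski_inv, mul_assoc, ← Finset.mul_sum, sum_minkowski_mul]

/-- The symmetric traceless matrix with the given entries. -/
def stf (a b c d e : ℝ) : Matrix (Fin 3) (Fin 3) ℝ := !![a, b, c; b, d, e; c, e, -a - d]

theorem eq_stf {E : Matrix (Fin 3) (Fin 3) ℝ} (h : E.IsSymm) (ht : E.trace = 0) :
    E = stf (E 0 0) (E 0 1) (E 0 2) (E 1 1) (E 1 2) := by
  rw [trace_fin_three] at ht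
  ext i j
  fin_cases i <;> fin_cases j <;> simp [stf] <;> first | exact h.apply _ _ | linarith

section
variable (a b c d e a' b' c' d' e' : ℝ)

/-- This and the following components, T_{i000} for the super-Poynting vector and T_{ijk0} for the
stress flux, are linear in the 2×2 minors of the pair (E, H). The total symmetry of T is never
proved in general, so one ordering of each triple of indices is computed by hand. -/
theorem belRobinson_weylOf_1000 :
    4 * belRobinson minkowski (weylOf (stf a b c d e) (stf a' b' c' d' e')) 1 0 0 0 =
      2 * (a * e' - e * a') + 2 * (b * c' - c * b') + 4 * (d * e' - e * d') := by
  simp only [belRobinson_minkowski, dual_weylOf]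
  simp [Fin.sum_univ_four, weylOf, biv, stf]
  ring

theorem belRobinson_weylOf_2000 :
    4 * belRobinson minkowski (weylOf (stf a b c d e) (stf a' b' c' d' e')) 2 0 0 0 =
      -4 * (a * c' - c * a') - 2 * (b * e' - e * b') + 2 * (c * d' - d * c') := by
  simp only [belRobinson_minkowski, dual_weylOf]
  simp [Fin.sum_univ_four, weylOf, biv, stf]
  ring

theorem belRobinson_weylOf_3000 :
    4 * belRobinson minkowski (weylOf (stf a b c d e) (stf a' b' c' d' e')) 3 0 0 0 =
      2 * (a * b' - b * a') + 2 * (b * d' - d * b') + 2 * (c * e' - e * c') := by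
  simp only [belRobinson_minkowski, dual_weylOf]
  simp [Fin.sum_univ_four, weylOf, biv, stf]
  ring

theorem belRobinson_weylOf_1110 :
    4 * belRobinson minkowski (weylOf (stf a b c d e) (stf a' b' c' d' e')) 1 1 1 0 =
      2 * (a * e' - e * a') - 2 * (b * c' - c * b') + 4 * (d * e' - e * d') := by
  simp only [belRobinson_minkowski, dual_weylOf]
  simp [Fin.sum_univ_four, weylOf, biv, stf]
  ring

theorem belRobinson_weylOf_1120 :
    4 * belRobinson minkowski (weylOf (stf a b c d e) (stf a' b' c' d' e')) 1 1 2 0 =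
      -2 * (b * e' - e * b') + 2 * (c * d' - d * c') := by
  simp only [belRobinson_minkowski, dual_weylOf]
  simp [Fin.sum_univ_four, weylOf, biv, stf]
  ring

theorem belRobinson_weylOf_1130 :
    4 * belRobinson minkowski (weylOf (stf a b c d e) (stf a' b' c' d' e')) 1 1 3 0 =
      -2 * (a * b' - b * a') + 2 * (b * d' - d * b') + 2 * (c * e' - e * c') := by
  simp only [belRobinson_minkowski, dual_weylOf]
  simp [Fin.sum_univ_four, weylOf, biv, stf]
  ring

theorem belRobinson_weylOf_1220 :
    4 * belRobinson minkowski (weylOf (stf a b c d e) (stf a' b' c' d' e')) 1 2 2 0 =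
      2 * (a * e' - e * a') + 2 * (b * c' - c * b') := by
  simp only [belRobinson_minkowski, dual_weylOf]
  simp [Fin.sum_univ_four, weylOf, biv, stf]
  ring

theorem belRobinson_weylOf_1230 :
    4 * belRobinson minkowski (weylOf (stf a b c d e) (stf a' b' c' d' e')) 1 2 3 0 =
      -2 * (a * d' - d * a') := by
  simp only [belRobinson_minkowski, dual_weylOf]
  simp [Fin.sum_univ_four, weylOf, biv, stf]
  ring

theorem belRobinson_weylOf_1330 :
    4 * belRobinson minkowski (weylOf (stf a b c d e) (stf a' b' c' d' e')) 1 3 3 0 =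
      -2 * (a * e' - e * a') + 2 * (b * c' - c * b') := by
  simp only [belRobinson_minkowski, dual_weylOf]
  simp [Fin.sum_univ_four, weylOf, biv, stf]
  ring

theorem belRobinson_weylOf_2220 :
    4 * belRobinson minkowski (weylOf (stf a b c d e) (stf a' b' c' d' e')) 2 2 2 0 =
      -4 * (a * c' - c * a') + 2 * (b * e' - e * b') + 2 * (c * d' - d * c') := by
  simp only [belRobinson_minkowski, dual_weylOf]
  simp [Fin.sum_univ_four, weylOf, biv, stf]
  ring

theorem belRobinson_weylOf_2230 :
    4 * belRobinson minkowski (weylOf (stf a b c d e) (stf a' b' c' d' e')) 2 2 3 0 =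
      2 * (a * b' - b * a') - 2 * (b * d' - d * b') + 2 * (c * e' - e * c') := by
  simp only [belRobinson_minkowski, dual_weylOf]
  simp [Fin.sum_univ_four, weylOf, biv, stf]
  ring

theorem belRobinson_weylOf_2330 :
    4 * belRobinson minkowski (weylOf (stf a b c d e) (stf a' b' c' d' e')) 2 3 3 0 =
      -2 * (b * e' - e * b') - 2 * (c * d' - d * c') := by
  simp only [belRobinson_minkowski, dual_weylOf]
  simp [Fin.sum_univ_four, weylOf, biv, stf]
  ring

theorem belRobinson_weylOf_3330 :
    4 * belRobinson minkowski (weylOf (stf a b c d e) (stf a' b' c' d' e')) 3 3 3 0 =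
      2 * (a * b' - b * a') + 2 * (b * d' - d * b') - 2 * (c * e' - e * c') := by
  simp only [belRobinson_minkowski, dual_weylOf]
  simp [Fin.sum_univ_four, weylOf, biv, stf]
  ring

end

theorem forall_fin_four {p : Fin 4 → Prop} : (∀ i, p i) ↔ p 0 ∧ p 1 ∧ p 2 ∧ p 3 := by
  simp [Fin.forall_fin_succ]

/-- The matrices `W_{arbs}`, for fixed `a` and `b`, of a diagonal Weyl tensor. -/
def diagWeylMid (e h : Fin 3 → ℝ) : Fin 4 → Fin 4 → Mat
  | 0, 0 => !![0, 0, 0, 0; 0, e 0, 0, 0; 0, 0, e 1, 0; 0, 0, 0, e 2]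
  | 0, 1 => !![0, 0, 0, 0; -e 0, 0, 0, 0; 0, 0, 0, -h 1; 0, 0, h 2, 0]
  | 0, 2 => !![0, 0, 0, 0; 0, 0, 0, h 0; -e 1, 0, 0, 0; 0, -h 2, 0, 0]
  | 0, 3 => !![0, 0, 0, 0; 0, 0, -h 0, 0; 0, h 1, 0, 0; -e 2, 0, 0, 0]
  | 1, 0 => !![0, -e 0, 0, 0; 0, 0, 0, 0; 0, 0, 0, h 2; 0, 0, -h 1, 0]
  | 1, 1 => !![e 0, 0, 0, 0; 0, 0, 0, 0; 0, 0, -e 2, 0; 0, 0, 0, -e 1]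
  | 1, 2 => !![0, 0, 0, -h 0; 0, 0, 0, 0; 0, e 2, 0, 0; h 1, 0, 0, 0]
  | 1, 3 => !![0, 0, h 0, 0; 0, 0, 0, 0; -h 2, 0, 0, 0; 0, e 1, 0, 0]
  | 2, 0 => !![0, 0, -e 1, 0; 0, 0, 0, -h 2; 0, 0, 0, 0; 0, h 0, 0, 0]
  | 2, 1 => !![0, 0, 0, h 1; 0, 0, e 2, 0; 0, 0, 0, 0; -h 0, 0, 0, 0]
  | 2, 2 => !![e 1, 0, 0, 0; 0, -e 2, 0, 0; 0, 0, 0, 0; 0, 0, 0, -e 0]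
  | 2, 3 => !![0, -h 1, 0, 0; h 2, 0, 0, 0; 0, 0, 0, 0; 0, 0, e 0, 0]
  | 3, 0 => !![0, 0, 0, -e 2; 0, 0, h 1, 0; 0, -h 0, 0, 0; 0, 0, 0, 0]
  | 3, 1 => !![0, 0, -h 2, 0; 0, 0, 0, e 1; h 0, 0, 0, 0; 0, 0, 0, 0]
  | 3, 2 => !![0, h 2, 0, 0; -h 1, 0, 0, 0; 0, 0, 0, e 0; 0, 0, 0, 0]
  | 3, 3 => !![e 2, 0, 0, 0; 0, -e 1, 0, 0; 0, 0, -e 0, 0; 0, 0, 0, 0]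

set_option maxHeartbeats 1000000 in
theorem weylOf_diagonal (e h : Fin 3 → ℝ) : ∀ a b r s : Fin 4,
    weylOf (diagonal e) (diagonal h) a r b s = diagWeylMid e h a b r s := by
  refine forall_fin_four.2 ⟨?_, ?_, ?_, ?_⟩ <;> refine forall_fin_four.2 ⟨?_, ?_, ?_, ?_⟩ <;>
    rw [diagWeylMid] <;>
    refine forall_fin_four.2 ⟨?_, ?_, ?_, ?_⟩ <;> refine forall_fin_four.2 ⟨?_, ?_, ?_, ?_⟩ <;>
    simp [weylOf, biv]

/-- The inner product of two 2-tensors in an orthonormal frame. -/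
def minkowskiInner (X Y : Mat) : ℝ :=
  ∑ r, ∑ s, (![-1, 1, 1, 1] : Vec) r * ((![-1, 1, 1, 1] : Vec) s * (X r s * Y r s))

theorem minkowskiInner_of (a b c d e f g h i j k l m n o p a' b' c' d' e' f' g' h' i' j' k' l' m'
    n' o' p' : ℝ) :
    minkowskiInner !![a, b, c, d; e, f, g, h; i, j, k, l; m, n, o, p]
      !![a', b', c', d'; e', f', g', h'; i', j', k', l'; m', n', o', p'] =
    a * a' - b * b' - c * c' - d * d' - e * e' + f * f' + g * g' + h * h' - i * i' + j * j' +
      k * k' + l * l' - m * m' + n * n' + o * o' + p * p' := by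
  simp [minkowskiInner, Fin.sum_univ_four]
  ring

/-- The completely symmetric tensor with `T_{0011} = A`, `T_{0022} = B`, `T_{0033} = C` and
`T_{0123} = w` which is the Bel-Robinson tensor of a diagonal Weyl tensor. -/
def diagBelRobinson (A B C w : ℝ) : Fin 4 → Fin 4 → Mat
  | 0, 0 => !![A + B + C, 0, 0, 0; 0, A, 0, 0; 0, 0, B, 0; 0, 0, 0, C]
  | 0, 1 => !![0, A, 0, 0; A, 0, 0, 0; 0, 0, 0, w; 0, 0, w, 0]
  | 0, 2 => !![0, 0, B, 0; 0, 0, 0, w; B, 0, 0, 0; 0, w, 0, 0]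
  | 0, 3 => !![0, 0, 0, C; 0, 0, w, 0; 0, w, 0, 0; C, 0, 0, 0]
  | 1, 0 => !![0, A, 0, 0; A, 0, 0, 0; 0, 0, 0, w; 0, 0, w, 0]
  | 1, 1 => !![A, 0, 0, 0; 0, A + B + C, 0, 0; 0, 0, -C, 0; 0, 0, 0, -B]
  | 1, 2 => !![0, 0, 0, w; 0, 0, -C, 0; 0, -C, 0, 0; w, 0, 0, 0]
  | 1, 3 => !![0, 0, w, 0; 0, 0, 0, -B; w, 0, 0, 0; 0, -B, 0, 0]
  | 2, 0 => !![0, 0, B, 0; 0, 0, 0, w; B, 0, 0, 0; 0, w, 0, 0]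
  | 2, 1 => !![0, 0, 0, w; 0, 0, -C, 0; 0, -C, 0, 0; w, 0, 0, 0]
  | 2, 2 => !![B, 0, 0, 0; 0, -C, 0, 0; 0, 0, A + B + C, 0; 0, 0, 0, -A]
  | 2, 3 => !![0, w, 0, 0; w, 0, 0, 0; 0, 0, 0, -A; 0, 0, -A, 0]
  | 3, 0 => !![0, 0, 0, C; 0, 0, w, 0; 0, w, 0, 0; C, 0, 0, 0]
  | 3, 1 => !![0, 0, w, 0; 0, 0, 0, -B; w, 0, 0, 0; 0, -B, 0, 0]
  | 3, 2 => !![0, w, 0, 0; w, 0, 0, 0; 0, 0, 0, -A; 0, 0, -A, 0]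
  | 3, 3 => !![C, 0, 0, 0; 0, -B, 0, 0; 0, 0, -A, 0; 0, 0, 0, A + B + C]

theorem diagBelRobinson_swap (A B C w : ℝ) : ∀ a b c d : Fin 4,
    diagBelRobinson A B C w a b c d = diagBelRobinson A B C w a c b d := by
  refine forall_fin_four.2 ⟨?_, ?_, ?_, ?_⟩ <;> refine forall_fin_four.2 ⟨?_, ?_, ?_, ?_⟩ <;>
    refine forall_fin_four.2 ⟨?_, ?_, ?_, ?_⟩ <;> refine forall_fin_four.2 ⟨?_, ?_, ?_, ?_⟩ <;>
    rfl

theorem belRobinson_diagonal (x y x' y' : ℝ) (a b c d : Fin 4) :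
    belRobinson minkowski (weylOf (diagonal ![x, y, -x - y]) (diagonal ![x', y', -x' - y']))
      a b c d = diagBelRobinson
        ((y ^ 2 + y' ^ 2 + x * y + x' * y') / 2) ((x ^ 2 + x' ^ 2 + x * y + x' * y') / 2)
        (-(x * y + x' * y') / 2) ((y * x' - x * y') / 2) a b c d := by
  have h (a b m n : Fin 4) : belRobinson minkowski
      (weylOf (diagonal ![x, y, -x - y]) (diagonal ![x', y', -x' - y'])) a m b n =
      (1 / 4) * (minkowskiInner (diagWeylMid ![x, y, -x - y] ![x', y', -x' - y'] a b)
          (diagWeylMid ![x, y, -x - y] ![x', y', -x' - y'] m n) +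
        minkowskiInner (diagWeylMid ![x', y', -x' - y'] ![-x, -y, -(-x - y)] a b)
          (diagWeylMid ![x', y', -x' - y'] ![-x, -y, -(-x - y)] m n)) := by
    have hn : (fun i => -(![x, y, -x - y] : Fin 3 → ℝ) i) = ![-x, -y, -(-x - y)] := by
      ext i
      fin_cases i <;> rfl
    simp only [belRobinson_minkowski, dual_weylOf, diagonal_neg, hn, weylOf_diagonal,
      minkowskiInner, ← Finset.sum_add_distrib]
    refine congrArg _ (Finset.sum_congr rfl fun _ _ => Finset.sum_congr rfl fun _ _ => ?_)
    ring
  -- The left side pairs the first index with the third; the symmetry in the middle indices brings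
  -- the table on the right into the same arrangement.
  rw [h, diagBelRobinson_swap]
  revert a c b d
  refine forall_fin_four.2 ⟨?_, ?_, ?_, ?_⟩ <;> rw [forall_comm] <;>
    refine forall_fin_four.2 ⟨?_, ?_, ?_, ?_⟩ <;> simp only [diagWeylMid, diagBelRobinson] <;>
    refine forall_fin_four.2 ⟨?_, ?_, ?_, ?_⟩ <;> refine forall_fin_four.2 ⟨?_, ?_, ?_, ?_⟩ <;>
    rw [minkowskiInner_of, minkowskiInner_of] <;>
    simp only [cons_val, of_apply] <;> ring

end SuperEnergy
end

/-! ### Relative quantities of the observer along the time axis of a frame -/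

noncomputable section

namespace SuperEnergy

open Matrix

/-- The first vector of the basis. -/
def timeVec : Vec := Pi.single 0 1

theorem timeVec_eq : timeVec = ![1, 0, 0, 0] := by
  ext i
  fin_cases i <;> simp [timeVec]

theorem isObserver_iff (G : Mat) (u : Vec) : IsObserver G u ↔ u ⬝ᵥ (G *ᵥ u) = -1 := by
  simp only [IsObserver, dotProduct, mulVec, Finset.mul_sum]
  refine Eq.congr_left (Finset.sum_congr rfl fun _ _ => Finset.sum_congr rfl fun _ _ => ?_)
  ring

theorem projector_timeVec (a b : Fin 4) :
    projector minkowski timeVec a b = if a = b then ![0, 1, 1, 1] a else 0 := by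
  simp only [projector, sum_minkowski_mul, timeVec_eq]
  revert a b
  simp [forall_fin_four]

theorem superPoynting_timeVec (W : Tensor4) (i : Fin 4) :
    superPoynting minkowski W timeVec i = -((![0, 1, 1, 1] : Vec) i *
      belRobinson minkowski W i 0 0 0) := by
  simp only [superPoynting, projector_timeVec]
  simp only [timeVec_eq, ite_mul, zero_mul]
  simp [Fin.sum_univ_four]

theorem stressFlux_timeVec (W : Tensor4) (i j k : Fin 4) :
    stressFlux minkowski W timeVec i j k = -((![0, 1, 1, 1] : Vec) i * ((![0, 1, 1, 1] : Vec) j *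
      ((![0, 1, 1, 1] : Vec) k * belRobinson minkowski W i j k 0))) := by
  simp only [stressFlux, projector_timeVec]
  simp only [timeVec, Pi.single_apply, ite_mul, mul_ite, zero_mul,
    mul_zero, mul_one, Finset.sum_ite_eq', Finset.mem_univ, if_true, mul_assoc]

theorem stressFlux_timeVec_eq_zero_iff (W : Tensor4) : stressFlux minkowski W timeVec = 0 ↔
    ∀ i j k : Fin 3, belRobinson minkowski W i.succ j.succ k.succ 0 = 0 := by
  have h (i : Fin 3) : (![0, 1, 1, 1] : Vec) i.succ = 1 := by fin_cases i <;> rfl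
  constructor
  · intro hs i j k
    have := congrFun (congrFun (congrFun hs i.succ) j.succ) k.succ
    simpa [stressFlux_timeVec, h] using this
  · intro hs
    funext i j k
    rw [stressFlux_timeVec]
    induction i using Fin.cases with
    | zero => simp
    | succ i =>
      induction j using Fin.cases with
      | zero => simp
      | succ j =>
        induction k using Fin.cases with
        | zero => simp
        | succ k => simp [hs]

theorem stressFluxScalar_timeVec (W : Tensor4) : stressFluxScalar minkowski W timeVec =
    √(∑ i : Fin 3, ∑ j : Fin 3, ∑ k : Fin 3,
      belRobinson minkowski W i.succ j.succ k.succ 0 ^ 2) := by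
  have h (i : Fin 3) : (![0, 1, 1, 1] : Vec) i.succ = 1 := by fin_cases i <;> rfl
  have h' (i : Fin 3) : (![-1, 1, 1, 1] : Vec) i.succ = 1 := by fin_cases i <;> rfl
  rw [stressFluxScalar]
  congr 1
  simp only [minkowski_inv, mul_assoc, ← Finset.mul_sum, sum_minkowski_mul, stressFlux_timeVec]
  simp only [Fin.sum_univ_succ (n := 3), h, h']
  simp [sq]

theorem electric_timeVec (W : Tensor4) (a c : Fin 4) : electric W timeVec a c = W a 0 c 0 := by
  simp [electric, timeVec, Pi.single_apply]

theorem weylOf_electric (E H : Matrix (Fin 3) (Fin 3) ℝ) (i j : Fin 3) :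
    weylOf E H i.succ 0 j.succ 0 = E i j := by
  fin_cases i <;> fin_cases j <;> simp [weylOf, biv]

/-- The commutator of two symmetric matrices is antisymmetric, and its three independent entries
are, up to a factor, the components T_{i000}. -/
theorem superPoynting_weylOf_iff {E H : Matrix (Fin 3) (Fin 3) ℝ} (hE : E.IsSymm)
    (hH : H.IsSymm) (tE : E.trace = 0) (tH : H.trace = 0) :
    superPoynting minkowski (weylOf E H) timeVec = 0 ↔ E * H = H * E := by
  rw [eq_stf hE tE, eq_stf hH tH]
  generalize E 0 0 = a, E 0 1 = b, E 0 2 = c, E 1 1 = d, E 1 2 = e, H 0 0 = a', H 0 1 = b',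
    H 0 2 = c', H 1 1 = d', H 1 2 = e'
  have h1 := belRobinson_weylOf_1000 a b c d e a' b' c' d' e'
  have h2 := belRobinson_weylOf_2000 a b c d e a' b' c' d' e'
  have h3 := belRobinson_weylOf_3000 a b c d e a' b' c' d' e'
  constructor
  · intro h
    have k (i : Fin 4) := congrFun h i
    simp only [superPoynting_timeVec] at k
    have k1 := k 1
    have k2 := k 2
    have k3 := k 3
    simp at k1 k2 k3
    rw [k1] at h1
    rw [k2] at h2
    rw [k3] at h3
    ext i j
    fin_cases i <;> fin_cases j <;> simp [stf, mul_apply, Fin.sum_univ_three] <;> linarith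
  · intro h
    have k (i j) := congrFun (congrFun h i) j
    simp only [mul_apply, Fin.sum_univ_three] at k
    have k1 := k 0 1
    have k2 := k 0 2
    have k3 := k 1 2
    simp [stf] at k1 k2 k3
    ext i
    rw [superPoynting_timeVec]
    revert i
    refine forall_fin_four.2 ⟨by simp, ?_, ?_, ?_⟩ <;> simp <;> linarith

/-- The electric and magnetic tensors are nearly parallel if the stress flux is small. -/
theorem sum_sq_mul_sum_sq_sub_le {E H : Matrix (Fin 3) (Fin 3) ℝ} (hE : E.IsSymm)
    (hH : H.IsSymm) (tE : E.trace = 0) (tH : H.trace = 0) :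
    (∑ i, ∑ j, E i j ^ 2) * (∑ i, ∑ j, H i j ^ 2) - (∑ i, ∑ j, E i j * H i j) ^ 2 ≤
      24 * stressFluxScalar minkowski (weylOf E H) timeVec ^ 2 := by
  rw [stressFluxScalar_timeVec, Real.sq_sqrt (by positivity)]
  rw [eq_stf hE tE, eq_stf hH tH]
  generalize E 0 0 = a, E 0 1 = b, E 0 2 = c, E 1 1 = d, E 1 2 = e, H 0 0 = a', H 0 1 = b',
    H 0 2 = c', H 1 1 = d', H 1 2 = e'
  set T := belRobinson minkowski (weylOf (stf a b c d e) (stf a' b' c' d' e'))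
  have h1 := belRobinson_weylOf_1110 a b c d e a' b' c' d' e'
  have h2 := belRobinson_weylOf_1120 a b c d e a' b' c' d' e'
  have h3 := belRobinson_weylOf_1130 a b c d e a' b' c' d' e'
  have h4 := belRobinson_weylOf_1220 a b c d e a' b' c' d' e'
  have h5 := belRobinson_weylOf_1230 a b c d e a' b' c' d' e'
  have h6 := belRobinson_weylOf_1330 a b c d e a' b' c' d' e'
  have h7 := belRobinson_weylOf_2220 a b c d e a' b' c' d' e'
  have h8 := belRobinson_weylOf_2230 a b c d e a' b' c' d' e'
  have h9 := belRobinson_weylOf_2330 a b c d e a' b' c' d' e'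
  have h10 := belRobinson_weylOf_3330 a b c d e a' b' c' d' e'
  -- A Lagrange identity: the Gram determinant is 2(|Q|² + |tr Q|²). The coefficients 1, 3, 6 count
  -- the orderings of the indices, and the last three squares are those of the trace vector.
  have key : 16 * ((∑ i, ∑ j, stf a b c d e i j ^ 2) * (∑ i, ∑ j, stf a' b' c' d' e' i j ^ 2) -
      (∑ i, ∑ j, stf a b c d e i j * stf a' b' c' d' e' i j) ^ 2) =
      2 * ((4 * T 1 1 1 0) ^ 2 + 3 * (4 * T 1 1 2 0) ^ 2 + 3 * (4 * T 1 1 3 0) ^ 2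
        + 3 * (4 * T 1 2 2 0) ^ 2 + 6 * (4 * T 1 2 3 0) ^ 2 + 3 * (4 * T 1 3 3 0) ^ 2
        + (4 * T 2 2 2 0) ^ 2 + 3 * (4 * T 2 2 3 0) ^ 2 + 3 * (4 * T 2 3 3 0) ^ 2
        + (4 * T 3 3 3 0) ^ 2 + (4 * T 1 1 1 0 + 4 * T 1 2 2 0 + 4 * T 1 3 3 0) ^ 2
        + (4 * T 1 1 2 0 + 4 * T 2 2 2 0 + 4 * T 2 3 3 0) ^ 2
        + (4 * T 1 1 3 0 + 4 * T 2 2 3 0 + 4 * T 3 3 3 0) ^ 2) := by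
    rw [h1, h2, h3, h4, h5, h6, h7, h8, h9, h10]
    simp [stf, Fin.sum_univ_three]
    ring
  have b (x y z : ℝ) : (x + y + z) ^ 2 ≤ 3 * x ^ 2 + 3 * y ^ 2 + 3 * z ^ 2 := by
    nlinarith [sq_nonneg (x - y), sq_nonneg (y - z), sq_nonneg (x - z)]
  have b1 := b (4 * T 1 1 1 0) (4 * T 1 2 2 0) (4 * T 1 3 3 0)
  have b2 := b (4 * T 1 1 2 0) (4 * T 2 2 2 0) (4 * T 2 3 3 0)
  have b3 := b (4 * T 1 1 3 0) (4 * T 2 2 3 0) (4 * T 3 3 3 0)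
  have le (i j k : Fin 4) : 0 ≤ T i j k 0 ^ 2 := sq_nonneg _
  -- One ordering of each triple is kept, so that no symmetry of T is needed; the loss is absorbed
  -- by the constant 24, which is not sharp.
  have S : T 1 1 1 0 ^ 2 + T 1 1 2 0 ^ 2 + T 1 1 3 0 ^ 2 + T 1 2 2 0 ^ 2 + T 1 2 3 0 ^ 2
      + T 1 3 3 0 ^ 2 + T 2 2 2 0 ^ 2 + T 2 2 3 0 ^ 2 + T 2 3 3 0 ^ 2 + T 3 3 3 0 ^ 2 ≤
      ∑ i : Fin 3, ∑ j : Fin 3, ∑ k : Fin 3, T i.succ j.succ k.succ 0 ^ 2 := by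
    simp only [Fin.sum_univ_three, Fin.succ_zero_eq_one, Fin.succ_one_eq_two, Fin.reduceSucc]
    linarith [le 1 2 1, le 1 3 1, le 2 1 1, le 3 1 1, le 2 1 2, le 2 2 1, le 2 1 3, le 1 3 2,
      le 2 3 1, le 3 1 2, le 3 2 1, le 3 1 3, le 3 3 1, le 2 3 2, le 3 2 2, le 3 2 3, le 3 3 2]
  linarith [le 1 1 1, le 1 1 2, le 1 1 3, le 1 2 2, le 1 2 3, le 1 3 3, le 2 2 2, le 2 2 3,
    le 2 3 3, le 3 3 3]

end SuperEnergy
end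

noncomputable section

namespace SuperEnergy

open Matrix

/-! ### The Weyl endomorphism in an orthonormal frame -/

theorem pull_mul (P R : Mat) (T : Tensor4) : pull (P * R) T = pull R (pull P T) := by
  apply flat_injective
  rw [flat_pull, flat_pull, flat_pull, mul_kronecker_mul, transpose_mul]
  simp only [Matrix.mul_assoc]

theorem pull_one (T : Tensor4) : pull 1 T = T := by
  apply flat_injective
  rw [flat_pull, one_kronecker_one, transpose_one, Matrix.one_mul, Matrix.mul_one]

theorem congrC_mul (P R : Mat) (F : CMat) : congrC (P * R) F = congrC R (congrC P F) := by
  have h : (P * R).map Complex.ofReal = P.map Complex.ofReal * R.map Complex.ofReal :=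
    Matrix.map_mul (f := Complex.ofRealHom)
  rw [congrC, congrC, congrC, h, transpose_mul]
  simp only [Matrix.mul_assoc]

theorem congrC_one (F : CMat) : congrC 1 F = F := by
  have h : (1 : Mat).map Complex.ofReal = 1 := Matrix.map_one _ Complex.ofReal_zero Complex.ofReal_one
  rw [congrC, h, transpose_one, Matrix.one_mul, Matrix.mul_one]

theorem congrC_transpose (P : Mat) (F : CMat) : (congrC P F)ᵀ = congrC P Fᵀ := by
  rw [congrC, congrC, transpose_mul, transpose_mul, transpose_transpose, Matrix.mul_assoc]

theorem congrC_smul (P : Mat) (z : ℂ) (F : CMat) : congrC P (z • F) = z • congrC P F := by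
  rw [congrC, congrC, Matrix.mul_smul, Matrix.smul_mul]

theorem congrC_add (P : Mat) (F F' : CMat) : congrC P (F + F') = congrC P F + congrC P F' := by
  rw [congrC, congrC, congrC, Matrix.mul_add, Matrix.add_mul]

theorem congrC_sub (P : Mat) (F F' : CMat) : congrC P (F - F') = congrC P F - congrC P F' := by
  rw [congrC, congrC, congrC, Matrix.mul_sub, Matrix.sub_mul]

theorem bivectorMap_pull (P G : Mat) (hP : IsUnit P.det) (T : Tensor4) (F : CMat) :
    bivectorMap (Pᵀ * G * P) (pull P T) (congrC P F) = congrC P (bivectorMap G T F) := by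
  rw [bivectorMap_eq, bivectorMap_eq, tensorApply_pull P G hP, congrC_smul]

theorem selfDualProj_apply (G : Mat) (F : CMat) : selfDualProj G F = (1 / 2 : ℂ) •
    ((1 / 2 : ℂ) • (F - Fᵀ) - Complex.I • bivectorMap G (volumeElement G)
      ((1 / 2 : ℂ) • (F - Fᵀ))) := rfl

theorem selfDualProj_congrC (P G : Mat) (hP : 0 < P.det) (F : CMat) :
    selfDualProj (Pᵀ * G * P) (congrC P F) = congrC P (selfDualProj G F) := by
  simp only [selfDualProj_apply]
  rw [congrC_transpose, ← congrC_sub, ← congrC_smul, ← pull_volumeElement P G hP,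
    bivectorMap_pull P G hP.ne'.isUnit, ← congrC_smul, ← congrC_sub, ← congrC_smul]

theorem tensorApply_minkowski (T : Tensor4) (F : CMat) (a b : Fin 4) :
    tensorApply minkowski T F a b = ∑ c, ∑ d, (![-1, 1, 1, 1] : Fin 4 → ℂ) c *
      ((![-1, 1, 1, 1] : Fin 4 → ℂ) d * (T a b c d * F c d)) := by
  have hm (a b : Fin 4) : ((minkowski a b : ℝ) : ℂ) =
      if a = b then (![-1, 1, 1, 1] : Fin 4 → ℂ) a else 0 := by
    rw [minkowski, diagonal_apply, apply_ite Complex.ofReal, Complex.ofReal_zero]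
    congr 1
    revert a
    simp [forall_fin_four]
  simp only [tensorApply, minkowski_inv, of_apply, Complex.ofReal_mul, hm]
  refine Finset.sum_congr rfl fun c _ => Finset.sum_congr rfl fun d _ => ?_
  simp only [mul_ite, ite_mul, mul_zero, zero_mul, Finset.sum_ite_eq, Finset.mem_univ, if_true]
  ring

theorem bivectorMap_weylOf (E H : Matrix (Fin 3) (Fin 3) ℝ) (x y : Fin 3 → ℂ) :
    bivectorMap minkowski (weylOf E H) (biv x y) =
      biv (-(E.map Complex.ofReal *ᵥ x) + H.map Complex.ofReal *ᵥ y)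
        (-(H.map Complex.ofReal *ᵥ x) - E.map Complex.ofReal *ᵥ y) := by
  ext a b
  rw [bivectorMap_eq, Matrix.smul_apply, tensorApply_minkowski]
  revert a b
  refine forall_fin_four.2 ⟨?_, ?_, ?_, ?_⟩ <;> refine forall_fin_four.2 ⟨?_, ?_, ?_, ?_⟩ <;>
    simp [Fin.sum_univ_four, weylOf, biv, mulVec, dotProduct, Fin.sum_univ_three] <;> ring

/-- The array of parts 0 and 1 is not traceless, but `bivectorMap_weylOf` requires no symmetry of E
and H, so it also computes the duality of bivectors. -/
theorem volumeElement_minkowski : volumeElement minkowski = weylOf 0 1 := by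
  funext a b c d
  have hv (a b c d : Fin 4) : volumeElement minkowski a b c d = leviCivita a b c d := by
    rw [volumeElement, det_minkowski, neg_neg, Real.sqrt_one, one_mul]
  have e1 (a b : Fin 4) : leviCivita a b c d =
      biv ![leviCivita a b 0 1, leviCivita a b 0 2, leviCivita a b 0 3]
        ![leviCivita a b 2 3, leviCivita a b 3 1, leviCivita a b 1 2] c d :=
    congrFun (congrFun (eq_biv_of_antisymm (X := of fun c d => leviCivita a b c d) fun c d => by
      simp only [of_apply, leviCivita_eq]; ring) c) d
  have e2 := congrFun (congrFun (eq_biv_of_antisymm (X := of fun a b => leviCivita a b c d)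
    fun a b => by simp only [of_apply, leviCivita_eq]; ring) a) b
  rw [hv]
  refine e2.trans (congrFun (congrFun (congrArg₂ biv ?_ ?_) a) b) <;> ext i <;> fin_cases i <;>
    simp only [of_apply, Fin.zero_eta, Fin.mk_one, Fin.reduceFinMk, cons_val] <;> rw [e1] <;>
    refine congrFun (congrFun (congrArg₂ biv ?_ ?_) c) d <;> ext j <;> fin_cases j <;>
    simp [leviCivita_eq] <;> norm_num

theorem biv_add (x y x' y' : Fin 3 → ℂ) : biv (x + x') (y + y') = biv x y + biv x' y' := by
  ext a b
  revert a b
  refine forall_fin_four.2 ⟨?_, ?_, ?_, ?_⟩ <;> refine forall_fin_four.2 ⟨?_, ?_, ?_, ?_⟩ <;>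
    simp [biv] <;> ring

theorem biv_smul (z : ℂ) (x y : Fin 3 → ℂ) : biv (z • x) (z • y) = z • biv x y := by
  ext a b
  revert a b
  simp [forall_fin_four, biv]

theorem biv_sub (x y x' y' : Fin 3 → ℂ) : biv (x - x') (y - y') = biv x y - biv x' y' := by
  rw [sub_eq_add_neg, sub_eq_add_neg, sub_eq_add_neg, biv_add, ← neg_one_smul ℂ x',
    ← neg_one_smul ℂ y', biv_smul, neg_one_smul]

/-- The self-dual bivectors of an orthonormal frame, from their electric part. -/
def selfDualOf : (Fin 3 → ℂ) →ₗ[ℂ] CMat where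
  toFun x := biv x (Complex.I • x)
  map_add' x y := by rw [smul_add, biv_add]
  map_smul' z x := by rw [smul_comm, biv_smul, RingHom.id_apply]

/-- The matrix of the Weyl endomorphism in an orthonormal frame. -/
def weylMatrix (E H : Matrix (Fin 3) (Fin 3) ℝ) : Matrix (Fin 3) (Fin 3) ℂ :=
  Complex.I • H.map Complex.ofReal - E.map Complex.ofReal

theorem bivectorMap_selfDualOf (E H : Matrix (Fin 3) (Fin 3) ℝ) (x : Fin 3 → ℂ) :
    bivectorMap minkowski (weylOf E H) (selfDualOf x) = selfDualOf (weylMatrix E H *ᵥ x) := by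
  change bivectorMap minkowski (weylOf E H) (biv x (Complex.I • x)) = biv _ _
  rw [bivectorMap_weylOf, weylMatrix, sub_mulVec, smul_mulVec, mulVec_smul, mulVec_smul,
    smul_sub, smul_smul, Complex.I_mul_I]
  congr 1
  · abel
  · simp

/-- Duality sends the pair (x, y) to (y, -x), so self-duality means y = ix, and half of 1 - i* has
the electric part (x - iy)/2. -/
theorem selfDualProj_of_biv {F : CMat} {x y : Fin 3 → ℂ}
    (h : (1 / 2 : ℂ) • (F - Fᵀ) = biv x y) :
    selfDualProj minkowski F = selfDualOf ((1 / 2 : ℂ) • (x - Complex.I • y)) := by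
  rw [selfDualProj_apply, h, volumeElement_minkowski, bivectorMap_weylOf]
  have h0 : (0 : Matrix (Fin 3) (Fin 3) ℝ).map Complex.ofReal = 0 := by ext; simp
  have h1 : (1 : Matrix (Fin 3) (Fin 3) ℝ).map Complex.ofReal = 1 :=
    Matrix.map_one _ Complex.ofReal_zero Complex.ofReal_one
  rw [h0, h1, map_smul]
  simp only [zero_mulVec, one_mulVec, neg_zero, zero_add, sub_zero, ← biv_smul, ← biv_sub]
  change _ = (1 / 2 : ℂ) • biv _ _
  rw [← biv_smul, smul_sub Complex.I, smul_smul, Complex.I_mul_I]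
  congr 2
  simp [add_comm]

theorem selfDualProj_selfDualOf (x : Fin 3 → ℂ) :
    selfDualProj minkowski (selfDualOf x) = selfDualOf x := by
  have h : (1 / 2 : ℂ) • (selfDualOf x - (selfDualOf x)ᵀ) = biv x (Complex.I • x) := by
    change (1 / 2 : ℂ) • (biv x (Complex.I • x) - (biv x (Complex.I • x))ᵀ) = _
    ext a b
    revert a b
    refine forall_fin_four.2 ⟨?_, ?_, ?_, ?_⟩ <;> refine forall_fin_four.2 ⟨?_, ?_, ?_, ?_⟩ <;>
      simp [biv] <;> ring
  rw [selfDualProj_of_biv h, smul_smul, Complex.I_mul_I]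
  congr 1
  ext i
  simp
  ring

theorem range_selfDualProj_minkowski :
    LinearMap.range (selfDualProj minkowski) = LinearMap.range selfDualOf := by
  apply le_antisymm
  · rintro _ ⟨F, rfl⟩
    refine ⟨_, (selfDualProj_of_biv (eq_biv_of_antisymm fun a b => ?_)).symm⟩
    simp
    ring
  · rintro _ ⟨x, rfl⟩
    exact ⟨_, selfDualProj_selfDualOf x⟩

theorem selfDualOf_injective : Function.Injective selfDualOf := by
  intro x y h
  have h' (i : Fin 3) : selfDualOf x 0 i.succ = selfDualOf y 0 i.succ := by rw [h]
  ext i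
  have := h' i
  change biv x _ 0 i.succ = biv y _ 0 i.succ at this
  fin_cases i <;> simpa [biv] using this

/-- In an orthonormal frame, the Weyl endomorphism of the self-dual bivectors is the matrix
`-E + iH`. -/
theorem exists_weylEnd_conj {P G : Mat} (hP : 0 < P.det) (hG : Pᵀ * G * P = minkowski)
    {W : Tensor4} {E H : Matrix (Fin 3) (Fin 3) ℝ} (hW : pull P W = weylOf E H) :
    ∃ e : (Fin 3 → ℂ) ≃ₗ[ℂ] SelfDual G,
      ∀ x, weylEnd G W (e x) = e (weylMatrix E H *ᵥ x) := by
  have hu : IsUnit P.det := hP.ne'.isUnit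
  have hQ : 0 < P⁻¹.det := by
    rw [det_nonsing_inv, Ring.inverse_eq_inv']
    exact inv_pos.2 hP
  have hG' : G = P⁻¹ᵀ * minkowski * P⁻¹ := by
    rw [← hG]
    calc G = (P * P⁻¹)ᵀ * G * (P * P⁻¹) := by
          rw [mul_nonsing_inv _ hu, transpose_one, Matrix.one_mul, Matrix.mul_one]
      _ = _ := by rw [transpose_mul]; simp only [Matrix.mul_assoc]
  have hW' : W = pull P⁻¹ (weylOf E H) := by
    rw [← hW, ← pull_mul, mul_nonsing_inv _ hu, pull_one]
  let c : CMat →ₗ[ℂ] CMat := ⟨⟨congrC P⁻¹, congrC_add _⟩, congrC_smul _⟩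
  let s : (Fin 3 → ℂ) →ₗ[ℂ] CMat := c ∘ₗ selfDualOf
  have hc (F : CMat) : congrC P (congrC P⁻¹ F) = F := by
    rw [← congrC_mul, nonsing_inv_mul _ hu, congrC_one]
  have hc' (F : CMat) : congrC P⁻¹ (congrC P F) = F := by
    rw [← congrC_mul, mul_nonsing_inv _ hu, congrC_one]
  have hs : Function.Injective s := fun x y h =>
    selfDualOf_injective ((Function.LeftInverse.injective hc) h)
  have hproj (F : CMat) : selfDualProj G (congrC P⁻¹ F) = congrC P⁻¹ (selfDualProj minkowski F) := by
    rw [hG', selfDualProj_congrC _ _ hQ]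
  have hr : LinearMap.range s = SelfDual G := by
    apply le_antisymm
    · rintro _ ⟨x, rfl⟩
      refine ⟨congrC P⁻¹ (selfDualOf x), ?_⟩
      rw [hproj, selfDualProj_selfDualOf]
      rfl
    · rintro _ ⟨F, rfl⟩
      rw [← hc' F, hproj]
      obtain ⟨x, hx⟩ : selfDualProj minkowski (congrC P F) ∈ LinearMap.range selfDualOf :=
        range_selfDualProj_minkowski ▸ LinearMap.mem_range_self _ _
      exact ⟨x, by rw [← hx]; rfl⟩
  refine ⟨(LinearEquiv.ofInjective s hs).trans (LinearEquiv.ofEq _ _ hr), fun x => ?_⟩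
  apply Subtype.ext
  change selfDualProj G (bivectorMap G W (congrC P⁻¹ (selfDualOf x))) =
    congrC P⁻¹ (selfDualOf (weylMatrix E H *ᵥ x))
  have hb : bivectorMap G W (congrC P⁻¹ (selfDualOf x)) =
      congrC P⁻¹ (selfDualOf (weylMatrix E H *ᵥ x)) := by
    rw [hG', hW', bivectorMap_pull _ _ hQ.ne'.isUnit, bivectorMap_selfDualOf]
  rw [hb, hproj, selfDualProj_selfDualOf]

end SuperEnergy
end

noncomputable section

namespace SuperEnergy

open Matrix

/-! ### Schur's inequality -/

theorem sum_norm_sq_eq_trace {n : ℕ} (M : Matrix (Fin n) (Fin n) ℂ) :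
    ((∑ i, ∑ j, ‖M i j‖ ^ 2 : ℝ) : ℂ) = trace (Mᴴ * M) := by
  simp only [trace, diag_apply, mul_apply, conjTranspose_apply, Complex.ofReal_sum,
    Complex.ofReal_pow]
  rw [Finset.sum_comm]
  refine Finset.sum_congr rfl fun _ _ => Finset.sum_congr rfl fun _ _ => ?_
  rw [← Complex.conj_mul']
  rfl

theorem charpoly_of_column_zero {n : ℕ} {N : Matrix (Fin (n + 1)) (Fin (n + 1)) ℂ}
    (h : ∀ i : Fin n, N i.succ 0 = 0) : N.charpoly =
      (Polynomial.X - Polynomial.C (N 0 0)) * (N.submatrix Fin.succ Fin.succ).charpoly := by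
  have hs : N.charmatrix.submatrix Fin.succ Fin.succ = (N.submatrix Fin.succ Fin.succ).charmatrix := by
    ext1 i j
    simp [charmatrix_apply, diagonal_apply]
  have hc : N.charpoly = N.charmatrix.det := rfl
  have hc' : (N.submatrix Fin.succ Fin.succ).charpoly =
      (N.submatrix Fin.succ Fin.succ).charmatrix.det := rfl
  rw [hc, det_succ_column_zero, Fin.sum_univ_succ, Finset.sum_eq_zero]
  · simp only [Fin.val_zero, pow_zero, one_mul, add_zero, charmatrix_apply_eq]
    rw [hc', ← hs]
    rfl
  · intro i _
    rw [charmatrix_apply_ne _ _ _ (Fin.succ_ne_zero i), h]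
    simp

/-- Schur's inequality. -/
theorem sum_norm_sq_roots_charpoly_le {n : ℕ} (M : Matrix (Fin n) (Fin n) ℂ) :
    (M.charpoly.roots.map fun ρ => ‖ρ‖ ^ 2).sum ≤ ∑ i, ∑ j, ‖M i j‖ ^ 2 := by
  induction n with
  | zero => simp [charpoly_isEmpty]
  | succ n ih =>
    -- Unitary triangularization, one step at a time: a unit eigenvector is completed to an
    -- orthonormal basis, in which the first column vanishes below the diagonal. Neither the
    -- characteristic polynomial nor the sum of squared moduli changes.
    obtain ⟨z, hz⟩ := Module.End.exists_eigenvalue (toEuclideanLin M)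
    obtain ⟨v, hv⟩ := hz.exists_hasEigenvector
    have hv0 : ‖v‖ ≠ 0 := norm_ne_zero_iff.2 hv.2
    obtain ⟨b, hb⟩ := Orthonormal.exists_orthonormalBasis_extension_of_card_eq (𝕜 := ℂ)
      (E := EuclideanSpace ℂ (Fin (n + 1))) (ι := Fin (n + 1)) (by simp)
      (v := fun _ => ((‖v‖ : ℂ)⁻¹) • v) (s := {0}) (by
        refine ⟨fun i => ?_, fun i j hij => absurd (Subsingleton.elim i j) hij⟩
        simp [norm_smul, hv0])
    have hb0 : b 0 = ((‖v‖ : ℂ)⁻¹) • v := hb 0 rfl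
    have he : toEuclideanLin M (b 0) = z • b 0 := by
      rw [hb0, map_smul, hv.apply_eq_smul, smul_comm]
    set U : Matrix (Fin (n + 1)) (Fin (n + 1)) ℂ := of fun i j => b j i with hU
    have hUU : Uᴴ * U = 1 := by
      ext i j
      have := (orthonormal_iff_ite.1 b.orthonormal) i j
      rw [one_apply, ← this]
      simp [mul_apply, hU, PiLp.inner_apply, mul_comm]
    have hUU' : U * Uᴴ = 1 := mul_eq_one_comm.1 hUU
    set N := Uᴴ * (M * U) with hN
    have hcol : ∀ i, (M * U) i 0 = z * U i 0 := by
      intro i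
      have := congrArg (fun w : EuclideanSpace ℂ (Fin (n + 1)) => w i) he
      simpa [toLpLin_apply, mulVec, dotProduct, mul_apply, hU] using this
    have hN0 : ∀ i, N i 0 = z * (1 : Matrix (Fin (n + 1)) (Fin (n + 1)) ℂ) i 0 := by
      intro i
      rw [← hUU, hN, mul_apply, mul_apply, Finset.mul_sum]
      refine Finset.sum_congr rfl fun j _ => ?_
      rw [hcol]
      ring
    have hchar : M.charpoly = N.charpoly := by
      rw [hN, charpoly_mul_comm, Matrix.mul_assoc, hUU', Matrix.mul_one]
    have hfrob : ∑ i, ∑ j, ‖M i j‖ ^ 2 = ∑ i, ∑ j, ‖N i j‖ ^ 2 := by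
      have : ((∑ i, ∑ j, ‖M i j‖ ^ 2 : ℝ) : ℂ) = ((∑ i, ∑ j, ‖N i j‖ ^ 2 : ℝ) : ℂ) := by
        rw [sum_norm_sq_eq_trace, sum_norm_sq_eq_trace, hN]
        simp only [conjTranspose_mul, conjTranspose_conjTranspose]
        calc trace (Mᴴ * M) = trace ((U * Uᴴ) * Mᴴ * ((U * Uᴴ) * M)) := by
              rw [hUU', Matrix.one_mul, Matrix.one_mul]
          _ = trace (U * (Uᴴ * Mᴴ * U * (Uᴴ * M))) := by simp only [Matrix.mul_assoc]
          _ = _ := by rw [trace_mul_comm]; simp only [Matrix.mul_assoc]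
      exact_mod_cast this
    have hs : ∀ i : Fin n, N i.succ 0 = 0 := by
      intro i
      rw [hN0, one_apply_ne (Fin.succ_ne_zero i), mul_zero]
    rw [hchar, hfrob, charpoly_of_column_zero hs, Polynomial.roots_mul
      (mul_ne_zero (Polynomial.X_sub_C_ne_zero _) (charpoly_monic _).ne_zero),
      Polynomial.roots_X_sub_C, Multiset.map_add, Multiset.sum_add, Multiset.map_singleton,
      Multiset.sum_singleton, Fin.sum_univ_succ]
    -- The inequality comes from discarding the entries of the first row to the right of the
    -- diagonal.
    refine add_le_add ?_ ((ih _).trans (Finset.sum_le_sum fun i _ => ?_))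
    · exact Finset.single_le_sum (f := fun j => ‖N 0 j‖ ^ 2) (fun _ _ => sq_nonneg _)
        (Finset.mem_univ 0)
    · rw [Fin.sum_univ_succ]
      exact le_add_of_nonneg_left (sq_nonneg _)

end SuperEnergy
end

noncomputable section

namespace SuperEnergy

open Matrix

/-! ### Orthonormal frames -/

/-- The columns of `P` form an oriented orthonormal basis. -/
structure IsFrame (G P : Mat) : Prop where
  congruence : Pᵀ * G * P = minkowski
  det_pos : 0 < P.det

theorem IsFrame.mul {G P L : Mat} (hP : IsFrame G P) (hL : IsFrame minkowski L) :
    IsFrame G (P * L) := by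
  refine ⟨?_, ?_⟩
  · rw [transpose_mul, ← hL.congruence, ← hP.congruence]
    simp only [Matrix.mul_assoc]
  · rw [det_mul]
    exact mul_pos hP.det_pos hL.det_pos

theorem minkowski_transpose : minkowskiᵀ = minkowski := diagonal_transpose _

/-- Lorentz transformations act transitively on the observers. -/
theorem exists_lorentz_mulVec_timeVec {v : Vec} (hv : v ⬝ᵥ (minkowski *ᵥ v) = -1) :
    ∃ L : Mat, Lᵀ * minkowski * L = minkowski ∧ L *ᵥ timeVec = v := by
  -- The reflection in w = `timeVec` - v exchanges the two unit timelike vectors, for either time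
  -- orientation of v. Its denominator w·w = 2(v₀ - 1) vanishes only if v₀ = 1, and then v is
  -- `timeVec` itself.
  by_cases h0 : v 0 = 1
  · refine ⟨1, by simp, ?_⟩
    have hq : -(v 0) ^ 2 + v 1 ^ 2 + v 2 ^ 2 + v 3 ^ 2 = -1 := by
      rw [← hv]
      simp [minkowski, mulVec_diagonal, dotProduct, Fin.sum_univ_four]
      ring
    rw [h0] at hq
    have h1 : v 1 = 0 := by nlinarith [sq_nonneg (v 1), sq_nonneg (v 2), sq_nonneg (v 3)]
    have h2 : v 2 = 0 := by nlinarith [sq_nonneg (v 1), sq_nonneg (v 2), sq_nonneg (v 3)]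
    have h3 : v 3 = 0 := by nlinarith [sq_nonneg (v 1), sq_nonneg (v 2), sq_nonneg (v 3)]
    rw [one_mulVec, timeVec_eq]
    ext i
    fin_cases i <;> simp [h0, h1, h2, h3]
  · set k := (v 0 - 1)⁻¹ with hk
    have hk0 : k * (v 0 - 1) = 1 := inv_mul_cancel₀ (sub_ne_zero.2 h0)
    set w := timeVec - v with hw
    have w0 : w 0 = 1 - v 0 := by simp [hw, timeVec]
    have w1 : w 1 = -v 1 := by simp [hw, timeVec]
    have w2 : w 2 = -v 2 := by simp [hw, timeVec]
    have w3 : w 3 = -v 3 := by simp [hw, timeVec]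
    have ht : (minkowski *ᵥ w) ⬝ᵥ timeVec = v 0 - 1 := by
      simp [minkowski, mulVec_diagonal, dotProduct, Fin.sum_univ_four, timeVec, w0]
    have hww : w ⬝ᵥ (minkowski *ᵥ w) = 2 * (v 0 - 1) := by
      have : w ⬝ᵥ (minkowski *ᵥ w) = v ⬝ᵥ (minkowski *ᵥ v) + 2 * v 0 - 1 := by
        simp [minkowski, mulVec_diagonal, dotProduct, Fin.sum_univ_four, w0, w1, w2, w3]
        ring
      rw [this, hv]
      ring
    refine ⟨1 - k • vecMulVec w (minkowski *ᵥ w), ?_, ?_⟩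
    · have h1 : (1 - k • vecMulVec w (minkowski *ᵥ w))ᵀ =
          1 - k • vecMulVec (minkowski *ᵥ w) w := by
        rw [transpose_sub, transpose_one, transpose_smul, transpose_vecMulVec]
      have h2 : w ᵥ* minkowski = minkowski *ᵥ w := by
        rw [← mulVec_transpose, minkowski_transpose]
      rw [h1, Matrix.sub_mul, Matrix.one_mul, Matrix.smul_mul, vecMulVec_mul, h2, Matrix.mul_sub,
        Matrix.mul_one, Matrix.sub_mul, Matrix.mul_smul, Matrix.smul_mul, mul_vecMulVec,
        Matrix.mul_smul, vecMulVec_mul_vecMulVec, dotProduct_comm, hww]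
      have hk2 : k * k * (2 * (v 0 - 1)) = 2 * k := by linear_combination 2 * k * hk0
      rw [vecMulVec_smul, smul_smul, smul_smul, hk2]
      module
    · rw [sub_mulVec, one_mulVec, smul_mulVec, vecMulVec_mulVec, ht]
      rw [op_smul_eq_smul, smul_smul, hk0, one_smul, hw, sub_sub_cancel]

theorem exists_isFrame {G : Mat} (hG : IsLorentzian G) {u : Vec} (hu : IsObserver G u) :
    ∃ P, IsFrame G P ∧ P *ᵥ timeVec = u := by
  obtain ⟨-, P, hP, hPG⟩ := hG
  have hPG' : Pᵀ * G * P = minkowski := hPG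
  have hv : (P⁻¹ *ᵥ u) ⬝ᵥ (minkowski *ᵥ (P⁻¹ *ᵥ u)) = -1 := by
    rw [isObserver_iff] at hu
    rw [← hu, ← hPG']
    have : (Pᵀ * G * P) *ᵥ (P⁻¹ *ᵥ u) = Pᵀ *ᵥ (G *ᵥ u) := by
      rw [mulVec_mulVec, Matrix.mul_assoc, mul_nonsing_inv _ hP, Matrix.mul_one, ← mulVec_mulVec]
    rw [this, dotProduct_mulVec, vecMul_transpose, mulVec_mulVec, mul_nonsing_inv _ hP,
      one_mulVec]
  obtain ⟨L, hL, hLv⟩ := exists_lorentz_mulVec_timeVec hv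
  have h1 : (P * L)ᵀ * G * (P * L) = minkowski := by
    rw [← hL, ← hPG', transpose_mul]
    simp only [Matrix.mul_assoc]
  have h2 : (P * L) *ᵥ timeVec = u := by
    rw [← mulVec_mulVec, hLv, mulVec_mulVec, mul_nonsing_inv _ hP, one_mulVec]
  have h3 : (P * L).det ≠ 0 := by
    intro h
    have := congrArg det h1
    rw [det_mul, h, mul_zero, det_minkowski] at this
    norm_num at this
  -- A wrong orientation is corrected by reversing the last spatial axis, which leaves the observer
  -- alone.
  rcases lt_or_gt_of_ne h3 with h3 | h3
  · refine ⟨P * L * diagonal ![1, 1, 1, -1], ⟨?_, ?_⟩, ?_⟩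
    · rw [transpose_mul, diagonal_transpose]
      calc diagonal ![1, 1, 1, -1] * (P * L)ᵀ * G * (P * L * diagonal ![1, 1, 1, -1]) =
          diagonal ![1, 1, 1, -1] * ((P * L)ᵀ * G * (P * L)) * diagonal ![1, 1, 1, -1] := by
            simp only [Matrix.mul_assoc]
        _ = minkowski := by
            rw [h1, minkowski, diagonal_mul_diagonal, diagonal_mul_diagonal]
            congr 1
            ext i
            fin_cases i <;> simp
    · rw [det_mul, det_diagonal]
      simpa [Fin.prod_univ_four] using h3
    · rw [← mulVec_mulVec]
      have : diagonal ![1, 1, 1, -1] *ᵥ timeVec = timeVec := by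
        rw [timeVec_eq]
        ext i
        fin_cases i <;> simp [mulVec_diagonal]
      rw [this, h2]
  · exact ⟨P * L, ⟨h1, h3⟩, h2⟩

theorem isObserver_mulVec_timeVec {G P : Mat} (h : Pᵀ * G * P = minkowski) :
    IsObserver G (P *ᵥ timeVec) := by
  rw [isObserver_iff]
  have : (P *ᵥ timeVec) ⬝ᵥ (G *ᵥ (P *ᵥ timeVec)) = timeVec ⬝ᵥ (minkowski *ᵥ timeVec) := by
    rw [← h, ← mulVec_mulVec, ← mulVec_mulVec, dotProduct_mulVec timeVec,
      vecMul_transpose]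
  rw [this, timeVec_eq]
  simp [minkowski, mulVec_diagonal, dotProduct, Fin.sum_univ_four]

theorem IsFrame.isObserver {G P : Mat} (h : IsFrame G P) : IsObserver G (P *ᵥ timeVec) :=
  isObserver_mulVec_timeVec h.congruence

/-- The Weyl tensor `W` has the electric and magnetic parts `E` and `H` in the frame `P`. -/
structure HasParts (G : Mat) (W : Tensor4) (P : Mat) (E H : Matrix (Fin 3) (Fin 3) ℝ) : Prop where
  frame : IsFrame G P
  symmE : E.IsSymm
  symmH : H.IsSymm
  traceE : E.trace = 0
  traceH : H.trace = 0
  eq : pull P W = weylOf E H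

theorem IsFrame.exists_hasParts {G P : Mat} {W : Tensor4} (hP : IsFrame G P)
    (hW : IsWeylTensor G W) : ∃ E H, HasParts G W P E H := by
  have h := hW.pull hP.det_pos.ne'.isUnit
  rw [hP.congruence] at h
  obtain ⟨E, H, h1, h2, h3, h4, h5⟩ := exists_eq_weylOf h
  exact ⟨E, H, hP, h1, h2, h3, h4, h5⟩

/-- The normal form exists in the new frame as well, so its two parts can be read off from the
components W_{i0j0} of the tensor and of its dual. -/
theorem HasParts.mul {G : Mat} {W : Tensor4} {P L : Mat} {E H : Matrix (Fin 3) (Fin 3) ℝ}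
    (h : HasParts G W P E H) (hW : IsWeylTensor G W) (hL : IsFrame minkowski L) :
    HasParts G W (P * L)
      (of fun i j => (Lᵀ * electric (weylOf E H) (L *ᵥ timeVec) * L) i.succ j.succ)
      (of fun i j => (Lᵀ * electric (weylOf H (-E)) (L *ᵥ timeVec) * L) i.succ j.succ) := by
  obtain ⟨E', H', h'⟩ := (h.frame.mul hL).exists_hasParts hW
  have hp : pull L (weylOf E H) = weylOf E' H' := by
    rw [← h'.eq, pull_mul, h.eq]
  have hd : pull L (weylOf H (-E)) = weylOf H' (-E') := by
    rw [← dual_weylOf, ← dual_weylOf, ← hp, ← pull_dual L minkowski hL.det_pos, hL.congruence]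
  have e1 : (of fun i j => (Lᵀ * electric (weylOf E H) (L *ᵥ timeVec) * L) i.succ j.succ :
      Matrix (Fin 3) (Fin 3) ℝ) = E' := by
    ext i j
    rw [of_apply, ← electric_pull, hp, electric_timeVec, weylOf_electric]
  have e2 : (of fun i j => (Lᵀ * electric (weylOf H (-E)) (L *ᵥ timeVec) * L) i.succ j.succ :
      Matrix (Fin 3) (Fin 3) ℝ) = H' := by
    ext i j
    rw [of_apply, ← electric_pull, hd, electric_timeVec, weylOf_electric]
  rw [e1, e2]
  exact h'

/-- A rotation of the spatial vectors. -/
def rotMat (R : Matrix (Fin 3) (Fin 3) ℝ) : Mat :=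
  !![1, 0, 0, 0; 0, R 0 0, R 0 1, R 0 2; 0, R 1 0, R 1 1, R 1 2; 0, R 2 0, R 2 1, R 2 2]

theorem rotMat_mulVec_timeVec (R : Matrix (Fin 3) (Fin 3) ℝ) : rotMat R *ᵥ timeVec = timeVec := by
  rw [timeVec_eq]
  ext i
  fin_cases i <;> simp [rotMat, mulVec, dotProduct, Fin.sum_univ_four]

theorem isFrame_rotMat {R : Matrix (Fin 3) (Fin 3) ℝ} (hR : Rᵀ * R = 1) (hd : R.det = 1) :
    IsFrame minkowski (rotMat R) := by
  have h (i j) := congrFun (congrFun hR i) j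
  simp only [mul_apply, Fin.sum_univ_three, transpose_apply, one_apply] at h
  refine ⟨?_, ?_⟩
  · ext i j
    revert i j
    refine forall_fin_four.2 ⟨?_, ?_, ?_, ?_⟩ <;> refine forall_fin_four.2 ⟨?_, ?_, ?_, ?_⟩ <;>
      simp [minkowski, rotMat, mul_apply, Fin.sum_univ_four, diagonal_apply]
    · simpa using h 0 0
    · simpa using h 0 1
    · simpa using h 0 2
    · simpa using h 1 0
    · simpa using h 1 1
    · simpa using h 1 2
    · simpa using h 2 0
    · simpa using h 2 1
    · simpa using h 2 2
  · have : (rotMat R).det = R.det := by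
      rw [det_succ_row_zero, det_fin_three]
      simp [Fin.sum_univ_four, rotMat, det_fin_three]
    rw [this, hd]
    norm_num

theorem HasParts.rot {G : Mat} {W : Tensor4} {P : Mat} {E H : Matrix (Fin 3) (Fin 3) ℝ}
    (h : HasParts G W P E H) (hW : IsWeylTensor G W) {R : Matrix (Fin 3) (Fin 3) ℝ}
    (hR : Rᵀ * R = 1) (hd : R.det = 1) :
    HasParts G W (P * rotMat R) (Rᵀ * E * R) (Rᵀ * H * R) := by
  have e (E H : Matrix (Fin 3) (Fin 3) ℝ) : (of fun i j => ((rotMat R)ᵀ *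
      electric (weylOf E H) (rotMat R *ᵥ timeVec) * rotMat R) i.succ j.succ :
      Matrix (Fin 3) (Fin 3) ℝ) = Rᵀ * E * R := by
    have r0 (i : Fin 3) : rotMat R 0 i.succ = 0 := by fin_cases i <;> rfl
    have r1 (i j : Fin 3) : rotMat R i.succ j.succ = R i j := by
      fin_cases i <;> fin_cases j <;> rfl
    rw [rotMat_mulVec_timeVec]
    ext i j
    simp only [of_apply, mul_apply, transpose_apply, Fin.sum_univ_succ (n := 3), r0, r1,
      electric_timeVec, weylOf_electric, zero_mul, mul_zero, zero_add]
  have := h.mul hW (isFrame_rotMat hR hd)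
  rwa [e, e] at this

/-- The boost along the third axis. -/
def boostMat (c s : ℝ) : Mat := !![c, 0, 0, s; 0, 1, 0, 0; 0, 0, 1, 0; s, 0, 0, c]

/-- The complex rotation by which a boost acts on the self-dual bivectors. -/
def boostRot (c s : ℝ) : Matrix (Fin 3) (Fin 3) ℂ :=
  !![(c : ℂ), -(Complex.I * s), 0; Complex.I * s, (c : ℂ), 0; 0, 0, 1]

theorem isFrame_boostMat {c s : ℝ} (h : c ^ 2 - s ^ 2 = 1) : IsFrame minkowski (boostMat c s) := by
  refine ⟨?_, ?_⟩
  · ext i j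
    revert i j
    refine forall_fin_four.2 ⟨?_, ?_, ?_, ?_⟩ <;> refine forall_fin_four.2 ⟨?_, ?_, ?_, ?_⟩ <;>
      simp [minkowski, boostMat, mul_apply, Fin.sum_univ_four, diagonal_apply] <;> linarith
  · have : (boostMat c s).det = c ^ 2 - s ^ 2 := by
      rw [det_succ_row_zero]
      simp [Fin.sum_univ_four, boostMat, det_fin_three, Fin.succAbove]
      ring
    rw [this, h]
    norm_num

/-- On the self-dual bivectors a boost along the third axis is a rotation by an imaginary angle in
the plane of the first two axes. -/
theorem HasParts.boost {G : Mat} {W : Tensor4} {P : Mat} {E H : Matrix (Fin 3) (Fin 3) ℝ}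
    (h : HasParts G W P E H) (hW : IsWeylTensor G W) {c s : ℝ} (hcs : c ^ 2 - s ^ 2 = 1) :
    ∃ P' E' H', HasParts G W P' E' H' ∧
      weylMatrix E' H' = (boostRot c s)ᵀ * weylMatrix E H * boostRot c s := by
  refine ⟨_, _, _, h.mul hW (isFrame_boostMat hcs), ?_⟩
  have b0 : boostMat c s *ᵥ timeVec = ![c, 0, 0, s] := by
    rw [timeVec_eq]
    ext i
    fin_cases i <;> simp [boostMat, mulVec, dotProduct, Fin.sum_univ_four]
  rw [b0]
  rw [eq_stf h.symmE h.traceE, eq_stf h.symmH h.traceH]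
  generalize E 0 0 = a, E 0 1 = b, E 0 2 = d, E 1 1 = e, E 1 2 = f, H 0 0 = a', H 0 1 = b',
    H 0 2 = d', H 1 1 = e', H 1 2 = f'
  ext i j
  fin_cases i <;> fin_cases j <;> simp [weylMatrix, boostMat, boostRot, stf, mul_apply,
    Fin.sum_univ_four, Fin.sum_univ_three, electric, weylOf, biv]
  all_goals apply Complex.ext
  all_goals simp
  · ring
  · ring
  · ring
  · ring
  -- Only the entries that involve the third axis need c² - s² = 1; the others are polynomial
  -- identities.
  · linear_combination -(d * c + f' * s) * hcs
  · linear_combination (d' * c - f * s) * hcs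
  · ring
  · ring
  · ring
  · ring
  · linear_combination -(f * c - d' * s) * hcs
  · linear_combination (f' * c + d * s) * hcs
  · linear_combination -(d * c + f' * s) * hcs
  · linear_combination (d' * c - f * s) * hcs
  · linear_combination -(f * c - d' * s) * hcs
  · linear_combination (f' * c + d * s) * hcs
  · linear_combination (a + e) * (c ^ 2 - s ^ 2 + 1) * hcs
  · linear_combination -(a' + e') * (c ^ 2 - s ^ 2 + 1) * hcs

end SuperEnergy
end

noncomputable section

namespace SuperEnergy

open Matrix

/-! ### Existence of observers at rest -/

theorem exists_unit_orthogonal (x : Fin 3 → ℝ) : ∃ w : Fin 3 → ℝ, x ⬝ᵥ w = 0 ∧ w ⬝ᵥ w = 1 := by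
  obtain ⟨w, h1, h2⟩ : ∃ w : Fin 3 → ℝ, x ⬝ᵥ w = 0 ∧ 0 < w ⬝ᵥ w := by
    by_cases h : x 0 = 0 ∧ x 1 = 0
    · exact ⟨![1, 0, 0], by simp [dotProduct, Fin.sum_univ_three, h.1],
        by simp [dotProduct, Fin.sum_univ_three]⟩
    · refine ⟨![x 1, -x 0, 0], by simp [dotProduct, Fin.sum_univ_three]; ring, ?_⟩
      simp only [dotProduct, Fin.sum_univ_three, cons_val]
      rcases not_and_or.1 h with h | h <;> nlinarith [sq_nonneg (x 0), sq_nonneg (x 1),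
        sq_pos_of_ne_zero h]
  refine ⟨(√(w ⬝ᵥ w))⁻¹ • w, by simp [dotProduct_smul, h1], ?_⟩
  rw [dotProduct_smul, smul_dotProduct, smul_eq_mul, smul_eq_mul, ← mul_assoc, ← mul_inv,
    Real.mul_self_sqrt h2.le, inv_mul_cancel₀ h2.ne']

/-- Two orthogonal vectors can be rotated into the first two axes. -/
theorem exists_rotation {x y : Fin 3 → ℝ} (hx : x ≠ 0) (hxy : x ⬝ᵥ y = 0) :
    ∃ R : Matrix (Fin 3) (Fin 3) ℝ, Rᵀ * R = 1 ∧ R.det = 1 ∧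
      ∃ a b : ℝ, Rᵀ *ᵥ x = ![a, 0, 0] ∧ Rᵀ *ᵥ y = ![0, b, 0] := by
  have normalize (z : Fin 3 → ℝ) (hz : z ≠ 0) : ∃ r : ℝ, ∃ n : Fin 3 → ℝ, r ≠ 0 ∧ z = r • n ∧
      n ⬝ᵥ n = 1 := by
    have h2 : 0 < z ⬝ᵥ z := lt_of_le_of_ne (by
      simp only [dotProduct]; exact Finset.sum_nonneg fun i _ => mul_self_nonneg _)
      fun h => hz (dotProduct_self_eq_zero.1 h.symm)
    refine ⟨√(z ⬝ᵥ z), (√(z ⬝ᵥ z))⁻¹ • z, (Real.sqrt_pos.2 h2).ne', ?_, ?_⟩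
    · rw [smul_smul, mul_inv_cancel₀ (Real.sqrt_pos.2 h2).ne', one_smul]
    · rw [dotProduct_smul, smul_dotProduct, smul_eq_mul, smul_eq_mul, ← mul_assoc, ← mul_inv,
        Real.mul_self_sqrt h2.le, inv_mul_cancel₀ h2.ne']
  obtain ⟨a, n, ha, rfl, hn⟩ := normalize x hx
  have hny : n ⬝ᵥ y = 0 := by
    rw [smul_dotProduct, smul_eq_mul] at hxy
    exact (mul_eq_zero.1 hxy).resolve_left ha
  obtain ⟨b, w, rfl, hw, hnw⟩ : ∃ b : ℝ, ∃ w : Fin 3 → ℝ, y = b • w ∧ w ⬝ᵥ w = 1 ∧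
      n ⬝ᵥ w = 0 := by
    by_cases hy : y = 0
    · obtain ⟨w, h1, h2⟩ := exists_unit_orthogonal n
      exact ⟨0, w, by rw [hy, zero_smul], h2, h1⟩
    · obtain ⟨b, w, hb, rfl, hw⟩ := normalize y hy
      rw [dotProduct_smul, smul_eq_mul] at hny
      exact ⟨b, w, rfl, hw, (mul_eq_zero.1 hny).resolve_left hb⟩
  simp only [dotProduct, Fin.sum_univ_three] at hn hw hnw
  -- The columns are n, w and n × w; the determinant and the square length of n × w are both
  -- |n|²|w|² - (n·w)² = 1.
  refine ⟨!![n 0, w 0, n 1 * w 2 - n 2 * w 1; n 1, w 1, n 2 * w 0 - n 0 * w 2;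
    n 2, w 2, n 0 * w 1 - n 1 * w 0], ?_, ?_, a, b, ?_, ?_⟩
  · ext i j
    fin_cases i <;> fin_cases j <;> simp [mul_apply, Fin.sum_univ_three]
    · linarith
    · linarith
    · ring
    · linarith
    · linarith
    · ring
    · ring
    · ring
    · linear_combination (w 0 * w 0 + w 1 * w 1 + w 2 * w 2) * hn + hw -
        (n 0 * w 0 + n 1 * w 1 + n 2 * w 2) * hnw
  · rw [det_fin_three]
    simp
    linear_combination (w 0 * w 0 + w 1 * w 1 + w 2 * w 2) * hn + hw -
        (n 0 * w 0 + n 1 * w 1 + n 2 * w 2) * hnw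
  · ext i
    fin_cases i <;> simp [mulVec, dotProduct, Fin.sum_univ_three]
    · linear_combination a * hn
    · linear_combination a * hnw
    · ring
  · ext i
    fin_cases i <;> simp [mulVec, dotProduct, Fin.sum_univ_three]
    · linear_combination b * hnw
    · linear_combination b * hw
    · ring

/-- The matrix is annihilated by a cubic polynomial with simple roots. -/
def HasSimpleCubic (M : Matrix (Fin 3) (Fin 3) ℂ) : Prop :=
  ∃ a b c : ℂ, a ≠ b ∧ a ≠ c ∧ b ≠ c ∧
    (M - scalar (Fin 3) a) * ((M - scalar (Fin 3) b) * (M - scalar (Fin 3) c)) = 0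

/-- Q = (M - b)(M - c) is a multiple of the spectral projector for a: it is symmetric and Q² =
(a-b)(a-c)Q. A nonzero diagonal entry Q_{ii} then makes the i-th column w an eigenvector with w·w =
(Q²)_{ii} ≠ 0, so that w can be normalized by a complex square root. -/
theorem exists_eigenvector_of_trace_ne_zero {M : Matrix (Fin 3) (Fin 3) ℂ} (hM : M.IsSymm)
    {a b c : ℂ} (hab : a ≠ b) (hac : a ≠ c)
    (h : (M - scalar (Fin 3) a) * ((M - scalar (Fin 3) b) * (M - scalar (Fin 3) c)) = 0)
    (ht : trace ((M - scalar (Fin 3) b) * (M - scalar (Fin 3) c)) ≠ 0) :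
    ∃ v : Fin 3 → ℂ, v ⬝ᵥ v = 1 ∧ M *ᵥ v = a • v := by
  set Q := (M - scalar (Fin 3) b) * (M - scalar (Fin 3) c) with hQ
  have hMQ : M * Q = a • Q := by
    rw [Matrix.sub_mul, sub_eq_zero] at h
    rw [h, scalar_apply, ← smul_one_eq_diagonal, Matrix.smul_mul, Matrix.one_mul]
  have hQQ : Q * Q = ((a - b) * (a - c)) • Q := by
    have h1 (z : ℂ) : (M - scalar (Fin 3) z) * Q = (a - z) • Q := by
      rw [Matrix.sub_mul, hMQ, scalar_apply, ← smul_one_eq_diagonal, Matrix.smul_mul,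
        Matrix.one_mul, sub_smul]
    nth_rw 1 [hQ]
    rw [Matrix.mul_assoc, h1, Matrix.mul_smul, h1, smul_smul, mul_comm]
  have hQs : Qᵀ = Q := by
    rw [hQ, transpose_mul, transpose_sub, transpose_sub, hM, scalar_apply, scalar_apply,
      diagonal_transpose, diagonal_transpose, ← scalar_apply, ← scalar_apply]
    have : ∀ z, Commute (scalar (Fin 3) z) M := fun z => scalar_commute _ (fun _ => Commute.all _ _) _
    have hc := (this c).eq
    have hb := (this b).eq
    have hbc : scalar (Fin 3) c * scalar (Fin 3) b = scalar (Fin 3) b * scalar (Fin 3) c := by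
      rw [← map_mul, ← map_mul, mul_comm]
    simp only [Matrix.sub_mul, Matrix.mul_sub, hc, hb, hbc]
    abel
  obtain ⟨i, hi⟩ : ∃ i, Q i i ≠ 0 := by
    by_contra! hcon
    exact ht (Finset.sum_eq_zero fun i _ => hcon i)
  set w : Fin 3 → ℂ := fun j => Q j i with hw
  have hMw : M *ᵥ w = a • w := by
    ext j
    exact congrFun (congrFun hMQ j) i
  have hww : w ⬝ᵥ w ≠ 0 := by
    have : w ⬝ᵥ w = (a - b) * (a - c) * Q i i := by
      have h2 := congrFun (congrFun hQQ i) i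
      rw [mul_apply, Matrix.smul_apply, smul_eq_mul] at h2
      rw [← h2]
      refine Finset.sum_congr rfl fun j _ => ?_
      rw [hw]
      exact congrArg (· * Q j i) (congrFun (congrFun hQs i) j)
    rw [this]
    exact mul_ne_zero (mul_ne_zero (sub_ne_zero.2 hab) (sub_ne_zero.2 hac)) hi
  obtain ⟨z, hz⟩ := IsAlgClosed.exists_pow_nat_eq (w ⬝ᵥ w) (n := 2) (by norm_num)
  have hz0 : z ≠ 0 := by
    rintro rfl
    exact hww (by rw [← hz]; simp)
  refine ⟨z⁻¹ • w, ?_, ?_⟩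
  · rw [dotProduct_smul, smul_dotProduct, ← hz, smul_eq_mul, smul_eq_mul]
    field_simp
  · rw [mulVec_smul, hMw, smul_comm]

/-- A complex symmetric matrix which can be diagonalised has an eigenvector that is not null. -/
theorem HasSimpleCubic.exists_eigenvector {M : Matrix (Fin 3) (Fin 3) ℂ} (h : HasSimpleCubic M)
    (hM : M.IsSymm) : ∃ (z : ℂ) (v : Fin 3 → ℂ), v ⬝ᵥ v = 1 ∧ M *ᵥ v = z • v := by
  obtain ⟨a, b, c, hab, hac, hbc, h⟩ := h
  have hcom (x y : ℂ) : (M - scalar (Fin 3) x) * (M - scalar (Fin 3) y) =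
      (M - scalar (Fin 3) y) * (M - scalar (Fin 3) x) := by
    have : ∀ z, Commute (scalar (Fin 3) z) M := fun z => scalar_commute _ (fun _ => Commute.all _ _) _
    have hbc : scalar (Fin 3) x * scalar (Fin 3) y = scalar (Fin 3) y * scalar (Fin 3) x := by
      rw [← map_mul, ← map_mul, mul_comm]
    simp only [Matrix.sub_mul, Matrix.mul_sub, (this x).eq, (this y).eq, hbc]
    abel
  by_cases h1 : trace ((M - scalar (Fin 3) b) * (M - scalar (Fin 3) c)) = 0
  · by_cases h2 : trace ((M - scalar (Fin 3) a) * (M - scalar (Fin 3) c)) = 0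
    · by_cases h3 : trace ((M - scalar (Fin 3) a) * (M - scalar (Fin 3) b)) = 0
      · exfalso
        simp only [trace_fin_three, mul_apply, Fin.sum_univ_three, Matrix.sub_apply, scalar_apply,
          diagonal_apply] at h1 h2 h3
        simp at h1 h2 h3
        -- Lagrange interpolation writes the identity as a combination of the three products, so
        -- their traces cannot all vanish.
        have : 3 * ((a - b) * (a - c) * (b - c)) = 0 := by
          linear_combination (b - c) * h1 - (a - c) * h2 + (a - b) * h3
        simp [sub_eq_zero, hab, hac, hbc] at this
      · refine ⟨c, exists_eigenvector_of_trace_ne_zero hM hac.symm hbc.symm ?_ h3⟩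
        rw [← Matrix.mul_assoc, hcom c a, Matrix.mul_assoc, hcom c b, h]
    · refine ⟨b, exists_eigenvector_of_trace_ne_zero hM hab.symm hbc ?_ h2⟩
      rw [← Matrix.mul_assoc, hcom b a, Matrix.mul_assoc, h]
  · exact ⟨a, exists_eigenvector_of_trace_ne_zero hM hab hac h h1⟩

/-- If the discriminant of the 2×2 block vanishes, the block is a scalar plus a nilpotent matrix;
simple roots force the nilpotent part to be zero. -/
theorem HasSimpleCubic.block {p q r z : ℂ}
    (h : HasSimpleCubic !![p, q, 0; q, r, 0; 0, 0, z]) :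
    (p - r = 0 ∧ q = 0) ∨ (p - r) ^ 2 + 4 * q ^ 2 ≠ 0 := by
  obtain ⟨a, b, c, hab, hac, hbc, h⟩ := h
  by_cases hd : (p - r) ^ 2 + 4 * q ^ 2 = 0
  swap
  · exact Or.inr hd
  left
  have e (i j) := congrFun (congrFun h i) j
  have e00 := e 0 0
  have e01 := e 0 1
  have e11 := e 1 1
  simp [mul_apply, Fin.sum_univ_three, diagonal_apply] at e00 e01 e11
  set m := (p + r) / 2 with hm
  set k := (p - r) / 2 with hk
  have hp : p = m + k := by rw [hm, hk]; ring
  have hr : r = m - k := by rw [hm, hk]; ring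
  have hq : q ^ 2 = -k ^ 2 := by rw [hk]; linear_combination hd / 4
  rw [hp, hr] at e00 e01 e11
  -- The block is m + N with N² = 0, so the cubic f takes the value f(m) + f'(m)N on it. Thus f(m) =
  -- 0, whence f'(m) ≠ 0, and N = 0.
  have f0 : (m - a) * (m - b) * (m - c) = 0 := by
    linear_combination e00 / 2 + e11 / 2 - (3 * m - a - b - c) * hq
  have f1 : ((m - a) * (m - b) + (m - a) * (m - c) + (m - b) * (m - c)) * k = 0 := by
    linear_combination e00 / 2 - e11 / 2 - k * hq
  have f2 : ((m - a) * (m - b) + (m - a) * (m - c) + (m - b) * (m - c)) * q = 0 := by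
    linear_combination e01 - q * hq
  have f3 : (m - a) * (m - b) + (m - a) * (m - c) + (m - b) * (m - c) ≠ 0 := by
    rcases mul_eq_zero.1 f0 with f0 | f0
    · rcases mul_eq_zero.1 f0 with f0 | f0 <;> rw [sub_eq_zero.1 f0] <;>
        simp [sub_eq_zero, hab, hac, hbc, hab.symm]
    · rw [sub_eq_zero.1 f0]
      simp [sub_eq_zero, hac.symm, hbc.symm]
  have k0 : k = 0 := (mul_eq_zero.1 f1).resolve_left f3
  exact ⟨by linear_combination 2 * k0, (mul_eq_zero.1 f2).resolve_left f3⟩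

end SuperEnergy
end

noncomputable section

namespace SuperEnergy

open Matrix

/-! ### The Petrov-Bel types in a frame -/

theorem HasParts.exists_conj {G P : Mat} {W : Tensor4} {E H : Matrix (Fin 3) (Fin 3) ℝ}
    (h : HasParts G W P E H) : ∃ e : (Fin 3 → ℂ) ≃ₗ[ℂ] SelfDual G,
      weylEnd G W = e.conj (toLin' (weylMatrix E H)) := by
  obtain ⟨e, he⟩ := exists_weylEnd_conj h.frame.det_pos h.frame.congruence h.eq
  refine ⟨e, LinearMap.ext fun x => ?_⟩
  rw [LinearEquiv.conj_apply_apply, toLin'_apply, ← he, e.apply_symm_apply]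

theorem eigenspace_conj {V V' : Type*} [AddCommGroup V] [Module ℂ V] [AddCommGroup V']
    [Module ℂ V'] (e : V ≃ₗ[ℂ] V') (f : Module.End ℂ V) (z : ℂ) :
    Module.End.eigenspace (e.conj f) z = (Module.End.eigenspace f z).map (e : V →ₗ[ℂ] V') := by
  ext x
  rw [Submodule.mem_map_equiv, Module.End.mem_eigenspace_iff, Module.End.mem_eigenspace_iff,
    LinearEquiv.conj_apply_apply, ← LinearEquiv.eq_symm_apply, map_smul]

theorem HasParts.finrank_eigenspace {G P : Mat} {W : Tensor4} {E H : Matrix (Fin 3) (Fin 3) ℝ}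
    (h : HasParts G W P E H) (z : ℂ) : Module.finrank ℂ ((weylEnd G W).eigenspace z) =
      Module.finrank ℂ (Module.End.eigenspace (toLin' (weylMatrix E H)) z) := by
  obtain ⟨e, he⟩ := h.exists_conj
  rw [he, eigenspace_conj, LinearEquiv.finrank_map_eq]

theorem HasParts.hasEigenvalue_iff {G P : Mat} {W : Tensor4} {E H : Matrix (Fin 3) (Fin 3) ℝ}
    (h : HasParts G W P E H) (z : ℂ) : (weylEnd G W).HasEigenvalue z ↔
      Module.End.HasEigenvalue (toLin' (weylMatrix E H)) z := by
  obtain ⟨e, he⟩ := h.exists_conj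
  rw [he, Module.End.hasEigenvalue_iff, Module.End.hasEigenvalue_iff, eigenspace_conj, Ne, Ne]
  simp

theorem HasParts.charpoly {G P : Mat} {W : Tensor4} {E H : Matrix (Fin 3) (Fin 3) ℝ}
    (h : HasParts G W P E H) : (weylEnd G W).charpoly = (weylMatrix E H).charpoly := by
  obtain ⟨e, he⟩ := h.exists_conj
  rw [he, LinearEquiv.charpoly_conj, Matrix.charpoly_toLin']

theorem toLin'_sub_scalar (M : Matrix (Fin 3) (Fin 3) ℂ) (a : ℂ) :
    toLin' (M - scalar (Fin 3) a) = toLin' M - a • (1 : Module.End ℂ (Fin 3 → ℂ)) := by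
  rw [map_sub, scalar_apply, ← smul_one_eq_diagonal, map_smul, toLin'_one]
  rfl

theorem hasSimpleCubic_of_hasEigenvalue {M : Matrix (Fin 3) (Fin 3) ℂ} {ρ : Fin 3 → ℂ}
    (hρ : Function.Injective ρ) (h : ∀ k, Module.End.HasEigenvalue (toLin' M) (ρ k)) :
    HasSimpleCubic M := by
  refine ⟨ρ 0, ρ 1, ρ 2, hρ.ne (by decide), hρ.ne (by decide), hρ.ne (by decide), ?_⟩
  choose v hv using fun k => (h k).exists_hasEigenvector
  have hl := Module.End.eigenvectors_linearIndependent' _ ρ hρ v hv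
  let b := basisOfLinearIndependentOfCardEqFinrank hl (by simp)
  have hb (k) : b k = v k := by simp [b]
  apply toLin'.injective
  refine b.ext fun k => ?_
  have e (a : ℂ) (c : ℂ) (k) : (toLin' M - a • (1 : Module.End ℂ (Fin 3 → ℂ))) (c • v k) = (ρ k - a) • c • v k := by
    rw [LinearMap.sub_apply, map_smul, (hv k).apply_eq_smul]
    simp only [LinearMap.smul_apply, Module.End.one_apply]
    module
  rw [toLin'_mul, toLin'_mul, hb, map_zero, LinearMap.zero_apply, LinearMap.comp_apply,
    LinearMap.comp_apply, toLin'_sub_scalar, toLin'_sub_scalar, toLin'_sub_scalar, ← one_smul ℂ (v k),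
    e, smul_smul, e, smul_smul, e, smul_smul]
  fin_cases k <;> simp

theorem hasSimpleCubic_of_finrank_eigenspace {M : Matrix (Fin 3) (Fin 3) ℂ} {ρ : ℂ} (hρ : ρ ≠ 0)
    (h : Module.End.HasEigenvalue (toLin' M) (-2 * ρ))
    (h2 : Module.finrank ℂ (Module.End.eigenspace (toLin' M) ρ) = 2) : HasSimpleCubic M := by
  -- The factors with roots -2ρ and ρ already annihilate M; 0 is a third root, distinct from both,
  -- added only to reach degree three.
  refine ⟨0, -2 * ρ, ρ, by simpa using hρ, hρ.symm, fun h => hρ ?_, ?_⟩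
  · linear_combination (-1 / 3) * h
  obtain ⟨v, hv⟩ := h.exists_hasEigenvector
  have hr : Module.finrank ℂ (LinearMap.range (toLin' M - ρ • (1 : Module.End ℂ (Fin 3 → ℂ)))) = 1 := by
    have := LinearMap.finrank_range_add_finrank_ker (toLin' M - ρ • (1 : Module.End ℂ (Fin 3 → ℂ)))
    rw [← Module.End.eigenspace_def, h2] at this
    simpa using this
  have hvr : (toLin' M - ρ • (1 : Module.End ℂ (Fin 3 → ℂ))) v = (-3 * ρ) • v := by
    rw [LinearMap.sub_apply, hv.apply_eq_smul]
    simp only [LinearMap.smul_apply, Module.End.one_apply]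
    module
  have hne : (⟨_, LinearMap.mem_range_self _ v⟩ :
      LinearMap.range (toLin' M - ρ • (1 : Module.End ℂ (Fin 3 → ℂ)))) ≠ 0 := by
    intro h0
    have h1 : (toLin' M - ρ • (1 : Module.End ℂ (Fin 3 → ℂ))) v = 0 := congrArg Subtype.val h0
    rw [hvr] at h1
    simp [hρ, hv.2] at h1
  have key := (finrank_eq_one_iff_of_nonzero' _ hne).1 hr
  -- The range of M - ρ is one-dimensional and contains the eigenvector v for -2ρ, so it is spanned
  -- by v and annihilated by M + 2ρ.
  have : (M - scalar (Fin 3) (-2 * ρ)) * (M - scalar (Fin 3) ρ) = 0 := by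
    apply toLin'.injective
    refine LinearMap.ext fun x => ?_
    obtain ⟨c, hc⟩ := key ⟨_, LinearMap.mem_range_self _ x⟩
    have hc := congrArg Subtype.val hc
    simp only [SetLike.mk_smul_mk, hvr] at hc
    rw [toLin'_mul, LinearMap.comp_apply, toLin'_sub_scalar, toLin'_sub_scalar, ← hc, map_smul,
      map_smul, LinearMap.sub_apply, hv.apply_eq_smul]
    simp
  rw [this, Matrix.mul_zero]

theorem HasParts.hasSimpleCubic {G P : Mat} {W : Tensor4} {E H : Matrix (Fin 3) (Fin 3) ℝ}
    (h : HasParts G W P E H) (hT : IsTypeI G W ∨ IsTypeD G W) :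
    HasSimpleCubic (weylMatrix E H) := by
  rcases hT with ⟨ρ, hρ, hk⟩ | ⟨ρ, hρ, h1, h2⟩
  · exact hasSimpleCubic_of_hasEigenvalue hρ fun k => (h.hasEigenvalue_iff _).1 (hk k)
  · exact hasSimpleCubic_of_finrank_eigenspace hρ ((h.hasEigenvalue_iff _).1 h1)
      ((h.finrank_eigenspace _).symm.trans h2)

end SuperEnergy
end

/-! ### Reduction of the Weyl matrix by rotations and boosts, and observers at rest -/

noncomputable section

namespace SuperEnergy

open Matrix

theorem weylMatrix_apply (E H : Matrix (Fin 3) (Fin 3) ℝ) (i j : Fin 3) :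
    weylMatrix E H i j = ⟨-E i j, H i j⟩ := by
  apply Complex.ext <;> simp [weylMatrix]

theorem weylMatrix_isSymm {E H : Matrix (Fin 3) (Fin 3) ℝ} (hE : E.IsSymm) (hH : H.IsSymm) :
    (weylMatrix E H).IsSymm := by
  ext i j
  rw [transpose_apply, weylMatrix_apply, weylMatrix_apply, hE.apply, hH.apply]

theorem weylMatrix_rot (E H R : Matrix (Fin 3) (Fin 3) ℝ) : weylMatrix (Rᵀ * E * R) (Rᵀ * H * R) =
    (R.map Complex.ofReal)ᵀ * weylMatrix E H * R.map Complex.ofReal := by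
  have h (X : Matrix (Fin 3) (Fin 3) ℝ) : (Rᵀ * X * R).map Complex.ofReal =
      (R.map Complex.ofReal)ᵀ * X.map Complex.ofReal * R.map Complex.ofReal := by
    rw [← transpose_map]
    exact (Matrix.map_mul (f := Complex.ofRealHom)).trans
      (congrArg (· * R.map Complex.ofReal) (Matrix.map_mul (f := Complex.ofRealHom)))
  rw [weylMatrix, h, h, weylMatrix, Matrix.mul_sub, Matrix.sub_mul, Matrix.mul_smul,
    Matrix.smul_mul]

theorem HasParts.superPoynting_eq_zero_iff {G P : Mat} {W : Tensor4}
    {E H : Matrix (Fin 3) (Fin 3) ℝ} (h : HasParts G W P E H) :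
    superPoynting G W (P *ᵥ timeVec) = 0 ↔ E * H = H * E := by
  rw [← superPoynting_weylOf_iff h.symmE h.symmH h.traceE h.traceH, ← h.eq, ← h.frame.congruence,
    superPoynting_pull P G h.frame.det_pos]
  refine ⟨fun h => by rw [h, mulVec_zero], fun h' => ?_⟩
  have hu : IsUnit Pᵀ.det := by
    rw [det_transpose]
    exact h.frame.det_pos.ne'.isUnit
  exact (mulVec_injective_iff_isUnit.2 ((isUnit_iff_isUnit_det _).2 hu)) (h'.trans (mulVec_zero _).symm)

theorem exists_observer {G : Mat} (hG : IsLorentzian G) : ∃ u, IsObserver G u := by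
  obtain ⟨-, P, -, hP⟩ := hG
  exact ⟨P *ᵥ timeVec, isObserver_mulVec_timeVec hP⟩

theorem map_ofReal_transpose_mul {R : Matrix (Fin 3) (Fin 3) ℝ} (hR : Rᵀ * R = 1) :
    (R.map Complex.ofReal)ᵀ * R.map Complex.ofReal = 1 := by
  rw [← transpose_map]
  refine (Matrix.map_mul (f := Complex.ofRealHom)).symm.trans ?_
  rw [hR]
  exact Matrix.map_one _ Complex.ofReal_zero Complex.ofReal_one

theorem boostRot_transpose_mul {c s : ℝ} (h : c ^ 2 - s ^ 2 = 1) :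
    (boostRot c s)ᵀ * boostRot c s = 1 := by
  have h' : (c : ℂ) ^ 2 - (s : ℂ) ^ 2 = 1 := by exact_mod_cast h
  ext i j
  fin_cases i <;> fin_cases j <;> simp [boostRot, mul_apply, Fin.sum_univ_three]
  · linear_combination h' + s ^ 2 * Complex.I_sq
  · ring
  · ring
  · linear_combination h' + s ^ 2 * Complex.I_sq

theorem mulVec_congr {M A : Matrix (Fin 3) (Fin 3) ℂ} {v : Fin 3 → ℂ} {z : ℂ} (hA : Aᵀ * A = 1)
    (hv : M *ᵥ v = z • v) : (Aᵀ * M * A) *ᵥ (Aᵀ *ᵥ v) = z • (Aᵀ *ᵥ v) := by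
  rw [mulVec_mulVec, Matrix.mul_assoc, mul_eq_one_comm.1 hA, Matrix.mul_one, ← mulVec_mulVec, hv,
    mulVec_smul]

/-- A unit eigenvector v = x + iy satisfies |x|² - |y|² = 1 and x·y = 0. Rotating x and y into the
first two axes turns it into (a, ib, 0) with a² - b² = 1, the image of the first axis under
`boostRot a b`; the corresponding boost therefore aligns the eigenvector with that axis, and
symmetry splits M. -/
theorem HasParts.exists_block {G P : Mat} {W : Tensor4} {E H : Matrix (Fin 3) (Fin 3) ℝ}
    (h : HasParts G W P E H) (hW : IsWeylTensor G W) (hM : HasSimpleCubic (weylMatrix E H)) :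
    ∃ P' E' H', HasParts G W P' E' H' ∧
      ∃ p q r z, weylMatrix E' H' = !![p, q, 0; q, r, 0; 0, 0, z] := by
  obtain ⟨z, v, hv, hz⟩ := hM.exists_eigenvector (weylMatrix_isSymm h.symmE h.symmH)
  set x : Fin 3 → ℝ := fun i => (v i).re with hx
  set y : Fin 3 → ℝ := fun i => (v i).im with hy
  have h1 : x ⬝ᵥ x - y ⬝ᵥ y = 1 := by
    have := congrArg Complex.re hv
    simp only [dotProduct, Fin.sum_univ_three, Complex.add_re, Complex.mul_re, Complex.one_re]
      at this
    simp only [dotProduct, Fin.sum_univ_three, hx, hy]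
    linarith
  have h2 : x ⬝ᵥ y = 0 := by
    have := congrArg Complex.im hv
    simp only [dotProduct, Fin.sum_univ_three, Complex.add_im, Complex.mul_im, Complex.one_im]
      at this
    simp only [dotProduct, Fin.sum_univ_three, hx, hy]
    linarith
  have hx0 : x ≠ 0 := by
    intro h0
    rw [h0, zero_dotProduct] at h1
    simp only [dotProduct, Fin.sum_univ_three] at h1
    nlinarith [sq_nonneg (y 0), sq_nonneg (y 1), sq_nonneg (y 2)]
  obtain ⟨R, hR, hd, a, b, ha, hb⟩ := exists_rotation hx0 h2
  have hRR (u w : Fin 3 → ℝ) : (Rᵀ *ᵥ u) ⬝ᵥ (Rᵀ *ᵥ w) = u ⬝ᵥ w := by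
    rw [dotProduct_mulVec, vecMul_transpose, mulVec_mulVec, mul_eq_one_comm.1 hR, one_mulVec]
  have hab : a ^ 2 - b ^ 2 = 1 := by
    rw [← h1, ← hRR x x, ← hRR y y, ha, hb]
    simp [dotProduct, Fin.sum_univ_three]
    ring
  have hA := boostRot_transpose_mul hab
  have hvR : (R.map Complex.ofReal)ᵀ *ᵥ v = boostRot a b *ᵥ ![1, 0, 0] := by
    have e : boostRot a b *ᵥ ![1, 0, 0] = ![(a : ℂ), Complex.I * b, 0] := by
      ext i
      fin_cases i <;> simp [boostRot, mulVec, dotProduct, Fin.sum_univ_three]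
    rw [e]
    have e1 (i) : ((R.map Complex.ofReal)ᵀ *ᵥ v) i = ⟨(Rᵀ *ᵥ x) i, (Rᵀ *ᵥ y) i⟩ := by
      apply Complex.ext <;> simp [mulVec, dotProduct, Fin.sum_univ_three, hx, hy]
    ext i
    rw [e1, ha, hb]
    fin_cases i <;> apply Complex.ext <;> simp
  obtain ⟨P', E', H', h', hM'⟩ := (h.rot hW hR hd).boost hW hab
  have hz' := mulVec_congr hA (mulVec_congr (map_ofReal_transpose_mul hR) hz)
  rw [← weylMatrix_rot, ← hM', hvR, mulVec_mulVec _ (boostRot a b)ᵀ, hA, one_mulVec] at hz'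
  have c1 : weylMatrix E' H' 1 0 = 0 := by
    simpa [mulVec, dotProduct, Fin.sum_univ_three] using congrFun hz' 1
  have c2 : weylMatrix E' H' 2 0 = 0 := by
    simpa [mulVec, dotProduct, Fin.sum_univ_three] using congrFun hz' 2
  have hs (i j) := (weylMatrix_isSymm h'.symmE h'.symmH).apply i j
  -- A cyclic permutation moves the eigenvector to the third axis, so that later boosts along it act
  -- on the 2×2 block alone.
  refine ⟨_, _, _, h'.rot hW (R := !![0, 0, 1; 1, 0, 0; 0, 1, 0]) ?_ ?_, weylMatrix E' H' 1 1,
    weylMatrix E' H' 1 2, weylMatrix E' H' 2 2, weylMatrix E' H' 0 0, ?_⟩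
  · ext i j
    fin_cases i <;> fin_cases j <;> simp [mul_apply, Fin.sum_univ_three]
  · simp [det_fin_three]
  · rw [weylMatrix_rot]
    ext i j
    fin_cases i <;> fin_cases j <;>
      simp [mul_apply, Fin.sum_univ_three, c1, c2, (hs 1 0).trans c1, (hs 2 0).trans c2, hs 1 2]

/-- The traceless part of the block is given by p - r and q; its real and imaginary parts commute
when these two numbers are proportional over ℝ. -/
theorem mul_comm_of_block {E H : Matrix (Fin 3) (Fin 3) ℝ} {p q r z : ℂ}
    (h : weylMatrix E H = !![p, q, 0; q, r, 0; 0, 0, z])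
    (hpq : (p - r).re * q.im = (p - r).im * q.re) : E * H = H * E := by
  have e (i j) : E i j = -(weylMatrix E H i j).re := by rw [weylMatrix_apply, neg_neg]
  have e' (i j) : H i j = (weylMatrix E H i j).im := by rw [weylMatrix_apply]
  simp only [Complex.sub_re, Complex.sub_im] at hpq
  ext i j
  simp only [mul_apply, Fin.sum_univ_three, e, e', h]
  fin_cases i <;> fin_cases j <;> simp <;> linarith

/-- A boost balances two nonzero complex numbers. -/
theorem exists_balancing_boost {k l : ℂ} (hk : k ≠ 0) (hl : l ≠ 0) : ∃ c s : ℝ, c ^ 2 - s ^ 2 = 1 ∧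
    Complex.normSq ((c + s) ^ 2 * k) = Complex.normSq ((c - s) ^ 2 * l) := by
  have hk' := Complex.normSq_pos.2 hk
  have hl' := Complex.normSq_pos.2 hl
  -- With c + s = m and c - s = 1/m the squared moduli to be equated are m⁴|k|² and m⁻⁴|l|².
  obtain ⟨m, hm, hm8⟩ : ∃ m : ℝ, 0 < m ∧ m ^ 8 = Complex.normSq l / Complex.normSq k := by
    refine ⟨√√√(Complex.normSq l / Complex.normSq k), by positivity, ?_⟩
    have hpos : 0 < Complex.normSq l / Complex.normSq k := by positivity
    rw [show (8 : ℕ) = 2 * 2 * 2 by norm_num, pow_mul, pow_mul, Real.sq_sqrt (by positivity),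
      Real.sq_sqrt (by positivity), Real.sq_sqrt (by positivity)]
  refine ⟨(m + m⁻¹) / 2, (m - m⁻¹) / 2, by field_simp; ring, ?_⟩
  have e1 : (((m + m⁻¹) / 2 : ℝ) : ℂ) + ((m - m⁻¹) / 2 : ℝ) = (m : ℝ) := by
    rw [← Complex.ofReal_add]; congr 1; ring
  have e2 : (((m + m⁻¹) / 2 : ℝ) : ℂ) - ((m - m⁻¹) / 2 : ℝ) = (m⁻¹ : ℝ) := by
    rw [← Complex.ofReal_sub]; congr 1; ring
  rw [e1, e2, map_mul, map_mul, map_pow, map_pow, Complex.normSq_ofReal, Complex.normSq_ofReal]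
  rw [eq_div_iff hk'.ne'] at hm8
  rw [← hm8]
  field_simp

/-- A boost along the third axis multiplies (p - r) ± 2iq by (c ± s)². Both numbers are nonzero
unless the block is scalar, so their moduli can be made equal, and equality of the moduli is the
commutation condition of `mul_comm_of_block`. -/
theorem exists_mul_comm {G : Mat} {W : Tensor4} (hG : IsLorentzian G) (hW : IsWeylTensor G W)
    (hT : IsTypeI G W ∨ IsTypeD G W) : ∃ P E H, HasParts G W P E H ∧ E * H = H * E := by
  obtain ⟨u, hu⟩ := exists_observer hG
  obtain ⟨P, hP, -⟩ := exists_isFrame hG hu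
  obtain ⟨E, H, h⟩ := hP.exists_hasParts hW
  obtain ⟨P, E, H, h, p, q, r, z, hM⟩ := h.exists_block hW (h.hasSimpleCubic hT)
  rcases (hM ▸ h.hasSimpleCubic hT).block with ⟨h1, h2⟩ | hpq
  · exact ⟨P, E, H, h, mul_comm_of_block hM (by rw [h1, h2]; simp)⟩
  · have hf : ((p - r) + 2 * Complex.I * q) * ((p - r) - 2 * Complex.I * q) ≠ 0 := by
      intro h0
      exact hpq (by linear_combination h0 + 4 * q ^ 2 * Complex.I_sq)
    obtain ⟨c, s, hcs, hb⟩ := exists_balancing_boost (left_ne_zero_of_mul hf)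
      (right_ne_zero_of_mul hf)
    obtain ⟨P', E', H', h', hM'⟩ := h.boost hW hcs
    have hblock : weylMatrix E' H' = !![c ^ 2 * p + 2 * c * s * Complex.I * q - s ^ 2 * r,
        (c ^ 2 + s ^ 2) * q - c * s * Complex.I * (p - r), 0;
        (c ^ 2 + s ^ 2) * q - c * s * Complex.I * (p - r),
        c ^ 2 * r - 2 * c * s * Complex.I * q - s ^ 2 * p, 0; 0, 0, z] := by
      rw [hM', hM]
      ext i j
      fin_cases i <;> fin_cases j <;> simp [boostRot, mul_apply, Fin.sum_univ_three]
      · linear_combination s ^ 2 * r * Complex.I_sq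
      · linear_combination -s ^ 2 * q * Complex.I_sq
      · linear_combination -s ^ 2 * q * Complex.I_sq
      · linear_combination s ^ 2 * p * Complex.I_sq
    refine ⟨P', E', H', h', mul_comm_of_block hblock ?_⟩
    set p' := c ^ 2 * p + 2 * c * s * Complex.I * q - s ^ 2 * r
    set q' := (c ^ 2 + s ^ 2) * q - c * s * Complex.I * (p - r) with hq'
    set r' := c ^ 2 * r - 2 * c * s * Complex.I * q - s ^ 2 * p
    have e1 : ((c : ℂ) + s) ^ 2 * ((p - r) + 2 * Complex.I * q) = (p' - r') + 2 * Complex.I * q' := by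
      simp only [p', q', r']
      linear_combination 2 * c * s * (p - r) * Complex.I_sq
    have e2 : ((c : ℂ) - s) ^ 2 * ((p - r) - 2 * Complex.I * q) = (p' - r') - 2 * Complex.I * q' := by
      simp only [p', q', r']
      linear_combination -2 * c * s * (p - r) * Complex.I_sq
    rw [e1, e2, Complex.normSq_apply, Complex.normSq_apply] at hb
    generalize p' - r' = k at hb ⊢
    simp at hb
    linarith

theorem exists_isAtRest {G : Mat} {W : Tensor4} (hG : IsLorentzian G) (hW : IsWeylTensor G W)
    (hT : IsTypeI G W ∨ IsTypeD G W) : ∃ e₀, IsAtRest G W e₀ := by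
  obtain ⟨P, E, H, h, hc⟩ := exists_mul_comm hG hW hT
  exact ⟨P *ᵥ timeVec, h.frame.isObserver, h.superPoynting_eq_zero_iff.2 hc⟩

end SuperEnergy
end

noncomputable section

namespace SuperEnergy

open Matrix

/-! ### Canonical frames -/

/-- Two commuting symmetric matrices are diagonal in a common rotated basis. -/
theorem exists_rotation_diagonal {E H : Matrix (Fin 3) (Fin 3) ℝ} (hE : E.IsSymm) (hH : H.IsSymm)
    (hc : E * H = H * E) : ∃ R : Matrix (Fin 3) (Fin 3) ℝ, Rᵀ * R = 1 ∧ R.det = 1 ∧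
      ∃ d d' : Fin 3 → ℝ, Rᵀ * E * R = diagonal d ∧ Rᵀ * H * R = diagonal d' := by
  have hs {A : Matrix (Fin 3) (Fin 3) ℝ} (hA : A.IsSymm) : (toEuclideanLin A).IsSymmetric :=
    isSymmetric_toEuclideanLin_iff.2 (by rw [IsHermitian, conjTranspose_eq_transpose_of_trivial, hA])
  have hcomm : Commute (toEuclideanLin E) (toEuclideanLin H) := by
    refine LinearMap.ext fun x => ?_
    simp only [Module.End.mul_apply, toLpLin_apply, mulVec_mulVec, hc]
  set V : ℝ × ℝ → Submodule ℝ (EuclideanSpace ℝ (Fin 3)) := fun i =>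
    Module.End.eigenspace (toEuclideanLin E) i.2 ⊓ Module.End.eigenspace (toEuclideanLin H) i.1
  have hV : DirectSum.IsInternal V :=
    LinearMap.IsSymmetric.directSum_isInternal_of_commute (hs hE) (hs hH) hcomm
  have : Fintype {i // V i ≠ ⊥} := (WellFoundedGT.finite_ne_bot_of_iSupIndep hV.submodule_iSupIndep).fintype
  have hV' := DirectSum.isInternal_ne_bot_iff.2 hV
  have ho : OrthogonalFamily ℝ (fun i : {i // V i ≠ ⊥} => V i) fun i => (V i).subtypeₗᵢ :=
    (LinearMap.IsSymmetric.orthogonalFamily_eigenspace_inf_eigenspace (hs hE)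
    (hs hH)).comp (Subtype.val_injective (p := fun i => V i ≠ ⊥))
  have hn : Module.finrank ℝ (EuclideanSpace ℝ (Fin 3)) = 3 := finrank_euclideanSpace_fin
  set b := hV'.subordinateOrthonormalBasis hn ho with hb
  have hmem (k) := hV'.subordinateOrthonormalBasis_subordinate hn k ho
  obtain ⟨d, d', hd⟩ : ∃ d d' : Fin 3 → ℝ, ∀ k, E *ᵥ (b k).ofLp = d k • (b k).ofLp ∧
      H *ᵥ (b k).ofLp = d' k • (b k).ofLp := by
    refine ⟨fun k => (hV'.subordinateOrthonormalBasisIndex hn k ho).1.2,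
      fun k => (hV'.subordinateOrthonormalBasisIndex hn k ho).1.1, fun k => ?_⟩
    have h1 := (hmem k).1
    have h2 := (hmem k).2
    rw [SetLike.mem_coe, Module.End.mem_eigenspace_iff] at h1 h2
    exact ⟨congrArg WithLp.ofLp h1, congrArg WithLp.ofLp h2⟩
  set R : Matrix (Fin 3) (Fin 3) ℝ := of fun i k => (b k).ofLp i with hR
  have hRR : Rᵀ * R = 1 := by
    ext i j
    have := orthonormal_iff_ite.1 b.orthonormal j i
    rw [PiLp.inner_apply] at this
    simp only [mul_apply, transpose_apply, hR, of_apply, one_apply, eq_comm (a := i)]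
    exact this
  have hdiag {A : Matrix (Fin 3) (Fin 3) ℝ} {d : Fin 3 → ℝ}
      (h : ∀ k, A *ᵥ (b k).ofLp = d k • (b k).ofLp) : Rᵀ * A * R = diagonal d := by
    have : A * R = R * diagonal d := by
      ext i k
      rw [mul_diagonal]
      exact (congrFun (h k) i).trans (mul_comm _ _)
    rw [Matrix.mul_assoc, this, ← Matrix.mul_assoc, hRR, Matrix.one_mul]
  have e1 := hdiag fun k => (hd k).1
  have e2 := hdiag fun k => (hd k).2
  have hdet : R.det * R.det = 1 := by
    have := congrArg det hRR
    rwa [det_mul, det_transpose, det_one] at this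
  rcases mul_self_eq_one_iff.1 hdet with h | h
  · exact ⟨R, hRR, h, d, d', e1, e2⟩
  -- In odd dimension a change of sign corrects the determinant without affecting the congruence.
  · refine ⟨-R, by simpa using hRR, ?_, d, d', by simpa using e1, by simpa using e2⟩
    rw [det_neg, h]
    norm_num

theorem eq_cons_of_sum_eq_zero {d : Fin 3 → ℝ} (h : (diagonal d).trace = 0) :
    d = ![d 0, d 1, -d 0 - d 1] := by
  rw [trace_diagonal, Fin.sum_univ_three] at h
  ext i
  fin_cases i
  · rfl
  · rfl
  · simp
    linarith

/-- Frames in which the electric and magnetic parts commute may be rotated into frames where both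
are diagonal, without changing the observer. -/
theorem HasParts.exists_diagonal {G P : Mat} {W : Tensor4} {E H : Matrix (Fin 3) (Fin 3) ℝ}
    (h : HasParts G W P E H) (hW : IsWeylTensor G W) (hc : E * H = H * E) :
    ∃ P' x y x' y', P' *ᵥ timeVec = P *ᵥ timeVec ∧
      HasParts G W P' (diagonal ![x, y, -x - y]) (diagonal ![x', y', -x' - y']) := by
  obtain ⟨R, hR, hd, d, d', e1, e2⟩ := exists_rotation_diagonal h.symmE h.symmH hc
  have h' := h.rot hW hR hd
  rw [e1, e2] at h'
  refine ⟨P * rotMat R, d 0, d 1, d' 0, d' 1, ?_, ?_⟩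
  swap
  · rw [← eq_cons_of_sum_eq_zero h'.traceE, ← eq_cons_of_sum_eq_zero h'.traceH]
    exact h'
  · rw [← mulVec_mulVec, rotMat_mulVec_timeVec]

end SuperEnergy
end

noncomputable section

namespace SuperEnergy

open Matrix

/-! ### Non-radiative fields -/

theorem HasParts.stressFlux_pull {G P : Mat} {W : Tensor4} {E H : Matrix (Fin 3) (Fin 3) ℝ}
    (h : HasParts G W P E H) :
    stressFlux minkowski (weylOf E H) timeVec = pull3 P (stressFlux G W (P *ᵥ timeVec)) := by
  rw [← h.eq, ← h.frame.congruence, SuperEnergy.stressFlux_pull P G h.frame.det_pos]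

theorem pull3_zero (P : Mat) : pull3 P 0 = 0 := by
  funext a b c
  simp [pull3]

theorem pull3_one (S : Tensor3) : pull3 1 S = S := by
  funext a b c
  simp [pull3, one_apply]

theorem HasParts.stressFlux_eq_zero_iff {G P : Mat} {W : Tensor4} {E H : Matrix (Fin 3) (Fin 3) ℝ}
    (h : HasParts G W P E H) : stressFlux G W (P *ᵥ timeVec) = 0 ↔
      ∀ i j k : Fin 3, belRobinson minkowski (weylOf E H) i.succ j.succ k.succ 0 = 0 := by
  rw [← stressFlux_timeVec_eq_zero_iff, h.stressFlux_pull]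
  refine ⟨fun h => by rw [h, pull3_zero], fun h' => ?_⟩
  rw [← pull3_one (stressFlux G W (P *ᵥ timeVec)),
    ← mul_nonsing_inv _ h.frame.det_pos.ne'.isUnit, pull3_mul, h', pull3_zero]

/-- If the stress flux vanishes, then so does the super-Poynting vector. -/
theorem mul_comm_of_belRobinson_eq_zero {E H : Matrix (Fin 3) (Fin 3) ℝ} (hE : E.IsSymm)
    (hH : H.IsSymm) (tE : E.trace = 0) (tH : H.trace = 0)
    (h : ∀ i j k : Fin 3, belRobinson minkowski (weylOf E H) i.succ j.succ k.succ 0 = 0) :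
    E * H = H * E := by
  rw [← superPoynting_weylOf_iff hE hH tE tH]
  revert h
  rw [eq_stf hE tE, eq_stf hH tH]
  generalize E 0 0 = a, E 0 1 = b, E 0 2 = c, E 1 1 = d, E 1 2 = e, H 0 0 = a', H 0 1 = b',
    H 0 2 = c', H 1 1 = d', H 1 2 = e'
  intro h
  have p1 := belRobinson_weylOf_1000 a b c d e a' b' c' d' e'
  have p2 := belRobinson_weylOf_2000 a b c d e a' b' c' d' e'
  have p3 := belRobinson_weylOf_3000 a b c d e a' b' c' d' e'
  have q1 := belRobinson_weylOf_1110 a b c d e a' b' c' d' e'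
  have q2 := belRobinson_weylOf_1220 a b c d e a' b' c' d' e'
  have q3 := belRobinson_weylOf_1330 a b c d e a' b' c' d' e'
  have q4 := belRobinson_weylOf_1120 a b c d e a' b' c' d' e'
  have q5 := belRobinson_weylOf_2220 a b c d e a' b' c' d' e'
  have q6 := belRobinson_weylOf_2330 a b c d e a' b' c' d' e'
  have q7 := belRobinson_weylOf_1130 a b c d e a' b' c' d' e'
  have q8 := belRobinson_weylOf_2230 a b c d e a' b' c' d' e'
  have q9 := belRobinson_weylOf_3330 a b c d e a' b' c' d' e'
  have h1 := h 0 0 0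
  have h2 := h 0 1 1
  have h3 := h 0 2 2
  have h4 := h 0 0 1
  have h5 := h 1 1 1
  have h6 := h 1 2 2
  have h7 := h 0 0 2
  have h8 := h 1 1 2
  have h9 := h 2 2 2
  simp only [Fin.succ_zero_eq_one, Fin.succ_one_eq_two, show (2 : Fin 3).succ = (3 : Fin 4) from rfl]
    at h1 h2 h3 h4 h5 h6 h7 h8 h9
  rw [h1] at q1
  rw [h2] at q2
  rw [h3] at q3
  rw [h4] at q4
  rw [h5] at q5
  rw [h6] at q6
  rw [h7] at q7
  rw [h8] at q8
  rw [h9] at q9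
  -- T is traceless: each T_{j000} is the sum of the three components T_{iij0}, with the indices
  -- reordered.
  have r1 : belRobinson minkowski (weylOf (stf a b c d e) (stf a' b' c' d' e')) 1 0 0 0 = 0 := by
    linarith
  have r2 : belRobinson minkowski (weylOf (stf a b c d e) (stf a' b' c' d' e')) 2 0 0 0 = 0 := by
    linarith
  have r3 : belRobinson minkowski (weylOf (stf a b c d e) (stf a' b' c' d' e')) 3 0 0 0 = 0 := by
    linarith
  ext i
  rw [superPoynting_timeVec]
  revert i
  simp [forall_fin_four, r1, r2, r3]

theorem weylMatrix_diagonal (d d' : Fin 3 → ℝ) :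
    weylMatrix (diagonal d) (diagonal d') = diagonal fun i => (⟨-d i, d' i⟩ : ℂ) := by
  ext i j
  rw [weylMatrix_apply, diagonal_apply, diagonal_apply, diagonal_apply]
  split_ifs
  · rfl
  · rw [neg_zero]
    rfl

theorem hasEigenvalue_toLin'_diagonal (m : Fin 3 → ℂ) (i : Fin 3) :
    Module.End.HasEigenvalue (toLin' (diagonal m)) (m i) := by
  refine Module.End.hasEigenvalue_of_hasEigenvector (x := Pi.single i 1) ⟨?_, by simp⟩
  rw [Module.End.mem_eigenspace_iff, toLin'_apply]
  ext j
  rcases eq_or_ne j i with rfl | hj <;> simp [mulVec_diagonal, *]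

theorem finrank_eigenspace_diagonal (m : Fin 3 → ℂ) {i j k : Fin 3} (hij : i ≠ j) (hik : i ≠ k)
    (hjk : j ≠ k) (h : m i = m j) (hk : m k ≠ m i) :
    Module.finrank ℂ (Module.End.eigenspace (toLin' (diagonal m)) (m i)) = 2 := by
  have hr := rank_diagonal fun l => m l - m i
  have hc : Fintype.card {l // m l - m i ≠ 0} = 1 := by
    rw [Fintype.card_eq_one_iff]
    refine ⟨⟨k, sub_ne_zero.2 hk⟩, fun ⟨l, hl⟩ => Subtype.ext ?_⟩
    have : ∀ i j k l : Fin 3, i ≠ j → i ≠ k → j ≠ k → l = i ∨ l = j ∨ l = k := by decide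
    rcases this i j k l hij hik hjk with rfl | rfl | rfl
    · exact absurd (sub_self _) hl
    · exact absurd (sub_eq_zero.2 h.symm) hl
    · rfl
  have hs : toLin' (diagonal m) - m i • (1 : Module.End ℂ (Fin 3 → ℂ)) =
      (diagonal fun l => m l - m i).mulVecLin := by
    refine LinearMap.ext fun x => ?_
    ext l
    simp [mulVec_diagonal, sub_mul]
  have := LinearMap.finrank_range_add_finrank_ker (diagonal fun l => m l - m i).mulVecLin
  rw [Module.End.eigenspace_def, hs]
  rw [rank, hc] at hr
  rw [hr, Module.finrank_fin_fun] at this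
  omega

theorem pull_zero (P : Mat) : pull P 0 = 0 := by
  funext a b c d
  simp [pull]

theorem weylOf_zero : weylOf 0 0 = 0 := by
  funext a b c d
  revert a b c d
  simp [forall_fin_four, weylOf, biv]

/-- If two of the three eigenvalues coincide, the vanishing trace makes the third one -2 times their
value, which is nonzero because W is. -/
theorem HasParts.isTypeI_or_isTypeD {G P : Mat} {W : Tensor4} {d d' : Fin 3 → ℝ}
    (h : HasParts G W P (diagonal d) (diagonal d')) (hW : W ≠ 0) :
    IsTypeI G W ∨ IsTypeD G W := by
  set m : Fin 3 → ℂ := fun i => ⟨-d i, d' i⟩ with hm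
  have hM : weylMatrix (diagonal d) (diagonal d') = diagonal m := weylMatrix_diagonal d d'
  have heig (i) : (weylEnd G W).HasEigenvalue (m i) := by
    rw [h.hasEigenvalue_iff, hM]
    exact hasEigenvalue_toLin'_diagonal m i
  by_cases hinj : Function.Injective m
  · exact Or.inl ⟨m, hinj, heig⟩
  right
  obtain ⟨i, j, hmij, hij⟩ : ∃ i j, m i = m j ∧ i ≠ j := by
    simpa [Function.Injective] using hinj
  obtain ⟨k, hik, hjk⟩ : ∃ k, i ≠ k ∧ j ≠ k := by
    have : ∀ i j : Fin 3, ∃ k, i ≠ k ∧ j ≠ k := by decide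
    exact this i j
  have hall : ∀ i j k l : Fin 3, i ≠ j → i ≠ k → j ≠ k → l = i ∨ l = j ∨ l = k := by decide
  have huniv : ∀ i j k : Fin 3, i ≠ j → i ≠ k → j ≠ k → Finset.univ = {i, j, k} := by decide
  have hsum : m i + m j + m k = 0 := by
    have h1 := h.traceE
    have h2 := h.traceH
    rw [trace_diagonal, huniv i j k hij hik hjk, Finset.sum_insert (by simp [hij, hik]),
      Finset.sum_insert (by simp [hjk]), Finset.sum_singleton] at h1 h2
    apply Complex.ext <;> simp [hm] <;> linarith
  have hk : m k = -2 * m i := by linear_combination hsum + hmij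
  have hi : m i ≠ 0 := by
    intro h0
    have hz : ∀ l, m l = 0 := by
      intro l
      rcases hall i j k l hij hik hjk with rfl | rfl | rfl
      · exact h0
      · exact hmij ▸ h0
      · rw [hk, h0, mul_zero]
    have hd : diagonal d = 0 := by
      rw [diagonal_eq_zero]
      ext l
      have := congrArg Complex.re (hz l)
      simpa [hm] using this
    have hd' : diagonal d' = 0 := by
      rw [diagonal_eq_zero]
      ext l
      have := congrArg Complex.im (hz l)
      simpa [hm] using this
    apply hW
    rw [← pull_one W, ← mul_nonsing_inv _ h.frame.det_pos.ne'.isUnit, pull_mul, h.eq, hd, hd',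
      weylOf_zero, pull_zero]
  refine ⟨m i, hi, hk ▸ heig k, ?_⟩
  rw [h.finrank_eigenspace, hM]
  refine finrank_eigenspace_diagonal m hij hik hjk hmij fun h => hi ?_
  linear_combination (-1 / 3 : ℂ) * h + (1 / 3 : ℂ) * hk

theorem isTypeI_or_isTypeD_of_not_isRadiative {G : Mat} {W : Tensor4} (hG : IsLorentzian G)
    (hW : IsWeylTensor G W) (hW0 : W ≠ 0) (hr : ¬IsRadiative G W) :
    IsTypeI G W ∨ IsTypeD G W := by
  obtain ⟨u, hu, hs⟩ : ∃ u, IsObserver G u ∧ stressFlux G W u = 0 := by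
    simpa [IsRadiative] using hr
  obtain ⟨P, hP, rfl⟩ := exists_isFrame hG hu
  obtain ⟨E, H, h⟩ := hP.exists_hasParts hW
  have hc := mul_comm_of_belRobinson_eq_zero h.symmE h.symmH h.traceE h.traceH
    (h.stressFlux_eq_zero_iff.1 hs)
  obtain ⟨P', x, y, x', y', -, h'⟩ := h.exists_diagonal hW hc
  exact h'.isTypeI_or_isTypeD hW0

end SuperEnergy
end

noncomputable section

namespace SuperEnergy

open Matrix

/-! ### The proper electric and magnetic tensors -/

theorem not_linearIndependent_pair_iff {n : Type*} {A B : Matrix n n ℝ} :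
    ¬LinearIndependent ℝ ![A, B] ↔ ∀ a b c d, A a b * B c d = B a b * A c d := by
  rw [LinearIndependent.pair_iff]
  constructor
  · intro h a b c d
    push Not at h
    obtain ⟨s, t, hst, h0⟩ := h
    have e (i j) : s * A i j + t * B i j = 0 := congrFun (congrFun hst i) j
    by_cases hs : s = 0
    · have ht := h0 hs
      have hB (i j) : B i j = 0 := by simpa [hs, ht] using e i j
      rw [hB, hB, mul_zero, zero_mul]
    · apply mul_left_cancel₀ hs
      linear_combination B c d * e a b - B a b * e c d
  · intro h hli
    -- Each pair of entries of B and -A is the pair of coefficients of a vanishing combination;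
    -- independence would make both matrices zero, a contradiction.
    have hz (c d) : B c d = 0 ∧ -A c d = 0 := hli (B c d) (-A c d) (by
      ext a b
      simp only [Matrix.add_apply, Matrix.smul_apply, smul_eq_mul, Matrix.zero_apply]
      linear_combination h a b c d)
    have hA : (1 : ℝ) = 0 := (hli 1 1 (by
      ext a b
      simp [(hz a b).1, neg_eq_zero.1 (hz a b).2])).1
    exact one_ne_zero hA

theorem electric_weylOf_diagonal (x y z : ℝ) (H : Matrix (Fin 3) (Fin 3) ℝ) :
    electric (weylOf (diagonal ![x, y, z]) H) timeVec = diagonal ![0, x, y, z] := by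
  ext a b
  rw [electric_timeVec]
  revert a b
  refine forall_fin_four.2 ⟨?_, ?_, ?_, ?_⟩ <;> refine forall_fin_four.2 ⟨?_, ?_, ?_, ?_⟩ <;>
    simp [weylOf, biv]

/-- Congruence by an invertible matrix preserves linear independence. -/
theorem linearIndependent_congruence {P A B : Mat} (hP : IsUnit P.det) :
    LinearIndependent ℝ ![Pᵀ * A * P, Pᵀ * B * P] ↔ LinearIndependent ℝ ![A, B] := by
  let f : Mat →ₗ[ℝ] Mat :=
    { toFun := fun X => Pᵀ * X * P
      map_add' := fun X Y => by rw [Matrix.mul_add, Matrix.add_mul]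
      map_smul' := fun c X => by rw [Matrix.mul_smul, Matrix.smul_mul, RingHom.id_apply] }
  have hf : LinearMap.ker f = ⊥ := by
    rw [LinearMap.ker_eq_bot']
    intro X hX
    have hX : Pᵀ * X * P = 0 := hX
    calc X = (P * P⁻¹)ᵀ * X * (P * P⁻¹) := by
          rw [mul_nonsing_inv _ hP, transpose_one, Matrix.one_mul, Matrix.mul_one]
      _ = P⁻¹ᵀ * (Pᵀ * X * P) * P⁻¹ := by rw [transpose_mul]; simp only [Matrix.mul_assoc]
      _ = 0 := by rw [hX, Matrix.mul_zero, Matrix.zero_mul]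
  have : f ∘ ![A, B] = ![Pᵀ * A * P, Pᵀ * B * P] := by
    ext i : 1
    fin_cases i <;> rfl
  rw [← this, LinearMap.linearIndependent_iff f hf]

theorem HasParts.electric {G P : Mat} {W : Tensor4} {E H : Matrix (Fin 3) (Fin 3) ℝ}
    (h : HasParts G W P E H) : SuperEnergy.electric (weylOf E H) timeVec =
      Pᵀ * SuperEnergy.electric W (P *ᵥ timeVec) * P := by
  rw [← h.eq, electric_pull]

theorem HasParts.magnetic {G P : Mat} {W : Tensor4} {E H : Matrix (Fin 3) (Fin 3) ℝ}
    (h : HasParts G W P E H) : SuperEnergy.electric (weylOf H (-E)) timeVec =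
      Pᵀ * SuperEnergy.magnetic G W (P *ᵥ timeVec) * P := by
  rw [← dual_weylOf, ← h.eq, ← magnetic_pull P G h.frame.det_pos, h.frame.congruence]
  rfl

/-- The third diagonal entries are minus the sum of the first two, so every 2×2 minor of the two
diagonals is, up to sign, xy' - yx' or zero. -/
theorem HasParts.not_linearIndependent_iff {G P : Mat} {W : Tensor4} {x y x' y' : ℝ}
    (h : HasParts G W P (diagonal ![x, y, -x - y]) (diagonal ![x', y', -x' - y'])) :
    ¬LinearIndependent ℝ ![SuperEnergy.electric W (P *ᵥ timeVec),
      SuperEnergy.magnetic G W (P *ᵥ timeVec)] ↔ x * y' - y * x' = 0 := by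
  rw [← linearIndependent_congruence h.frame.det_pos.ne'.isUnit, ← h.electric, ← h.magnetic,
    electric_weylOf_diagonal, electric_weylOf_diagonal, not_linearIndependent_pair_iff]
  constructor
  · intro h
    have := h 1 1 2 2
    simp at this
    linarith
  · intro h a b c d
    have key : ∀ a c : Fin 4, (![0, x, y, -x - y] : Vec) a * (![0, x', y', -x' - y'] : Vec) c =
        (![0, x', y', -x' - y'] : Vec) a * (![0, x, y, -x - y] : Vec) c := by
      refine forall_fin_four.2 ⟨?_, ?_, ?_, ?_⟩ <;> refine forall_fin_four.2 ⟨?_, ?_, ?_, ?_⟩ <;>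
        simp <;> linarith
    rw [diagonal_apply, diagonal_apply, diagonal_apply, diagonal_apply]
    split_ifs
    · exact key a c
    all_goals simp

/-! ### The proper stress flux tensor -/

theorem HasParts.stressFlux_eq_zero_iff_diagonal {G P : Mat} {W : Tensor4} {x y x' y' : ℝ}
    (h : HasParts G W P (diagonal ![x, y, -x - y]) (diagonal ![x', y', -x' - y'])) :
    stressFlux G W (P *ᵥ timeVec) = 0 ↔ x * y' - y * x' = 0 := by
  rw [h.stressFlux_eq_zero_iff]
  simp only [belRobinson_diagonal]
  constructor
  · intro h
    have := h 0 1 2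
    simp [diagBelRobinson] at this
    linarith
  · intro h
    have hw : (y * x' - x * y') / 2 = 0 := by linarith
    rw [hw]
    intro i j k
    fin_cases i <;> fin_cases j <;> fin_cases k <;> simp [diagBelRobinson]

/-! ### The scalar invariants -/

theorem HasParts.xi_eq {G P : Mat} {W : Tensor4} {d d' : Fin 3 → ℝ}
    (h : HasParts G W P (diagonal d) (diagonal d')) :
    xi G W = (1 / 4) * ∑ i, (d i ^ 2 + d' i ^ 2) := by
  rw [xi, h.charpoly, weylMatrix_diagonal, charpoly_diagonal]
  have : (∏ i, (Polynomial.X - Polynomial.C (⟨-d i, d' i⟩ : ℂ))) =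
      (Multiset.map (fun a => Polynomial.X - Polynomial.C a)
        (Multiset.map (fun i => (⟨-d i, d' i⟩ : ℂ)) Finset.univ.val)).prod := by
    rw [Multiset.map_map]
    rfl
  rw [this, Polynomial.roots_multiset_prod_X_sub_C, Multiset.map_map]
  change 1 / 4 * ∑ i, ‖(⟨-d i, d' i⟩ : ℂ)‖ ^ 2 = _
  congr 1
  refine Finset.sum_congr rfl fun i _ => ?_
  rw [← Complex.normSq_eq_norm_sq, Complex.normSq_apply]
  ring

theorem alpha_minkowski (W : Tensor4) : alpha minkowski W = (1 / 2) * √(∑ a, ∑ b,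
    (![-1, 1, 1, 1] : Vec) a * ((![-1, 1, 1, 1] : Vec) b *
      minkowskiInner (of (belRobinson minkowski W a b)) (of (belRobinson minkowski W a b)))) := by
  rw [alpha]
  congr 2
  refine Finset.sum_congr rfl fun a _ => Finset.sum_congr rfl fun b _ => ?_
  simp only [minkowskiInner, Finset.mul_sum, of_apply]
  refine Finset.sum_congr rfl fun c _ => Finset.sum_congr rfl fun d _ => ?_
  simp only [minkowski_inv, mul_assoc, ← Finset.mul_sum, sum_minkowski_mul]

/-- The radicand is |tr M²|², so α is half the modulus of the trace of M². -/
theorem HasParts.alpha_eq {G P : Mat} {W : Tensor4} {x y x' y' : ℝ}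
    (h : HasParts G W P (diagonal ![x, y, -x - y]) (diagonal ![x', y', -x' - y'])) :
    alpha G W = (1 / 2) * √(4 * (x ^ 2 + x * y + y ^ 2 - x' ^ 2 - x' * y' - y' ^ 2) ^ 2 +
      4 * (2 * x * x' + 2 * y * y' + x * y' + y * x') ^ 2) := by
  rw [← alpha_pull P G h.frame.det_pos, h.frame.congruence, h.eq, alpha_minkowski]
  have e (a b : Fin 4) : of (belRobinson minkowski (weylOf (diagonal ![x, y, -x - y])
      (diagonal ![x', y', -x' - y'])) a b) = diagBelRobinson
        ((y ^ 2 + y' ^ 2 + x * y + x' * y') / 2) ((x ^ 2 + x' ^ 2 + x * y + x' * y') / 2)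
        (-(x * y + x' * y') / 2) ((y * x' - x * y') / 2) a b := by
    ext c d
    exact belRobinson_diagonal x y x' y' a b c d
  simp only [e]
  congr 2
  simp only [Fin.sum_univ_four, diagBelRobinson, minkowskiInner_of, cons_val]
  ring

end SuperEnergy
end

noncomputable section

namespace SuperEnergy

open Matrix

/-! ### The proper scalar of the stress flux -/

/-- The left side does not mention the frame, so |E|² - |H|² and E·H are the same for all observers.
-/
theorem HasParts.trace_mul_self {G P : Mat} {W : Tensor4} {E H : Matrix (Fin 3) (Fin 3) ℝ}
    (h : HasParts G W P E H) : LinearMap.trace ℂ _ (weylEnd G W ∘ₗ weylEnd G W) =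
      ⟨∑ i, ∑ j, E i j ^ 2 - ∑ i, ∑ j, H i j ^ 2, -2 * ∑ i, ∑ j, E i j * H i j⟩ := by
  obtain ⟨e, he⟩ := h.exists_conj
  rw [he, ← LinearEquiv.conj_comp, LinearMap.trace_conj', ← toLin'_mul, trace_toLin'_eq, trace]
  have hs (i j) := (weylMatrix_isSymm h.symmE h.symmH).apply i j
  simp only [diag_apply, mul_apply]
  have : ∀ i j, weylMatrix E H i j * weylMatrix E H j i =
      ⟨E i j ^ 2 - H i j ^ 2, -2 * (E i j * H i j)⟩ := by
    intro i j
    rw [hs i j, weylMatrix_apply]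
    apply Complex.ext
    · simp
      ring
    · simp
      ring
  simp only [this]
  apply Complex.ext
  · simp [Complex.re_sum]
  · simp [Complex.im_sum, Finset.mul_sum]

theorem HasParts.xi_le {G P : Mat} {W : Tensor4} {E H : Matrix (Fin 3) (Fin 3) ℝ}
    (h : HasParts G W P E H) :
    xi G W ≤ (1 / 4) * (∑ i, ∑ j, E i j ^ 2 + ∑ i, ∑ j, H i j ^ 2) := by
  have key := sum_norm_sq_roots_charpoly_le (weylMatrix E H)
  rw [xi, h.charpoly]
  have : ∀ i j, ‖weylMatrix E H i j‖ ^ 2 = E i j ^ 2 + H i j ^ 2 := by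
    intro i j
    rw [← Complex.normSq_eq_norm_sq, weylMatrix_apply, Complex.normSq_apply]
    ring
  simp only [this, Finset.sum_add_distrib] at key
  linarith

theorem xi_nonneg (G : Mat) (W : Tensor4) : 0 ≤ xi G W := by
  refine mul_nonneg (by norm_num) (Multiset.sum_nonneg fun x hx => ?_)
  obtain ⟨ρ, -, rfl⟩ := Multiset.mem_map.1 hx
  positivity

/-- A lower bound for the stress flux relative to an arbitrary observer. -/
theorem le_stressFluxScalar {G : Mat} {W : Tensor4} (hG : IsLorentzian G) (hW : IsWeylTensor G W)
    {u : Vec} (hu : IsObserver G u) :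
    16 * xi G W ^ 2 - Complex.normSq (LinearMap.trace ℂ _ (weylEnd G W ∘ₗ weylEnd G W)) ≤
      96 * stressFluxScalar G W u ^ 2 := by
  obtain ⟨P, hP, rfl⟩ := exists_isFrame hG hu
  obtain ⟨E, H, h⟩ := hP.exists_hasParts hW
  rw [h.trace_mul_self, ← stressFluxScalar_pull P G hP.det_pos, hP.congruence, h.eq,
    Complex.normSq_mk]
  have h1 := sum_sq_mul_sum_sq_sub_le h.symmE h.symmH h.traceE h.traceH
  have h2 := h.xi_le
  have h3 : xi G W ^ 2 ≤ ((1 / 4) * (∑ i, ∑ j, E i j ^ 2 + ∑ i, ∑ j, H i j ^ 2)) ^ 2 :=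
    pow_le_pow_left₀ (xi_nonneg G W) h2 2
  -- With e = |E|² and h = |H|², the terms (e + h)² - (e - h)² = 4eh turn the bound into four times
  -- the Gram determinant, whence 96 = 4·24.
  linarith

theorem HasParts.sixteen_mul_xi_sq_sub {G P : Mat} {W : Tensor4} {x y x' y' : ℝ}
    (h : HasParts G W P (diagonal ![x, y, -x - y]) (diagonal ![x', y', -x' - y'])) :
    16 * xi G W ^ 2 - Complex.normSq (LinearMap.trace ℂ _ (weylEnd G W ∘ₗ weylEnd G W)) =
      12 * (x * y' - y * x') ^ 2 := by
  rw [h.trace_mul_self, h.xi_eq, Complex.normSq_mk]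
  simp [Fin.sum_univ_three]
  ring

/-- The radicand is a nonnegative multiple of a square, so the square root does not truncate a
negative value. -/
theorem HasParts.xiQ_eq_zero_iff {G P : Mat} {W : Tensor4} {x y x' y' : ℝ}
    (h : HasParts G W P (diagonal ![x, y, -x - y]) (diagonal ![x', y', -x' - y'])) :
    xiQ G W = 0 ↔ x * y' - y * x' = 0 := by
  have e : 2 * xi G W ^ 2 - 1 / 2 * alpha G W ^ 2 = 3 / 2 * (x * y' - y * x') ^ 2 := by
    rw [h.xi_eq, h.alpha_eq, mul_pow, mul_pow (1 / 2) (√_), Real.sq_sqrt (by positivity)]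
    simp [Fin.sum_univ_three]
    ring
  rw [xiQ, e, Real.sqrt_eq_zero (by positivity)]
  simp

theorem HasParts.sq_le_stressFluxScalar {G P : Mat} {W : Tensor4} {x y x' y' : ℝ}
    (h : HasParts G W P (diagonal ![x, y, -x - y]) (diagonal ![x', y', -x' - y']))
    (hG : IsLorentzian G) (hW : IsWeylTensor G W) {u : Vec} (hu : IsObserver G u) :
    (x * y' - y * x') ^ 2 ≤ 8 * stressFluxScalar G W u ^ 2 := by
  have := le_stressFluxScalar hG hW hu
  rw [h.sixteen_mul_xi_sq_sub] at this
  linarith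

theorem stressFluxScalar_of_stressFlux_eq_zero {G : Mat} {W : Tensor4} {u : Vec}
    (h : stressFlux G W u = 0) : stressFluxScalar G W u = 0 := by
  simp [stressFluxScalar, h]

theorem HasParts.properStressFluxScalar_eq_zero_iff {G P : Mat} {W : Tensor4} {x y x' y' : ℝ}
    (h : HasParts G W P (diagonal ![x, y, -x - y]) (diagonal ![x', y', -x' - y']))
    (hG : IsLorentzian G) (hW : IsWeylTensor G W) :
    properStressFluxScalar G W = 0 ↔ x * y' - y * x' = 0 := by
  have hne : (stressFluxScalar G W '' {u | IsObserver G u}).Nonempty :=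
    ⟨_, P *ᵥ timeVec, h.frame.isObserver, rfl⟩
  constructor
  · intro h0
    -- The bound is uniform in the observer, so a vanishing infimum forces xy' = yx' even without
    -- assuming that it is attained.
    have : √((x * y' - y * x') ^ 2 / 8) ≤ properStressFluxScalar G W := by
      refine le_csInf hne ?_
      rintro _ ⟨u, hu, rfl⟩
      refine Real.sqrt_le_iff.2 ⟨Real.sqrt_nonneg _, ?_⟩
      have := h.sq_le_stressFluxScalar hG hW hu
      linarith
    rw [h0] at this
    have := Real.sqrt_eq_zero'.1 (le_antisymm this (Real.sqrt_nonneg _))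
    have h2 := sq_nonneg (x * y' - y * x')
    exact pow_eq_zero_iff two_ne_zero |>.1 (by linarith)
  · intro h0
    refine IsLeast.csInf_eq ⟨⟨P *ᵥ timeVec, h.frame.isObserver,
      stressFluxScalar_of_stressFlux_eq_zero (h.stressFlux_eq_zero_iff_diagonal.2 h0)⟩, ?_⟩
    rintro _ ⟨u, -, rfl⟩
    exact Real.sqrt_nonneg _

theorem HasParts.not_isRadiative_iff {G P : Mat} {W : Tensor4} {x y x' y' : ℝ}
    (h : HasParts G W P (diagonal ![x, y, -x - y]) (diagonal ![x', y', -x' - y']))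
    (hG : IsLorentzian G) (hW : IsWeylTensor G W) :
    ¬IsRadiative G W ↔ x * y' - y * x' = 0 := by
  constructor
  · intro hr
    obtain ⟨u, hu, hs⟩ : ∃ u, IsObserver G u ∧ stressFlux G W u = 0 := by
      simpa [IsRadiative] using hr
    have := h.sq_le_stressFluxScalar hG hW hu
    rw [stressFluxScalar_of_stressFlux_eq_zero hs] at this
    have h2 := sq_nonneg (x * y' - y * x')
    exact pow_eq_zero_iff two_ne_zero |>.1 (by linarith)
  · intro h0 hr
    exact hr _ h.frame.isObserver (h.stressFlux_eq_zero_iff_diagonal.2 h0)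

end SuperEnergy
end

noncomputable section

namespace SuperEnergy

open Matrix

/-! ### The eigenvalues of the Bel-Robinson tensor -/

theorem sum_inv_mul_eq_trace {G : Mat} (X : CMat) :
    ∑ a, ∑ b, ((G⁻¹ a b : ℝ) : ℂ) * X a b = trace ((G⁻¹.map Complex.ofReal)ᵀ * X) := by
  rw [trace, Finset.sum_comm]
  rfl

theorem isBelRobinsonEigenvalue_pull {P G : Mat} (hP : 0 < P.det) {W : Tensor4} {z : ℂ}
    (h : IsBelRobinsonEigenvalue G W z) :
    IsBelRobinsonEigenvalue (Pᵀ * G * P) (pull P W) z := by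
  obtain ⟨X, hX, hs, ht, he⟩ := h
  have hu := hP.ne'.isUnit
  refine ⟨congrC P X, fun h0 => hX ?_, ?_, ?_, ?_⟩
  · rw [← congrC_one X, ← mul_nonsing_inv _ hu, congrC_mul, h0, congrC, Matrix.mul_zero,
      Matrix.zero_mul]
  · rw [IsSymm, congrC_transpose, hs]
  · rw [sum_inv_mul_eq_trace] at ht ⊢
    have hm (A B : Mat) : (A * B).map Complex.ofReal = A.map Complex.ofReal * B.map Complex.ofReal :=
      Matrix.map_mul (f := Complex.ofRealHom)
    have hi : P.map Complex.ofReal * P⁻¹.map Complex.ofReal = 1 := by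
      rw [← hm, mul_nonsing_inv _ hu]
      exact Matrix.map_one _ Complex.ofReal_zero Complex.ofReal_one
    have e : (Pᵀ * G * P)⁻¹ = P⁻¹ * G⁻¹ * P⁻¹ᵀ := by
      rw [Matrix.mul_inv_rev, Matrix.mul_inv_rev, transpose_nonsing_inv, Matrix.mul_assoc]
    have hi' : (P⁻¹.map Complex.ofReal)ᵀ * (P.map Complex.ofReal)ᵀ = 1 := by
      rw [← transpose_mul, hi, transpose_one]
    rw [e, hm, hm, transpose_mul, transpose_mul, ← transpose_map, transpose_transpose, congrC,
      ← ht]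
    calc _ = trace (P⁻¹.map Complex.ofReal * ((G⁻¹.map Complex.ofReal)ᵀ *
          (((P⁻¹.map Complex.ofReal)ᵀ * (P.map Complex.ofReal)ᵀ) * X) * P.map Complex.ofReal)) := by
          simp only [Matrix.mul_assoc]
      _ = _ := by
          rw [hi', Matrix.one_mul, trace_mul_comm, Matrix.mul_assoc, hi, Matrix.mul_one]
  · rw [belRobinsonApply_eq, pull_belRobinson P G hP, tensorApply_pull P G hu,
      ← belRobinsonApply_eq, he, congrC_smul]

theorem HasParts.isBelRobinsonEigenvalue_iff {G P : Mat} {W : Tensor4}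
    {E H : Matrix (Fin 3) (Fin 3) ℝ} (h : HasParts G W P E H) (z : ℂ) :
    IsBelRobinsonEigenvalue G W z ↔ IsBelRobinsonEigenvalue minkowski (weylOf E H) z := by
  have hu := h.frame.det_pos.ne'.isUnit
  constructor
  · intro hz
    have := isBelRobinsonEigenvalue_pull h.frame.det_pos hz
    rwa [h.frame.congruence, h.eq] at this
  · intro hz
    have hQ : 0 < P⁻¹.det := by
      rw [det_nonsing_inv, Ring.inverse_eq_inv']
      exact inv_pos.2 h.frame.det_pos
    have := isBelRobinsonEigenvalue_pull hQ hz
    rw [← h.eq, ← pull_mul, mul_nonsing_inv _ hu, pull_one, ← h.frame.congruence] at this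
    have e : P⁻¹ᵀ * (Pᵀ * G * P) * P⁻¹ = G := by
      calc P⁻¹ᵀ * (Pᵀ * G * P) * P⁻¹ = (P * P⁻¹)ᵀ * G * (P * P⁻¹) := by
            rw [transpose_mul]; simp only [Matrix.mul_assoc]
        _ = G := by rw [mul_nonsing_inv _ hu, transpose_one, Matrix.one_mul, Matrix.mul_one]
    rwa [e] at this

theorem sum_minkowski_inv_mul (X : CMat) : ∑ a, ∑ b, ((minkowski⁻¹ a b : ℝ) : ℂ) * X a b =
    -X 0 0 + X 1 1 + X 2 2 + X 3 3 := by
  rw [minkowski_inv]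
  simp [minkowski, Fin.sum_univ_four, diagonal_apply]

/-- The action of the Bel-Robinson tensor of a diagonal Weyl tensor. -/
theorem tensorApply_diagBelRobinson (A B C w : ℝ) {X : CMat} (hX : X.IsSymm) :
    tensorApply minkowski (fun a b c d => diagBelRobinson A B C w a b c d) X =
      !![(A + B + C) * X 0 0 + A * X 1 1 + B * X 2 2 + C * X 3 3, -2 * A * X 0 1 + 2 * w * X 2 3,
          -2 * B * X 0 2 + 2 * w * X 1 3, -2 * C * X 0 3 + 2 * w * X 1 2;
        -2 * A * X 0 1 + 2 * w * X 2 3, A * X 0 0 + (A + B + C) * X 1 1 - C * X 2 2 - B * X 3 3,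
          -2 * C * X 1 2 - 2 * w * X 0 3, -2 * B * X 1 3 - 2 * w * X 0 2;
        -2 * B * X 0 2 + 2 * w * X 1 3, -2 * C * X 1 2 - 2 * w * X 0 3,
          B * X 0 0 - C * X 1 1 + (A + B + C) * X 2 2 - A * X 3 3, -2 * A * X 2 3 - 2 * w * X 0 1;
        -2 * C * X 0 3 + 2 * w * X 1 2, -2 * B * X 1 3 - 2 * w * X 0 2,
          -2 * A * X 2 3 - 2 * w * X 0 1,
          C * X 0 0 - B * X 1 1 - A * X 2 2 + (A + B + C) * X 3 3] := by
  have h1 := hX.apply 0 1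
  have h2 := hX.apply 0 2
  have h3 := hX.apply 0 3
  have h4 := hX.apply 1 2
  have h5 := hX.apply 1 3
  have h6 := hX.apply 2 3
  ext a b
  rw [tensorApply_minkowski]
  revert a b
  refine forall_fin_four.2 ⟨?_, ?_, ?_, ?_⟩ <;> refine forall_fin_four.2 ⟨?_, ?_, ?_, ?_⟩ <;>
    simp [Fin.sum_univ_four, diagBelRobinson, h1, h2, h3, h4, h5, h6] <;> ring

/-- The entries X₀₁ and X₂₃ span an invariant plane with the matrix (-2A, 2w; -2w, -2A) and
eigenvalues -2A ± 2iw; the other off-diagonal entries pair up in the same way with B or C. Diagonal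
traceless arrays contribute only real eigenvalues. -/
theorem isBelRobinsonEigenvalue_diagonal_iff (x y x' y' : ℝ) :
    (∀ z, IsBelRobinsonEigenvalue minkowski
      (weylOf (diagonal ![x, y, -x - y]) (diagonal ![x', y', -x' - y'])) z → z.im = 0) ↔
      x * y' - y * x' = 0 := by
  have e : belRobinson minkowski (weylOf (diagonal ![x, y, -x - y])
      (diagonal ![x', y', -x' - y'])) = fun a b c d => diagBelRobinson
        ((y ^ 2 + y' ^ 2 + x * y + x' * y') / 2) ((x ^ 2 + x' ^ 2 + x * y + x' * y') / 2)
        (-(x * y + x' * y') / 2) ((y * x' - x * y') / 2) a b c d := by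
    funext a b c d
    exact belRobinson_diagonal x y x' y' a b c d
  simp only [IsBelRobinsonEigenvalue, belRobinsonApply_eq, e, sum_minkowski_inv_mul]
  generalize (y ^ 2 + y' ^ 2 + x * y + x' * y') / 2 = A,
    (x ^ 2 + x' ^ 2 + x * y + x' * y') / 2 = B, -(x * y + x' * y') / 2 = C
  constructor
  · intro h
    set w := (y * x' - x * y') / 2 with hw
    have hX : (!![0, 1, 0, 0; 1, 0, 0, 0; 0, 0, 0, Complex.I; 0, 0, Complex.I, 0] : CMat).IsSymm := by
      ext a b
      revert a b
      simp [forall_fin_four]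
    -- The array with X₀₁ = 1 and X₂₃ = i is an eigenvector for this number, whose reality forces w
    -- = 0.
    have := h (-2 * A + 2 * w * Complex.I) ⟨_, fun h0 => ?_, hX, by simp, ?_⟩
    · simp [hw] at this
      linarith
    · simpa using congrFun (congrFun h0 0) 1
    · rw [tensorApply_diagBelRobinson A B C w hX]
      ext a b
      revert a b
      refine forall_fin_four.2 ⟨?_, ?_, ?_, ?_⟩ <;> refine forall_fin_four.2 ⟨?_, ?_, ?_, ?_⟩ <;>
        simp <;> linear_combination -2 * w * Complex.I_sq
  · rintro h0 z ⟨X, hX, hs, ht, hz⟩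
    have hw : (y * x' - x * y') / 2 = 0 := by linarith
    rw [hw, tensorApply_diagBelRobinson A B C 0 hs] at hz
    by_contra hne
    -- For w = 0 the operator is diagonal in real coordinates with real eigenvalues, so a non-real z
    -- annihilates each coordinate.
    have key {r : ℝ} {t : ℂ} (h : r * t = z * t) : t = 0 := by
      have : ((r : ℂ) - z) * t = 0 := by linear_combination h
      refine (mul_eq_zero.1 this).resolve_left fun h => hne ?_
      rw [← sub_eq_zero.1 h, Complex.ofReal_im]
    have q (i j) := congrFun (congrFun hz i) j
    have q00 := q 0 0
    have q11 := q 1 1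
    have q22 := q 2 2
    have q33 := q 3 3
    have q01 := q 0 1
    have q02 := q 0 2
    have q03 := q 0 3
    have q12 := q 1 2
    have q13 := q 1 3
    have q23 := q 2 3
    simp at q00 q11 q22 q33 q01 q02 q03 q12 q13 q23
    have r01 : X 0 1 = 0 := key (r := -2 * A) (by push_cast; linear_combination q01)
    have r02 : X 0 2 = 0 := key (r := -2 * B) (by push_cast; linear_combination q02)
    have r03 : X 0 3 = 0 := key (r := -2 * C) (by push_cast; linear_combination q03)
    have r12 : X 1 2 = 0 := key (r := -2 * C) (by push_cast; linear_combination q12)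
    have r13 : X 1 3 = 0 := key (r := -2 * B) (by push_cast; linear_combination q13)
    have r23 : X 2 3 = 0 := key (r := -2 * A) (by push_cast; linear_combination q23)
    -- Three eigenforms on the diagonal entries; together with the trace they determine all four
    -- entries.
    have s1 : -X 0 0 + X 1 1 - X 2 2 - X 3 3 = 0 :=
      key (r := 2 * (B + C)) (by push_cast; linear_combination -q00 + q11 - q22 - q33)
    have s2 : -X 0 0 - X 1 1 + X 2 2 - X 3 3 = 0 :=
      key (r := 2 * (A + C)) (by push_cast; linear_combination -q00 - q11 + q22 - q33)
    have s3 : -X 0 0 - X 1 1 - X 2 2 + X 3 3 = 0 :=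
      key (r := 2 * (A + B)) (by push_cast; linear_combination -q00 - q11 - q22 + q33)
    have t0 : X 0 0 = 0 := by linear_combination (-1 / 4 : ℂ) * (ht + s1 + s2 + s3)
    have t1 : X 1 1 = 0 := by linear_combination (1 / 4 : ℂ) * (ht + s1 - s2 - s3)
    have t2 : X 2 2 = 0 := by linear_combination (1 / 4 : ℂ) * (ht - s1 + s2 - s3)
    have t3 : X 3 3 = 0 := by linear_combination (1 / 4 : ℂ) * (ht - s1 - s2 + s3)
    apply hX
    ext a b
    revert a b
    refine forall_fin_four.2 ⟨?_, ?_, ?_, ?_⟩ <;> refine forall_fin_four.2 ⟨?_, ?_, ?_, ?_⟩ <;>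
      simp [*, hs.apply 0 1, hs.apply 0 2, hs.apply 0 3, hs.apply 1 2, hs.apply 1 3, hs.apply 2 3]

/-! ### The characterisation of the non-radiative fields -/

/-- Since `e₀` is at rest, one of its frames makes E and H diagonal; there each of the seven
conditions becomes xy' - yx' = 0. -/
theorem not_isRadiative_tfae {G : Mat} {W : Tensor4} (hG : IsLorentzian G) (hW : IsWeylTensor G W)
    {e₀ : Vec} (he : IsAtRest G W e₀) : List.TFAE [
      ¬IsRadiative G W,
      stressFlux G W e₀ = 0,
      ¬LinearIndependent ℝ ![electric W e₀, magnetic G W e₀],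
      ∀ a b c d, electric W e₀ a b * magnetic G W e₀ c d =
        magnetic G W e₀ a b * electric W e₀ c d,
      properStressFluxScalar G W = 0,
      xiQ G W = 0,
      ∀ z : ℂ, IsBelRobinsonEigenvalue G W z → z.im = 0] := by
  obtain ⟨P, hP, rfl⟩ := exists_isFrame hG he.1
  obtain ⟨E, H, h⟩ := hP.exists_hasParts hW
  obtain ⟨P', x, y, x', y', hPP, h'⟩ := h.exists_diagonal hW (h.superPoynting_eq_zero_iff.1 he.2)
  rw [← hPP, ← not_linearIndependent_pair_iff, h'.not_linearIndependent_iff,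
    h'.not_isRadiative_iff hG hW, h'.stressFlux_eq_zero_iff_diagonal,
    h'.properStressFluxScalar_eq_zero_iff hG hW, h'.xiQ_eq_zero_iff]
  simp only [h'.isBelRobinsonEigenvalue_iff, isBelRobinsonEigenvalue_diagonal_iff]
  tfae_finish

end SuperEnergy
end


/-- A nonzero Weyl tensor which is non-radiative is of type I or D, and the non-radiative fields of
these types are characterised by their proper quantities. -/
theorem mainTheorem4 (U : Set SuperEnergy.Vec) (g : SuperEnergy.Vec → SuperEnergy.Mat)
    (hg : SuperEnergy.IsLorentzianMetricOn g U) (p : SuperEnergy.Vec) (hp : p ∈ U)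
    (hW : SuperEnergy.weyl g p ≠ 0) :
    (¬ SuperEnergy.IsRadiative (g p) (SuperEnergy.weyl g p) →
      SuperEnergy.IsTypeI (g p) (SuperEnergy.weyl g p) ∨
        SuperEnergy.IsTypeD (g p) (SuperEnergy.weyl g p)) ∧
    ((SuperEnergy.IsTypeI (g p) (SuperEnergy.weyl g p) ∨
        SuperEnergy.IsTypeD (g p) (SuperEnergy.weyl g p)) →
      (∃ e₀, SuperEnergy.IsAtRest (g p) (SuperEnergy.weyl g p) e₀) ∧
      ∀ e₀, SuperEnergy.IsAtRest (g p) (SuperEnergy.weyl g p) e₀ →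
        List.TFAE [
          ¬ SuperEnergy.IsRadiative (g p) (SuperEnergy.weyl g p),
          SuperEnergy.stressFlux (g p) (SuperEnergy.weyl g p) e₀ = 0,
          ¬ LinearIndependent ℝ
            ![SuperEnergy.electric (SuperEnergy.weyl g p) e₀,
              SuperEnergy.magnetic (g p) (SuperEnergy.weyl g p) e₀],
          ∀ a b c d,
            SuperEnergy.electric (SuperEnergy.weyl g p) e₀ a b *
                SuperEnergy.magnetic (g p) (SuperEnergy.weyl g p) e₀ c d =
              SuperEnergy.magnetic (g p) (SuperEnergy.weyl g p) e₀ a b *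
                SuperEnergy.electric (SuperEnergy.weyl g p) e₀ c d,
          SuperEnergy.properStressFluxScalar (g p) (SuperEnergy.weyl g p) = 0,
          SuperEnergy.xiQ (g p) (SuperEnergy.weyl g p) = 0,
          ∀ z : ℂ, SuperEnergy.IsBelRobinsonEigenvalue (g p) (SuperEnergy.weyl g p) z →
            z.im = 0]) := by
  have hG := hg.lorentzian p hp
  have hWeyl := SuperEnergy.IsLorentzianMetricOn.isWeylTensor hg hp
  exact ⟨SuperEnergy.isTypeI_or_isTypeD_of_not_isRadiative hG hWeyl hW, fun hT =>
    ⟨SuperEnergy.exists_isAtRest hG hWeyl hT, fun _ he =>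
      SuperEnergy.not_isRadiative_tfae hG hWeyl he⟩⟩
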